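/- Let $d\in\mathbb C$. A Kauffman diagram of type $(m,n)$ consists of $m$ marked points on the upper and $n$ marked points on the lower edge of a rectangle, joined in pairs by non-crossing strings inside the rectangle, up to planar isotopy. Let $\mathcal K_d$ be the Temperley–Lieb category: the objects are the non-negative integers $n$, written $X^{\otimes n}$ (with $I=X^{\otimes 0}$, $X=X^{\otimes 1}$), $\mathrm{Hom}(X^{\otimes n},X^{\otimes m})$ is the complex vector space with basis the Kauffman diagrams of type $(m,n)$, composition is bilinear concatenation with every closed loop replaced by the factor $d$, and $\otimes$ is horizontal juxtaposition. Let $\mathrm{tr}$ be the Markov trace on $\mathrm{End}(X^{\otimes k})$ (close each diagram completely and replace each loop by $d$), and let $h_k=1_{X^{\otimes (k-1)}}\otimes(\delta\epsilon)\in\mathrm{End}(X^{\otimes(k+1)})$, where $\epsilon:X\otimes X\to I$ and $\delta:I\to X\otimes X$ are the arcs. Let $\widetilde{\mathcal K}_d$ be the idempotent completion, whose objects are the pairs $pY=(p,Y)$ with $p=p^2\in\mathrm{End}(Y)$ and $\mathrm{Hom}(pY,p'Y')=p'\,\mathrm{Hom}(Y,Y')\,p$, with $pY\otimes p'Y'=(p\otimes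 p')(Y\otimes Y')$. A finite-dimensional linear category is called essentially semisimple if for every finite family of its objects the endomorphism algebra of their formal direct sum is semisimple. **Proposition.** Let $d=q+q^{-1}$ with $q\in\mathbb C^\times$, and put $[k]_q=\sum_{i=0}^{k-1}q^{k-1-2i}$ (which equals $(q^k-q^{-k})/(q-q^{-1})$ if $q\ne\pm1$). Let $n\ge 0$ and assume that $[k]_q\neq0$ for $1\le k\le n$. Then the full linear subcategory of $\mathcal K_d$ on $\{I,X,\dots,X^{\otimes n}\}$ is essentially semisimple. Moreover there are idempotents $f_k\in\mathrm{End}(X^{\otimes k})$, $0\le k\le n$, with $f_0=1_I$, $f_1=1_X$ (if $n\geq 1$) and $$f_{k+1}=f_k\otimes1_X-\frac{[k]_q}{[k+1]_q}\,(f_k\otimes1_X)\,h_k\,(f_k\otimes1_X)\qquad(1\le k<n),$$ such that $\mathrm{tr}(f_k)=[k+1]_q$ for $0\le k\le n$, and such that the objects $X_k=f_kX^{\otimes k}$ of $\widetilde{\mathcal K}_d$ satisfy: 1. $X_k\ne0$ and $\mathrm{End}(X_k)=\mathbb C\,1_{X_k}$ for $0\le k\le n$ (the $X_k$ are simple), and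 $\mathrm{Hom}(X_j,X_k)=0$ for $j\ne k$ in $\{0,\dots,n\}$; 2. every object $pX^{\otimes m}$ of $\widetilde{\mathcal K}_d$ with $m\le n$ is isomorphic to a finite direct sum of objects among $X_0,\dots,X_n$; 3. $X_k\otimes X\cong X_{k-1}\oplus X_{k+1}$ for $1\le k<n$; 4. for $0\le k\le n$, $X^{\otimes k}$ has a decomposition as a finite direct sum of objects among $X_0,\dots,X_k$ in which $X_k$ occurs exactly once, and the projection of $X^{\otimes k}$ onto that summand is $f_k$. -/

import Mathlib

open CategoryTheory

namespace TemperleyLieb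

/-! ### Generalities on images of equivalence relations -/

section Generalities

variable {A B C D : Type}

theorem map_le_iff {r : Setoid A} {f : A → B} {s : Setoid B} :
    r.map f ≤ s ↔ ∀ x y, r x y → s (f x) (f y) := by
  constructor
  · intro h x y hxy
    exact h (Setoid.le_comap_map hxy)
  · intro h
    refine Setoid.eqvGen_le ?_
    rintro _ _ ⟨x, y, hxy, rfl, rfl⟩
    exact h x y hxy

theorem map_rel {r : Setoid A} (f : A → B) {x y : A} (h : r x y) : r.map f (f x) (f y) :=
  Setoid.le_comap_map h

theorem map_sup (r s : Setoid A) (f : A → B) : (r ⊔ s).map f = r.map f ⊔ s.map f := by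
  apply le_antisymm
  · have h : r ⊔ s ≤ (r.map f ⊔ s.map f).comap f :=
      sup_le (fun x y h => (le_sup_left : r.map f ≤ _) (map_rel f h))
        (fun x y h => (le_sup_right : s.map f ≤ _) (map_rel f h))
    exact map_le_iff.2 fun x y hxy => h hxy
  · refine sup_le (map_le_iff.2 fun x y h => map_rel f ?_) (map_le_iff.2 fun x y h => map_rel f ?_)
    · exact (le_sup_left : r ≤ r ⊔ s) h
    · exact (le_sup_right : s ≤ r ⊔ s) h

theorem map_map (r : Setoid A) (f : A → B) (g : B → C) : (r.map f).map g = r.map (g ∘ f) := by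
  apply le_antisymm
  · have h : r.map f ≤ (r.map (g ∘ f)).comap g :=
      map_le_iff.2 fun x y h => map_rel (g ∘ f) h
    exact map_le_iff.2 fun x y hxy => h hxy
  · exact map_le_iff.2 fun x y h => map_rel g (map_rel f h)

/-- The number of classes of `r` that do not meet the range of `f`. -/
noncomputable def missed (r : Setoid B) (f : A → B) : ℕ :=
  Nat.card {c : Quotient r // ∀ a, Quotient.mk r (f a) ≠ c}

/-! Contracting a part of a relation: `V` is covered by `U` and `W`, which overlap in `B`. -/

section Contract

variable {U W V E : Type} (s : Setoid U) (t : Setoid W) (j : U → V) (i : W → V)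
  (b : B → U) (b' : B → W)

theorem contract (hj : Function.Injective j) (hi : Function.Injective i)
    (hb : ∀ x, j (b x) = i (b' x))
    (hov : ∀ u w, j u = i w → ∃ x, u = b x ∧ w = b' x) :
    (∀ w w', (s.map j ⊔ t.map i) (i w) (i w') ↔ ((s.comap b).map b' ⊔ t) w w') ∧
    (∀ u v, (s.map j ⊔ t.map i) (j u) v →
      (∃ x, s u (b x)) ∨ ∃ u', v = j u' ∧ s u u') := by
  set T := (s.comap b).map b' ⊔ t with hT
  have hTs : ∀ x y, s (b x) (b y) → T (b' x) (b' y) := fun x y h =>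
    (le_sup_left : _ ≤ T) (map_rel (r := s.comap b) b' h)
  have hTt : ∀ x y, t x y → T x y := fun x y h => (le_sup_right : t ≤ T) h
  let ρ : V → W → Prop := fun v w => v = i w ∨ ∃ u x, v = j u ∧ s u (b x) ∧ w = b' x
  have hρ : ∀ v w w', ρ v w → ρ v w' → T w w' := by
    rintro v w w' (rfl | ⟨u, x, rfl, hu, rfl⟩) (h | ⟨u', x', h, hu', rfl⟩)
    · rw [hi h]
    · obtain ⟨y, rfl, rfl⟩ := hov _ _ h.symm
      exact hTs _ _ hu'
    · obtain ⟨y, rfl, rfl⟩ := hov _ _ h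
      exact hTs _ _ (s.symm hu)
    · cases hj h
      exact hTs _ _ (s.trans (s.symm hu) hu')
  have hρj : ∀ u w u', ρ (j u) w → s u u' → ∃ x, s u (b x) ∧ ρ (j u') w := by
    rintro u w u' (h | ⟨u1, x, h, hu, rfl⟩) huu'
    · obtain ⟨y, rfl, rfl⟩ := hov _ _ h
      exact ⟨y, s.refl _, Or.inr ⟨u', y, rfl, s.symm huu', rfl⟩⟩
    · cases hj h
      exact ⟨x, hu, Or.inr ⟨u', x, rfl, s.trans (s.symm huu') hu, rfl⟩⟩
  let P : V → V → Prop := fun v v' =>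
    (∃ w w', ρ v w ∧ ρ v' w' ∧ T w w') ∨ v = v' ∨ ∃ u u', v = j u ∧ v' = j u' ∧ s u u'
  have hP : Equivalence P := by
    refine ⟨fun v => Or.inr (Or.inl rfl), ?_, ?_⟩
    · rintro v v' (⟨w, w', h, h', ht⟩ | rfl | ⟨u, u', h, h', hs⟩)
      · exact Or.inl ⟨w', w, h', h, T.symm ht⟩
      · exact Or.inr (Or.inl rfl)
      · exact Or.inr (Or.inr ⟨u', u, h', h, s.symm hs⟩)
    · rintro v v' v'' (⟨w, w', h, h', ht⟩ | rfl | ⟨u, u', rfl, rfl, hs⟩) h2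
      · rcases h2 with (⟨w1, w1', h1, h1', ht1⟩ | rfl | ⟨u, u', rfl, rfl, hs⟩)
        · exact Or.inl ⟨w, w1', h, h1', T.trans ht (T.trans (hρ _ _ _ h' h1) ht1)⟩
        · exact Or.inl ⟨w, w', h, h', ht⟩
        · obtain ⟨x, hx, hx'⟩ := hρj _ _ _ h' hs
          exact Or.inl ⟨w, w', h, hx', ht⟩
      · exact h2
      · rcases h2 with (⟨w1, w1', h1, h1', ht1⟩ | rfl | ⟨u1, u1', h1, rfl, hs1⟩)
        · obtain ⟨x, hx, hx'⟩ := hρj _ _ _ h1 (s.symm hs)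
          exact Or.inl ⟨w1, w1', hx', h1', ht1⟩
        · exact Or.inr (Or.inr ⟨u, u', rfl, rfl, hs⟩)
        · cases hj h1
          exact Or.inr (Or.inr ⟨u, u1', rfl, rfl, s.trans hs hs1⟩)
  have hle : s.map j ⊔ t.map i ≤ ⟨P, hP⟩ := by
    refine sup_le (map_le_iff.2 fun u u' h => ?_) (map_le_iff.2 fun w w' h => ?_)
    · exact Or.inr (Or.inr ⟨u, u', rfl, rfl, h⟩)
    · exact Or.inl ⟨w, w', Or.inl rfl, Or.inl rfl, hTt _ _ h⟩
  refine ⟨fun w w' => ⟨fun h => ?_, fun h => ?_⟩, fun u v h => ?_⟩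
  · rcases hle h with (⟨w1, w1', h1, h1', ht1⟩ | h1 | ⟨u1, u1', h1, h1', hs1⟩)
    · exact T.trans (hρ _ _ _ (Or.inl rfl) h1) (T.trans ht1 (hρ _ _ _ h1' (Or.inl rfl)))
    · rw [hi h1]
    · obtain ⟨x, rfl, rfl⟩ := hov _ _ h1.symm
      obtain ⟨x', rfl, rfl⟩ := hov _ _ h1'.symm
      exact hTs _ _ hs1
  · have : T ≤ (s.map j ⊔ t.map i).comap i := by
      refine sup_le (map_le_iff.2 fun x y h => ?_) (fun x y h => ?_)
      · change (s.map j ⊔ t.map i) (i (b' x)) (i (b' y))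
        rw [← hb, ← hb]
        exact (le_sup_left : s.map j ≤ _) (map_rel j h)
      · exact (le_sup_right : t.map i ≤ _) (map_rel i h)
    exact this h
  · rcases hle h with (⟨w1, w1', (h1 | ⟨u', x, h1, hu, rfl⟩), h1', ht1⟩ | h1 | ⟨u1, u1', h1, h1', hs1⟩)
    · obtain ⟨x, rfl, rfl⟩ := hov _ _ h1
      exact Or.inl ⟨x, s.refl _⟩
    · cases hj h1
      exact Or.inl ⟨x, hu⟩
    · exact Or.inr ⟨u, h1.symm, s.refl _⟩
    · cases hj h1
      exact Or.inr ⟨u1', h1', hs1⟩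

theorem contract_missed [Finite U] [Finite W] (hj : Function.Injective j)
    (hi : Function.Injective i) (hb : ∀ x, j (b x) = i (b' x))
    (hov : ∀ u w, j u = i w → ∃ x, u = b x ∧ w = b' x)
    (hcov : ∀ v, (∃ u, v = j u) ∨ ∃ w, v = i w) (o : E → W)
    (ho : ∀ e u, i (o e) = j u → ∃ x, u = b x) :
    missed (s.map j ⊔ t.map i) (i ∘ o) =
      missed s b + missed ((s.comap b).map b' ⊔ t) o := by
  obtain ⟨h1, h2⟩ := contract s t j i b b' hj hi hb hov
  set R := s.map j ⊔ t.map i with hR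
  set T := (s.comap b).map b' ⊔ t with hT
  have hsR : ∀ u u', s u u' → R (j u) (j u') := fun u u' h =>
    (le_sup_left : s.map j ≤ R) (map_rel j h)
  let F1 : Quotient s → Quotient R := Quotient.map j hsR
  let F2 : Quotient T → Quotient R := Quotient.map i fun w w' h => (h1 w w').2 h
  let F : {c : Quotient s // ∀ a, Quotient.mk s (b a) ≠ c} ⊕
      {c : Quotient T // ∀ a, Quotient.mk T (o a) ≠ c} →
      {c : Quotient R // ∀ a, Quotient.mk R ((i ∘ o) a) ≠ c} :=
    Sum.elim
      (fun c => ⟨F1 c.1, by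
        obtain ⟨c, hc⟩ := c
        induction c using Quotient.inductionOn with
        | h u =>
          intro a ha
          have := R.symm (Quotient.exact ha)
          rcases h2 _ _ this with ⟨x, hx⟩ | ⟨u', h, hu⟩
          · exact hc x (Quotient.sound (s.symm hx))
          · obtain ⟨x, rfl⟩ := ho _ _ h
            exact hc x (Quotient.sound (s.symm hu))⟩)
      (fun c => ⟨F2 c.1, by
        obtain ⟨c, hc⟩ := c
        induction c using Quotient.inductionOn with
        | h w =>
          intro a ha
          exact hc a (Quotient.sound ((h1 _ _).1 (Quotient.exact ha)))⟩)
  have hF : Function.Bijective F := by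
    constructor
    · rintro (⟨c, hc⟩ | ⟨c, hc⟩) (⟨c', hc'⟩ | ⟨c', hc'⟩) h <;>
        induction c using Quotient.inductionOn with
        | h u => ?_
      all_goals
        induction c' using Quotient.inductionOn with
        | h u' => ?_
      all_goals
        have h' := Quotient.exact (congrArg Subtype.val h)
      · rcases h2 _ _ h' with ⟨x, hx⟩ | ⟨u1, h, hu⟩
        · exact absurd (Quotient.sound (s.symm hx)) (hc x)
        · cases hj h
          congr 2
          exact Quotient.sound hu
      · exfalso
        rcases h2 _ _ h' with ⟨x, hx⟩ | ⟨u1, h, hu⟩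
        · exact absurd (Quotient.sound (s.symm hx)) (hc x)
        · obtain ⟨x, rfl, rfl⟩ := hov _ _ h.symm
          exact hc x (Quotient.sound (s.symm hu))
      · exfalso
        rcases h2 _ _ (R.symm h') with ⟨x, hx⟩ | ⟨u1, h, hu⟩
        · exact absurd (Quotient.sound (s.symm hx)) (hc' x)
        · obtain ⟨x, rfl, rfl⟩ := hov _ _ h.symm
          exact hc' x (Quotient.sound (s.symm hu))
      · congr 2
        exact Quotient.sound ((h1 _ _).1 h')
    · rintro ⟨c, hc⟩
      induction c using Quotient.inductionOn with
      | h v =>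
        have key : ∀ w, v = i w → ∃ y, F y = ⟨Quotient.mk R v, hc⟩ := by
          rintro w rfl
          refine ⟨Sum.inr ⟨Quotient.mk T w, fun a ha => ?_⟩, rfl⟩
          exact hc a (Quotient.sound ((h1 _ _).2 (Quotient.exact ha)))
        rcases hcov v with ⟨u, rfl⟩ | ⟨w, rfl⟩
        · by_cases hu : ∃ x, s u (b x)
          · obtain ⟨x, hx⟩ := hu
            have hcl : R (j u) (i (b' x)) := by
              rw [← hb]
              exact hsR _ _ hx
            have hq : Quotient.mk R (j u) = Quotient.mk R (i (b' x)) := Quotient.sound hcl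
            refine ⟨Sum.inr ⟨Quotient.mk T (b' x), fun a ha => ?_⟩, Subtype.ext hq.symm⟩
            refine hc a (Eq.trans ?_ hq.symm)
            exact Quotient.sound ((h1 _ _).2 (Quotient.exact ha))
          · refine ⟨Sum.inl ⟨Quotient.mk s u, fun a ha => ?_⟩, rfl⟩
            exact hu ⟨a, s.symm (Quotient.exact ha)⟩
        · exact key w rfl
  have := Nat.card_eq_of_bijective F hF
  rw [Nat.card_sum] at this
  exact this.symm

end Contract

/-! Disjoint unions of equivalence relations. -/

section Disjoint

variable {A' C' : Type} (r : Setoid A) (r' : Setoid A') (e : A → C) (e' : A' → C)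

theorem disjoint_rel (he : Function.Injective e) (he' : Function.Injective e')
    (hd : ∀ x y, e x ≠ e' y) :
    (∀ x y, (r.map e ⊔ r'.map e') (e x) y ↔ ∃ x', y = e x' ∧ r x x') ∧
    (∀ x y, (r.map e ⊔ r'.map e') (e' x) y ↔ ∃ x', y = e' x' ∧ r' x x') := by
  let P : C → C → Prop := fun c c' =>
    c = c' ∨ (∃ x x', c = e x ∧ c' = e x' ∧ r x x') ∨ (∃ x x', c = e' x ∧ c' = e' x' ∧ r' x x')
  have hP : Equivalence P := by
    refine ⟨fun c => Or.inl rfl, ?_, ?_⟩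
    · rintro c c' (rfl | ⟨x, x', rfl, rfl, h⟩ | ⟨x, x', rfl, rfl, h⟩)
      · exact Or.inl rfl
      · exact Or.inr (Or.inl ⟨_, _, rfl, rfl, r.symm h⟩)
      · exact Or.inr (Or.inr ⟨_, _, rfl, rfl, r'.symm h⟩)
    · rintro c c' c'' (rfl | ⟨x, x', rfl, rfl, h⟩ | ⟨x, x', rfl, rfl, h⟩) h2
      · exact h2
      · rcases h2 with rfl | ⟨y, y', h3, rfl, h4⟩ | ⟨y, y', h3, rfl, h4⟩
        · exact Or.inr (Or.inl ⟨_, _, rfl, rfl, h⟩)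
        · cases he h3
          exact Or.inr (Or.inl ⟨_, _, rfl, rfl, r.trans h h4⟩)
        · exact absurd h3 (hd _ _)
      · rcases h2 with rfl | ⟨y, y', h3, rfl, h4⟩ | ⟨y, y', h3, rfl, h4⟩
        · exact Or.inr (Or.inr ⟨_, _, rfl, rfl, h⟩)
        · exact absurd h3.symm (hd _ _)
        · cases he' h3
          exact Or.inr (Or.inr ⟨_, _, rfl, rfl, r'.trans h h4⟩)
  have hle : r.map e ⊔ r'.map e' ≤ ⟨P, hP⟩ :=
    sup_le (map_le_iff.2 fun x y h => Or.inr (Or.inl ⟨_, _, rfl, rfl, h⟩))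
      (map_le_iff.2 fun x y h => Or.inr (Or.inr ⟨_, _, rfl, rfl, h⟩))
  refine ⟨fun x y => ⟨fun h => ?_, ?_⟩, fun x y => ⟨fun h => ?_, ?_⟩⟩
  · rcases hle h with rfl | ⟨y, y', h3, rfl, h4⟩ | ⟨y, y', h3, rfl, h4⟩
    · exact ⟨_, rfl, r.refl _⟩
    · cases he h3
      exact ⟨_, rfl, h4⟩
    · exact absurd h3 (hd _ _)
  · rintro ⟨x', rfl, h⟩
    exact (le_sup_left : r.map e ≤ _) (map_rel e h)
  · rcases hle h with rfl | ⟨y, y', h3, rfl, h4⟩ | ⟨y, y', h3, rfl, h4⟩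
    · exact ⟨_, rfl, r'.refl _⟩
    · exact absurd h3.symm (hd _ _)
    · cases he' h3
      exact ⟨_, rfl, h4⟩
  · rintro ⟨x', rfl, h⟩
    exact (le_sup_right : r'.map e' ≤ _) (map_rel e' h)

theorem disjoint_missed [Finite A] [Finite A'] (he : Function.Injective e)
    (he' : Function.Injective e') (hd : ∀ x y, e x ≠ e' y)
    (hcov : ∀ c, (∃ x, c = e x) ∨ ∃ x, c = e' x) {O O' P : Type} (o : O → A) (o' : O' → A')
    (p : P → C) (hp : ∀ x, (∃ y, p y = e x) ↔ ∃ y, o y = x)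
    (hp' : ∀ x, (∃ y, p y = e' x) ↔ ∃ y, o' y = x) :
    missed (r.map e ⊔ r'.map e') p = missed r o + missed r' o' := by
  obtain ⟨h1, h2⟩ := disjoint_rel r r' e e' he he' hd
  set R := r.map e ⊔ r'.map e' with hR
  let F1 : Quotient r → Quotient R := Quotient.map e fun x y h => (h1 _ _).2 ⟨y, rfl, h⟩
  let F2 : Quotient r' → Quotient R := Quotient.map e' fun x y h => (h2 _ _).2 ⟨y, rfl, h⟩
  let F : {c : Quotient r // ∀ a, Quotient.mk r (o a) ≠ c} ⊕
      {c : Quotient r' // ∀ a, Quotient.mk r' (o' a) ≠ c} →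
      {c : Quotient R // ∀ a, Quotient.mk R (p a) ≠ c} :=
    Sum.elim
      (fun c => ⟨F1 c.1, by
        obtain ⟨c, hc⟩ := c
        induction c using Quotient.inductionOn with
        | h u =>
          intro a ha
          obtain ⟨x, hx, hx'⟩ := (h1 _ _).1 (R.symm (Quotient.exact ha))
          obtain ⟨y, rfl⟩ := (hp x).1 ⟨a, hx⟩
          exact hc y (Quotient.sound (r.symm hx'))⟩)
      (fun c => ⟨F2 c.1, by
        obtain ⟨c, hc⟩ := c
        induction c using Quotient.inductionOn with
        | h u =>
          intro a ha
          obtain ⟨x, hx, hx'⟩ := (h2 _ _).1 (R.symm (Quotient.exact ha))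
          obtain ⟨y, rfl⟩ := (hp' x).1 ⟨a, hx⟩
          exact hc y (Quotient.sound (r'.symm hx'))⟩)
  have hF : Function.Bijective F := by
    constructor
    · rintro (⟨c, hc⟩ | ⟨c, hc⟩) (⟨c', hc'⟩ | ⟨c', hc'⟩) h <;>
        induction c using Quotient.inductionOn with
        | h u => ?_
      all_goals
        induction c' using Quotient.inductionOn with
        | h u' => ?_
      all_goals
        have h' := Quotient.exact (congrArg Subtype.val h)
      · obtain ⟨x, hx, hx'⟩ := (h1 _ _).1 h'
        cases he hx
        congr 2
        exact Quotient.sound hx'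
      · obtain ⟨x, hx, hx'⟩ := (h1 _ _).1 h'
        exact absurd hx.symm (hd _ _)
      · obtain ⟨x, hx, hx'⟩ := (h2 _ _).1 h'
        exact absurd hx (hd _ _)
      · obtain ⟨x, hx, hx'⟩ := (h2 _ _).1 h'
        cases he' hx
        congr 2
        exact Quotient.sound hx'
    · rintro ⟨c, hc⟩
      induction c using Quotient.inductionOn with
      | h v =>
        rcases hcov v with ⟨u, rfl⟩ | ⟨u, rfl⟩
        · refine ⟨Sum.inl ⟨Quotient.mk r u, fun a ha => ?_⟩, rfl⟩
          obtain ⟨y, hy⟩ := (hp (o a)).2 ⟨a, rfl⟩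
          refine hc y ?_
          rw [hy]
          exact congrArg F1 ha
        · refine ⟨Sum.inr ⟨Quotient.mk r' u, fun a ha => ?_⟩, rfl⟩
          obtain ⟨y, hy⟩ := (hp' (o' a)).2 ⟨a, rfl⟩
          refine hc y ?_
          rw [hy]
          exact congrArg F2 ha
  have := Nat.card_eq_of_bijective F hF
  rw [Nat.card_sum] at this
  exact this.symm

end Disjoint

/-! Orbits of a pair of involutions. -/

theorem exists_unique_end [Finite A] (R : Setoid A) (S T : A → A)
    (hS : Function.Involutive S) (hT : Function.Involutive T)
    (hR : ∀ (Q : Setoid A), (∀ x, Q x (S x)) → (∀ x, Q x (T x)) → R ≤ Q)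
    (hRS : ∀ x, R x (S x)) (hRT : ∀ x, R x (T x)) (x : A) (hx : T x = x) (hx' : S x ≠ x) :
    ∃! y, (y ≠ x ∧ R x y) ∧ (S y = y ∨ T y = y) := by
  let p : Equiv.Perm A := hT.toPerm * hS.toPerm
  have hp : ∀ y, p y = T (S y) := fun y => rfl
  have hpi : ∀ y, p⁻¹ y = S (T y) := by
    intro y
    rw [Equiv.Perm.inv_eq_iff_eq, hp, hS, hT]
  have hTp : ∀ k : ℤ, ∀ y, T ((p ^ k) y) = (p ^ (-k)) (T y) := by
    intro k
    induction k using Int.induction_on with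
    | zero => intro y; simp
    | succ k ih =>
      intro y
      rw [zpow_add_one, Equiv.Perm.mul_apply, ih, hp, hT, neg_add, zpow_add,
        Equiv.Perm.mul_apply, zpow_neg_one, hpi, hT]
    | pred k ih =>
      intro y
      rw [zpow_sub_one, Equiv.Perm.mul_apply, ih, neg_sub, sub_eq_add_neg, add_comm, zpow_add,
        Equiv.Perm.mul_apply, zpow_one, hp, hpi]
  have hTx : ∀ k : ℤ, T ((p ^ k) x) = (p ^ (-k)) x := fun k => by rw [hTp, hx]
  have hSx : ∀ k : ℤ, S ((p ^ k) x) = (p ^ (-(k + 1))) x := by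
    intro k
    rw [← hTx, add_comm, zpow_add, zpow_one, Equiv.Perm.mul_apply, hp, hT]
  have hRp : ∀ y, R x y ↔ ∃ k : ℤ, y = (p ^ k) x := by
    let Q : Setoid A := ⟨fun y z => (∃ k : ℤ, y = (p ^ k) x) ↔ ∃ k : ℤ, z = (p ^ k) x,
      fun _ => Iff.rfl, fun h => h.symm, fun h h' => h.trans h'⟩
    have hQ : R ≤ Q := by
      refine hR Q (fun y => ⟨?_, ?_⟩) (fun y => ⟨?_, ?_⟩)
      · rintro ⟨k, rfl⟩
        exact ⟨_, hSx k⟩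
      · rintro ⟨k, hk⟩
        exact ⟨-(k + 1), by rw [← hSx, ← hk, hS]⟩
      · rintro ⟨k, rfl⟩
        exact ⟨_, hTx k⟩
      · rintro ⟨k, hk⟩
        exact ⟨-k, by rw [← hTx, ← hk, hT]⟩
    intro y
    constructor
    · intro h
      exact (hQ h).1 ⟨0, rfl⟩
    · rintro ⟨k, rfl⟩
      induction k using Int.induction_on with
      | zero => exact R.refl _
      | succ k ih =>
        rw [add_comm, zpow_add, zpow_one, Equiv.Perm.mul_apply, hp]
        exact R.trans ih (R.trans (hRS _) (hRT _))
      | pred k ih =>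
        rw [sub_eq_add_neg, add_comm, zpow_add, zpow_neg_one, Equiv.Perm.mul_apply, hpi]
        exact R.trans ih (R.trans (hRT _) (hRS _))
  set L := Function.minimalPeriod (p • ·) x with hL
  have hper : ∀ k : ℤ, (p ^ k) x = x ↔ (L : ℤ) ∣ k := fun k =>
    MulAction.zpow_smul_eq_iff_minimalPeriod_dvd (a := p) (b := x) (n := k)
  have hLpos : 0 < L := by
    apply Function.minimalPeriod_pos_of_mem_periodicPts
    obtain ⟨m, hm, h⟩ := isOfFinOrder_iff_pow_eq_one.1 (isOfFinOrder_of_finite p)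
    refine ⟨m, hm, ?_⟩
    rw [Function.IsPeriodicPt, Function.IsFixedPt, smul_iterate, h]
    rfl
  have hL1 : L ≠ 1 := by
    intro h
    apply hx'
    have := hSx 0
    rw [zpow_zero, Equiv.Perm.one_apply] at this
    rw [this, hper, h]
    exact one_dvd _
  have heq : ∀ k l : ℤ, (p ^ k) x = (p ^ l) x ↔ (L : ℤ) ∣ k - l := by
    intro k l
    rw [← hper, sub_eq_neg_add, zpow_add, Equiv.Perm.mul_apply, zpow_neg,
      Equiv.Perm.inv_eq_iff_eq]
  have hfix : ∀ k : ℤ, (S ((p ^ k) x) = (p ^ k) x ∨ T ((p ^ k) x) = (p ^ k) x) ↔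
      ((L : ℤ) ∣ 2 * k + 1 ∨ (L : ℤ) ∣ 2 * k) := by
    intro k
    rw [hSx, hTx, heq, heq, ← dvd_neg, ← dvd_neg (b := -k - k)]
    ring_nf
  refine ⟨(p ^ ((L / 2 : ℕ) : ℤ)) x, ⟨⟨?_, (hRp _).2 ⟨_, rfl⟩⟩, ?_⟩, ?_⟩
  · rw [Ne, hper]
    intro h
    have := Nat.le_of_dvd (by omega) (Int.natCast_dvd_natCast.1 h)
    omega
  · rw [hfix]
    rcases Nat.even_or_odd' L with ⟨m, hm | hm⟩
    · right
      exact ⟨1, by omega⟩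
    · left
      exact ⟨1, by omega⟩
  · rintro y ⟨⟨hy, hy'⟩, hy''⟩
    obtain ⟨k, rfl⟩ := (hRp _).1 hy'
    rw [hfix] at hy''
    rw [Ne, hper] at hy
    rw [heq]
    rcases Nat.even_or_odd' L with ⟨m, hm | hm⟩
    · have h2 : L / 2 = m := by omega
      rcases hy'' with ⟨c, hc⟩ | ⟨c, hc⟩
      · exfalso
        rw [hm] at hc
        push_cast at hc
        rw [mul_assoc] at hc
        omega
      · rw [hm] at hc hy ⊢
        have hk : k = m * c := by
          push_cast at hc
          rw [mul_assoc] at hc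
          omega
        rcases Int.even_or_odd' c with ⟨c', rfl | rfl⟩
        · exact absurd ⟨c', by rw [hk]; push_cast; ring⟩ hy
        · refine ⟨c', ?_⟩
          rw [← hm, h2, hk]
          rw [hm]
          push_cast
          ring
    · have h2 : L / 2 = m := by omega
      rcases hy'' with h | h
      · have hd : (L : ℤ) ∣ 2 * (k - (L / 2 : ℕ)) := by
          have : (2 * (k - (L / 2 : ℕ)) : ℤ) = 2 * k + 1 - L := by omega
          rw [this]
          exact dvd_sub_self_right.2 h
        refine IsCoprime.dvd_of_dvd_mul_left ?_ hd
        exact ⟨1, -m, by rw [hm]; push_cast; ring⟩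
      · refine absurd (IsCoprime.dvd_of_dvd_mul_left ?_ h) hy
        exact ⟨1, -m, by rw [hm]; push_cast; ring⟩

end Generalities

/-! ### Gluing relations along a common row of points -/

section Gluing

variable {α β γ δ : Type}

/-- Points of the first and third row inside the union of three rows. -/
def outer : α ⊕ γ → α ⊕ β ⊕ γ := Sum.map id Sum.inr

/-- The equivalence relation on three rows of points generated by `r` on the first two rows and
`s` on the last two. -/
def glue (r : Setoid (α ⊕ β)) (s : Setoid (β ⊕ γ)) : Setoid (α ⊕ β ⊕ γ) :=
  r.map (Sum.map id Sum.inl) ⊔ s.map Sum.inr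

/-- Stacking: two points of the first and third row are related if they are connected through
the glued picture. -/
def stack (r : Setoid (α ⊕ β)) (s : Setoid (β ⊕ γ)) : Setoid (α ⊕ γ) :=
  (glue r s).comap outer

/-- The number of connected components of the glued picture which do not reach the first or
third row. -/
noncomputable def innerComponents (r : Setoid (α ⊕ β)) (s : Setoid (β ⊕ γ)) : ℕ :=
  missed (glue r s) outer

/-- The relation pairing each point with its copy in the other row. -/
def idRel (α : Type) : Setoid (α ⊕ α) := Setoid.ker (Sum.elim id id)

theorem outer_injective : Function.Injective (outer : α ⊕ γ → α ⊕ β ⊕ γ) := by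
  rintro (x | x) (y | y) h <;> simp_all [outer]

def e12 : α ⊕ β ⊕ γ → α ⊕ β ⊕ γ ⊕ δ :=
  Sum.map id (Sum.map id Sum.inl)

def e23 : β ⊕ γ ⊕ δ → α ⊕ β ⊕ γ ⊕ δ := Sum.inr

def e13 : α ⊕ γ ⊕ δ → α ⊕ β ⊕ γ ⊕ δ := Sum.map id Sum.inr

def e123 : α ⊕ β ⊕ δ → α ⊕ β ⊕ γ ⊕ δ := Sum.map id (Sum.map id Sum.inr)

theorem inj12 : Function.Injective (e12 : α ⊕ β ⊕ γ → α ⊕ β ⊕ γ ⊕ δ) := by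
  rintro (x | x | x) (y | y | y) h <;> simp_all [e12]

theorem inj23 : Function.Injective (e23 : β ⊕ γ ⊕ δ → α ⊕ β ⊕ γ ⊕ δ) :=
  Sum.inr_injective

theorem inj13 : Function.Injective (e13 : α ⊕ γ ⊕ δ → α ⊕ β ⊕ γ ⊕ δ) := by
  rintro (x | x | x) (y | y | y) h <;> simp_all [e13]

theorem inj123 : Function.Injective (e123 : α ⊕ β ⊕ δ → α ⊕ β ⊕ γ ⊕ δ) := by
  rintro (x | x | x) (y | y | y) h <;> simp_all [e123]

variable (r₁ : Setoid (α ⊕ β)) (r₂ : Setoid (β ⊕ γ)) (r₃ : Setoid (γ ⊕ δ))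

theorem glue_left : (glue r₁ r₂).map (e12 (δ := δ)) ⊔ (r₃.map Sum.inr).map e13 =
    (glue r₂ r₃).map (e23 (α := α)) ⊔ (r₁.map (Sum.map id Sum.inl)).map e123 := by
  simp only [glue, map_sup, map_map]
  have h1 : (e12 (α := α) (β := β) (γ := γ) (δ := δ)) ∘ Sum.map id Sum.inl =
      e123 ∘ Sum.map id Sum.inl := by
    funext x; rcases x with x | x <;> rfl
  have h2 : (e12 (α := α) (β := β) (γ := γ) (δ := δ)) ∘ Sum.inr =
      e23 ∘ Sum.map id Sum.inl := by
    funext x; rcases x with x | x <;> rfl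
  have h3 : (e13 (α := α) (β := β) (γ := γ) (δ := δ)) ∘ Sum.inr =
      e23 ∘ Sum.inr := by
    funext x; rcases x with x | x <;> rfl
  rw [h1, h2, h3, sup_assoc, sup_comm]

theorem glue_right_eq : glue r₁ (stack r₂ r₃) =
    ((glue r₂ r₃).comap outer).map Sum.inr ⊔ r₁.map (Sum.map id Sum.inl) := by
  rw [glue, stack, sup_comm]

theorem overlap12 (u : α ⊕ β ⊕ γ) (w : α ⊕ γ ⊕ δ) (h : e12 u = e13 w) :
    ∃ x : α ⊕ γ, u = outer x ∧ w = Sum.map id Sum.inl x := by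
  revert h
  rcases u with u | u | u <;> rcases w with w | w | w <;> intro h <;>
    simp [e12, e13, outer] at h ⊢
  · exact h.symm
  · exact h.symm

theorem overlap23 (u : β ⊕ γ ⊕ δ) (w : α ⊕ β ⊕ δ) (h : e23 u = e123 w) :
    ∃ x : β ⊕ δ, u = outer x ∧ w = Sum.inr x := by
  revert h
  rcases u with u | u | u <;> rcases w with w | w | w <;> intro h <;>
    simp [e23, e123, outer] at h ⊢
  · exact h
  · exact h

theorem stack_assoc : stack (stack r₁ r₂) r₃ = stack r₁ (stack r₂ r₃) := by
  have h1 := (contract (glue r₁ r₂) (r₃.map Sum.inr) (e12 (δ := δ)) e13 outer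
    (Sum.map id Sum.inl) inj12 inj13 (by rintro (x | x) <;> rfl) overlap12).1
  have h2 := (contract (glue r₂ r₃) (r₁.map (Sum.map id Sum.inl)) (e23 (α := α)) e123 outer
    Sum.inr inj23 inj123 (by rintro (x | x) <;> rfl) overlap23).1
  rw [glue_left] at h1
  rw [← glue_right_eq] at h2
  ext x y
  have h3 : ∀ x : α ⊕ δ, (e13 (outer x) : α ⊕ β ⊕ γ ⊕ δ) = e123 (outer x) := by
    rintro (x | x) <;> rfl
  have h1' := h1 (outer x) (outer y)
  have h2' := h2 (outer x) (outer y)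
  rw [h3, h3] at h1'
  exact h1'.symm.trans h2'

theorem innerComponents_assoc [Finite α] [Finite β] [Finite γ] [Finite δ] :
    innerComponents r₁ r₂ + innerComponents (stack r₁ r₂) r₃ =
      innerComponents r₂ r₃ + innerComponents r₁ (stack r₂ r₃) := by
  have h1 := contract_missed (glue r₁ r₂) (r₃.map Sum.inr) (e12 (δ := δ)) e13 outer
    (Sum.map id Sum.inl) inj12 inj13 (by rintro (x | x) <;> rfl) overlap12
    (by
      rintro (x | x | x | x)
      · exact Or.inl ⟨Sum.inl x, rfl⟩
      · exact Or.inl ⟨Sum.inr (Sum.inl x), rfl⟩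
      · exact Or.inl ⟨Sum.inr (Sum.inr x), rfl⟩
      · exact Or.inr ⟨Sum.inr (Sum.inr x), rfl⟩)
    (outer : α ⊕ δ → _) (by
      rintro x u h
      obtain ⟨y, hy, -⟩ := overlap12 u _ h.symm
      exact ⟨y, hy⟩)
  have h2 := contract_missed (glue r₂ r₃) (r₁.map (Sum.map id Sum.inl)) (e23 (α := α)) e123 outer
    Sum.inr inj23 inj123 (by rintro (x | x) <;> rfl) overlap23
    (by
      rintro (x | x | x | x)
      · exact Or.inr ⟨Sum.inl x, rfl⟩
      · exact Or.inl ⟨Sum.inl x, rfl⟩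
      · exact Or.inl ⟨Sum.inr (Sum.inl x), rfl⟩
      · exact Or.inl ⟨Sum.inr (Sum.inr x), rfl⟩)
    (outer : α ⊕ δ → _) (by
      rintro x u h
      obtain ⟨y, hy, -⟩ := overlap23 u _ h.symm
      exact ⟨y, hy⟩)
  rw [glue_left] at h1
  rw [← glue_right_eq] at h2
  have h3 : (e13 ∘ outer : α ⊕ δ → α ⊕ β ⊕ γ ⊕ δ) = e123 ∘ outer := by
    funext x
    rcases x with x | x <;> rfl
  rw [h3] at h1
  exact h1.symm.trans h2

theorem glue_idRel_left (r : Setoid (α ⊕ β)) :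
    glue (idRel α) r = r.comap (Sum.elim Sum.inl id) := by
  apply le_antisymm
  · refine sup_le (map_le_iff.2 ?_) (map_le_iff.2 ?_)
    · rintro (x | x) (y | y) h <;> cases (show x = y from h) <;> exact r.refl _
    · intro x y h
      exact h
  · have key : ∀ x : α ⊕ α ⊕ β, glue (idRel α) r x (Sum.inr (Sum.elim Sum.inl id x)) := by
      rintro (x | x)
      · exact (le_sup_left : _ ≤ glue (idRel α) r)
          (map_rel (r := idRel α) (Sum.map id Sum.inl) (x := Sum.inl x) (y := Sum.inr x) rfl)
      · exact (glue (idRel α) r).refl _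
    intro x y h
    refine (glue (idRel α) r).trans (key x) ((glue (idRel α) r).trans ?_ ((glue (idRel α) r).symm (key y)))
    exact (le_sup_right : _ ≤ glue (idRel α) r) (map_rel Sum.inr h)

theorem glue_idRel_right (r : Setoid (α ⊕ β)) :
    glue r (idRel β) = r.comap (Sum.elim Sum.inl (Sum.elim Sum.inr Sum.inr)) := by
  apply le_antisymm
  · refine sup_le (map_le_iff.2 ?_) (map_le_iff.2 ?_)
    · rintro (x | x) (y | y) h <;> exact h
    · rintro (x | x) (y | y) h <;> cases (show x = y from h) <;> exact r.refl _
  · have key : ∀ x : α ⊕ β ⊕ β, glue r (idRel β) x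
        (Sum.map id Sum.inl ((Sum.elim Sum.inl (Sum.elim Sum.inr Sum.inr) x : α ⊕ β))) := by
      rintro (x | x | x)
      · exact (glue r (idRel β)).refl _
      · exact (glue r (idRel β)).refl _
      · exact (le_sup_right : _ ≤ glue r (idRel β))
          (map_rel (r := idRel β) Sum.inr (x := Sum.inr x) (y := Sum.inl x) rfl)
    intro x y h
    refine (glue r (idRel β)).trans (key x) ((glue r (idRel β)).trans ?_ ((glue r (idRel β)).symm (key y)))
    exact (le_sup_left : _ ≤ glue r (idRel β)) (map_rel _ h)

theorem stack_idRel_left (r : Setoid (α ⊕ β)) : stack (idRel α) r = r := by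
  ext x y
  rw [stack, glue_idRel_left]
  rcases x with x | x <;> rcases y with y | y <;> rfl

theorem stack_idRel_right (r : Setoid (α ⊕ β)) : stack r (idRel β) = r := by
  ext x y
  rw [stack, glue_idRel_right]
  rcases x with x | x <;> rcases y with y | y <;> rfl

theorem missed_eq_zero {r : Setoid β} {f : α → β} (h : ∀ b, ∃ a, r (f a) b) :
    missed r f = 0 := by
  unfold missed
  rw [Nat.card_eq_zero]
  refine Or.inl ⟨?_⟩
  rintro ⟨c, hc⟩
  induction c using Quotient.inductionOn with
  | h b =>
    obtain ⟨a, ha⟩ := h b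
    exact hc a (Quotient.sound ha)

theorem innerComponents_idRel_left (r : Setoid (α ⊕ β)) : innerComponents (idRel α) r = 0 := by
  refine missed_eq_zero fun x => ?_
  rw [glue_idRel_left]
  rcases x with x | x | x
  · exact ⟨Sum.inl x, r.refl _⟩
  · exact ⟨Sum.inl x, r.refl _⟩
  · exact ⟨Sum.inr x, r.refl _⟩

theorem innerComponents_idRel_right (r : Setoid (α ⊕ β)) : innerComponents r (idRel β) = 0 := by
  refine missed_eq_zero fun x => ?_
  rw [glue_idRel_right]
  rcases x with x | x | x
  · exact ⟨Sum.inl x, r.refl _⟩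
  · exact ⟨Sum.inr x, r.refl _⟩
  · exact ⟨Sum.inr x, r.refl _⟩

/-! Perfect matchings. -/

/-- Every point is related to exactly one other point. -/
def IsMatching (r : Setoid α) : Prop := ∀ x, ∃! y, y ≠ x ∧ r x y

theorem IsMatching.exists_mate {r : Setoid α} (h : IsMatching r) :
    ∃ f : α → α, Function.Involutive f ∧ (∀ x, f x ≠ x) ∧ ∀ x y, r x y ↔ y = x ∨ y = f x := by
  choose f hf hf' using h
  have hf'' : ∀ x y, y ≠ x → r x y → y = f x := fun x y h1 h2 => hf' x y ⟨h1, h2⟩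
  refine ⟨f, fun x => ?_, fun x => (hf x).1, fun x y => ⟨fun h => ?_, ?_⟩⟩
  · exact (hf'' _ _ (hf x).1.symm (r.symm (hf x).2)).symm
  · by_cases hxy : y = x
    · exact Or.inl hxy
    · exact Or.inr (hf'' _ _ hxy h)
  · rintro (rfl | rfl)
    · exact r.refl _
    · exact (hf x).2

theorem stack_isMatching [Finite α] [Finite β] [Finite γ] {r : Setoid (α ⊕ β)}
    {s : Setoid (β ⊕ γ)} (hr : IsMatching r) (hs : IsMatching s) : IsMatching (stack r s) := by
  obtain ⟨f, hf, hf1, hf2⟩ := hr.exists_mate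
  obtain ⟨g, hg, hg1, hg2⟩ := hs.exists_mate
  let S : α ⊕ β ⊕ γ → α ⊕ β ⊕ γ := fun x =>
    Sum.elim (fun a => Sum.map id Sum.inl (f (Sum.inl a)))
      (Sum.elim (fun b => Sum.map id Sum.inl (f (Sum.inr b))) (fun c => Sum.inr (Sum.inr c))) x
  let T : α ⊕ β ⊕ γ → α ⊕ β ⊕ γ := Sum.elim Sum.inl (fun b => Sum.inr (g b))
  have hSe : ∀ x, S (Sum.map id Sum.inl x) = Sum.map id Sum.inl (f x) := by
    rintro (x | x) <;> rfl
  have hSc : ∀ c, S (Sum.inr (Sum.inr c)) = Sum.inr (Sum.inr c) := fun c => rfl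
  have hTe : ∀ x, T (Sum.inr x) = Sum.inr (g x) := fun x => rfl
  have hTa : ∀ a, T (Sum.inl a) = Sum.inl a := fun a => rfl
  have hcov : ∀ x : α ⊕ β ⊕ γ, (∃ y, x = Sum.map id Sum.inl y) ∨ ∃ c, x = Sum.inr (Sum.inr c) := by
    rintro (x | x | x)
    · exact Or.inl ⟨Sum.inl x, rfl⟩
    · exact Or.inl ⟨Sum.inr x, rfl⟩
    · exact Or.inr ⟨x, rfl⟩
  have hinj : Function.Injective (Sum.map id Sum.inl : α ⊕ β → α ⊕ β ⊕ γ) :=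
    Sum.map_injective.2 ⟨Function.injective_id, Sum.inl_injective⟩
  have hS : Function.Involutive S := by
    intro x
    rcases hcov x with ⟨y, rfl⟩ | ⟨c, rfl⟩
    · rw [hSe, hSe, hf]
    · rfl
  have hT : Function.Involutive T := by
    rintro (x | x)
    · rfl
    · rw [hTe, hTe, hg]
  have hRS : ∀ x, glue r s x (S x) := by
    intro x
    rcases hcov x with ⟨y, rfl⟩ | ⟨c, rfl⟩
    · rw [hSe]
      exact (le_sup_left : _ ≤ glue r s) (map_rel _ ((hf2 _ _).2 (Or.inr rfl)))
    · exact (glue r s).refl _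
  have hRT : ∀ x, glue r s x (T x) := by
    rintro (x | x)
    · exact (glue r s).refl _
    · exact (le_sup_right : _ ≤ glue r s) (map_rel _ ((hg2 _ _).2 (Or.inr rfl)))
  have hR : ∀ (Q : Setoid (α ⊕ β ⊕ γ)), (∀ x, Q x (S x)) → (∀ x, Q x (T x)) → glue r s ≤ Q := by
    intro Q h1 h2
    refine sup_le (map_le_iff.2 fun x y h => ?_) (map_le_iff.2 fun x y h => ?_)
    · rcases (hf2 _ _).1 h with rfl | rfl
      · exact Q.refl _
      · rw [← hSe]
        exact h1 _
    · rcases (hg2 _ _).1 h with rfl | rfl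
      · exact Q.refl _
      · exact h2 _
  have hends : ∀ y, (S y = y ∨ T y = y) ↔ ∃ z, y = outer z := by
    rintro (y | y | y)
    · exact ⟨fun _ => ⟨Sum.inl y, rfl⟩, fun _ => Or.inr rfl⟩
    · constructor
      · rintro (h | h)
        · rw [show (Sum.inr (Sum.inl y) : α ⊕ β ⊕ γ) = Sum.map id Sum.inl (Sum.inr y) from rfl,
            hSe] at h
          exact absurd (hinj h) (hf1 _)
        · rw [hTe] at h
          exact absurd (Sum.inr_injective h) (hg1 _)
      · rintro ⟨z | z, hz⟩ <;> simp [outer] at hz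
    · exact ⟨fun _ => ⟨Sum.inr y, rfl⟩, fun _ => Or.inl rfl⟩
  have main : ∀ x : α ⊕ γ, ∃! y, (y ≠ outer x ∧ glue r s (outer x) y) ∧ (S y = y ∨ T y = y) := by
    rintro (x | x)
    · refine exists_unique_end (glue r s) S T hS hT hR hRS hRT _ rfl ?_
      intro h
      rw [show (outer (Sum.inl x) : α ⊕ β ⊕ γ) = Sum.map id Sum.inl (Sum.inl x) from rfl, hSe] at h
      exact hf1 _ (hinj h)
    · have := exists_unique_end (glue r s) T S hT hS (fun Q h1 h2 => hR Q h2 h1) hRT hRS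
        (outer (Sum.inr x)) rfl (fun h => hg1 _ (Sum.inr_injective h))
      simpa only [or_comm] using this
  intro x
  obtain ⟨y, ⟨⟨hy1, hy2⟩, hy3⟩, hy4⟩ := main x
  obtain ⟨z, rfl⟩ := (hends y).1 hy3
  refine ⟨z, ⟨fun h => hy1 (h ▸ rfl), hy2⟩, ?_⟩
  rintro z' ⟨h1, h2⟩
  exact outer_injective (hy4 _ ⟨⟨fun h => h1 (outer_injective h), h2⟩, (hends _).2 ⟨z', rfl⟩⟩)

end Gluing

/-! ### Planarity -/

section Planarity

variable {a b c : ℕ}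

/-- The position of a marked point on the boundary of the rectangle, read along the lower edge
from left to right and then along the upper edge from right to left. -/
def pos : Fin a ⊕ Fin b → ℕ := Sum.elim (fun i => (i : ℕ)) (fun j => a + (j.rev : ℕ))

/-- No two different strings cross. -/
def IsPlanar (r : Setoid (Fin a ⊕ Fin b)) : Prop :=
  ∀ x y z w, pos x < pos y → pos y < pos z → pos z < pos w → r x z → ¬ r y w

theorem pos_injective : Function.Injective (pos : Fin a ⊕ Fin b → ℕ) := by
  rintro (x | x) (y | y) h <;> simp only [pos, Sum.elim_inl, Sum.elim_inr, Fin.val_rev] at h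
  · rw [Fin.ext h]
  · omega
  · omega
  · congr 1
    ext
    omega

open Classical in
/-- The parity of the number of points of `T` to the left of a point of a row. -/
noncomputable def rowParity (T : Fin a → Prop) (i : Fin a) : ZMod 2 :=
  ∑ k, if T k ∧ k < i then 1 else 0

/-- The same for two rows, only counting points in the row of the given point. -/
noncomputable def leftParity (T : Fin a ⊕ Fin b → Prop) : Fin a ⊕ Fin b → ZMod 2 :=
  Sum.elim (rowParity (T ∘ Sum.inl)) (rowParity (T ∘ Sum.inr))

open Classical in
theorem sum_eq_zero_of_involution {X : Type} [Fintype X] (f : X → X)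
    (hf : Function.Involutive f) (hf1 : ∀ x, f x ≠ x) (T : X → Prop) (hT : ∀ x, T x → T (f x)) :
    ∑ x, (if T x then (1 : ZMod 2) else 0) = 0 := by
  refine Finset.sum_involution (fun x _ => f x) ?_ ?_ (fun _ _ => Finset.mem_univ _)
    (fun x _ => hf x)
  · intro x _
    by_cases h : T x
    · rw [if_pos h, if_pos (hT x h)]
      decide
    · rw [if_neg h, if_neg (fun h' => h (by simpa [hf x] using hT _ h'))]
      decide
  · intro x _ _
    exact hf1 x

open Classical in
theorem leftParity_eq (T : Fin a ⊕ Fin b → Prop)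
    (hT : ∑ x, (if T x then (1 : ZMod 2) else 0) = 0) (x : Fin a ⊕ Fin b) (hx : ¬ T x) :
    leftParity T x = ∑ z, if T z ∧ pos z < pos x then 1 else 0 := by
  rcases x with i | j
  · rw [Fintype.sum_sum_type]
    simp only [leftParity, Sum.elim_inl, rowParity, Function.comp]
    rw [Finset.sum_eq_zero (s := (Finset.univ : Finset (Fin b))), add_zero]
    · rfl
    · intro k _
      rw [if_neg]
      rintro ⟨-, h⟩
      simp only [pos, Sum.elim_inl, Sum.elim_inr] at h
      omega
  · have h2 : ∀ u v : ZMod 2, u + v = 0 → u = v := by decide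
    apply h2
    refine Eq.trans ?_ hT
    rw [Fintype.sum_sum_type, Fintype.sum_sum_type, add_comm (leftParity _ _), add_assoc]
    congr 1
    · refine Finset.sum_congr rfl fun k _ => ?_
      have hk : pos (Sum.inl k : Fin a ⊕ Fin b) < pos (Sum.inr j : Fin a ⊕ Fin b) := by
        simp only [pos, Sum.elim_inl, Sum.elim_inr]
        omega
      simp [hk]
    · simp only [leftParity, Sum.elim_inr, rowParity, Function.comp]
      rw [← Finset.sum_add_distrib]
      refine Finset.sum_congr rfl fun k _ => ?_
      have hpos : pos (Sum.inr k : Fin a ⊕ Fin b) < pos (Sum.inr j : Fin a ⊕ Fin b) ↔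
          (j : ℕ) < k := by
        simp only [pos, Sum.elim_inr, Fin.val_rev]
        omega
      have hlt : k < j ↔ (k : ℕ) < j := Iff.rfl
      simp only [hpos, hlt]
      by_cases hk : T (Sum.inr k)
      · have hkj : (k : ℕ) ≠ j := by
          intro h
          exact hx (Fin.ext h ▸ hk)
        rcases lt_or_gt_of_ne hkj with h | h
        · simp [hk, h, not_lt.2 h.le]
        · simp [hk, show (j : ℕ) < k from h, not_lt.2 (show (j : ℕ) ≤ k from h.le)]
      · simp [hk]

theorem leftParity_congr {r : Setoid (Fin a ⊕ Fin b)} (hr : IsMatching r) (hp : IsPlanar r)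
    (T : Fin a ⊕ Fin b → Prop) (hT : ∀ x y, r x y → T x → T y) (x y : Fin a ⊕ Fin b)
    (hxy : r x y) (hx : ¬ T x) : leftParity T x = leftParity T y := by
  classical
  obtain ⟨f, hf, hf1, hf2⟩ := hr.exists_mate
  have hrf : ∀ x, r x (f x) := fun x => (hf2 _ _).2 (Or.inr rfl)
  have hsum := sum_eq_zero_of_involution f hf hf1 T fun x h => hT _ _ (hrf x) h
  wlog hlt : pos x < pos y generalizing x y
  · rcases lt_or_eq_of_le (not_lt.1 hlt) with h | h
    · exact (this y x (r.symm hxy) (fun h' => hx (hT _ _ (r.symm hxy) h')) h).symm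
    · rw [pos_injective h]
  have hy : ¬ T y := fun h' => hx (hT _ _ (r.symm hxy) h')
  rw [leftParity_eq T hsum x hx, leftParity_eq T hsum y hy]
  have h0 := sum_eq_zero_of_involution f hf hf1 (fun z => T z ∧ pos x < pos z ∧ pos z < pos y) (by
    rintro z ⟨h1, h2, h3⟩
    have hTf := hT _ _ (hrf z) h1
    refine ⟨hTf, ?_, ?_⟩
    · by_contra h
      rcases lt_or_eq_of_le (not_lt.1 h) with h | h
      · exact hp (f z) x z y h h2 h3 (r.symm (hrf z)) hxy
      · exact hx (pos_injective h ▸ hTf)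
    · by_contra h
      rcases lt_or_eq_of_le (not_lt.1 h) with h | h
      · exact hp x z y (f z) h2 h3 h hxy (hrf z)
      · exact hy (pos_injective h ▸ hTf))
  refine (add_zero _).symm.trans ?_
  refine (congrArg _ h0.symm).trans ?_
  rw [← Finset.sum_add_distrib]
  refine Finset.sum_congr rfl fun z _ => ?_
  by_cases hz : T z
  · have hzx : pos z ≠ pos x := fun h => hx (pos_injective h ▸ hz)
    simp only [hz, true_and]
    split_ifs <;> first | omega | rfl
  · simp [hz]

theorem stack_isPlanar {r : Setoid (Fin a ⊕ Fin b)} {s : Setoid (Fin b ⊕ Fin c)}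
    (hr : IsMatching r) (hs : IsMatching s) (hr' : IsPlanar r) (hs' : IsPlanar s) :
    IsPlanar (stack r s) := by
  classical
  intro x y z w hxy hyz hzw hxz hyw
  obtain ⟨f, hf, hf1, hf2⟩ := (stack_isMatching hr hs).exists_mate
  have hz : z = f x := by
    rcases (hf2 _ _).1 hxz with rfl | h
    · omega
    · exact h
  let S : Fin a ⊕ Fin b ⊕ Fin c → Prop := fun v => glue r s (outer x) v
  let χ : Fin a ⊕ Fin b ⊕ Fin c → ZMod 2 := Sum.elim (rowParity (S ∘ Sum.inl))
    (leftParity (S ∘ Sum.inr))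
  have hS : ∀ v v', glue r s v v' → S v → S v' := fun v v' h h' => (glue r s).trans h' h
  have hle : glue r s ≤ Setoid.ker (fun v => if S v then none else some (χ v)) := by
    refine sup_le (map_le_iff.2 fun u v h => ?_) (map_le_iff.2 fun u v h => ?_)
    · have hg : glue r s (Sum.map id Sum.inl u) (Sum.map id Sum.inl v) :=
        (le_sup_left : _ ≤ glue r s) (map_rel _ h)
      have hχ : ∀ v, χ (Sum.map id Sum.inl v) = leftParity (S ∘ Sum.map id Sum.inl) v := by
        rintro (v | v) <;> rfl
      rw [Setoid.ker_def]
      by_cases hu : S (Sum.map id Sum.inl u)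
      · rw [if_pos hu, if_pos (hS _ _ hg hu)]
      · rw [if_neg hu, if_neg (fun h' => hu (hS _ _ ((glue r s).symm hg) h')), hχ, hχ]
        congr 1
        refine leftParity_congr hr hr' _ (fun p q hpq => hS _ _ ?_) _ _ h hu
        exact (le_sup_left : _ ≤ glue r s) (map_rel _ hpq)
    · have hg : glue r s (Sum.inr u) (Sum.inr v) :=
        (le_sup_right : _ ≤ glue r s) (map_rel _ h)
      rw [Setoid.ker_def]
      by_cases hu : S (Sum.inr u)
      · rw [if_pos hu, if_pos (hS _ _ hg hu)]
      · rw [if_neg hu, if_neg (fun h' => hu (hS _ _ ((glue r s).symm hg) h'))]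
        congr 1
        refine leftParity_congr hs hs' _ (fun p q hpq => hS _ _ ?_) _ _ h hu
        exact (le_sup_right : _ ≤ glue r s) (map_rel _ hpq)
  have hSo : ∀ v, S (outer v) ↔ v = x ∨ v = z := by
    intro v
    rw [hz]
    exact hf2 x v
  have hSy : ¬ S (outer y) := by
    rw [hSo]
    rintro (rfl | rfl) <;> omega
  have hSw : ¬ S (outer w) := by
    rw [hSo]
    rintro (rfl | rfl) <;> omega
  have h1 := hle hyw
  rw [Setoid.ker_def, if_neg hSy, if_neg hSw] at h1
  have hχ : ∀ v : Fin a ⊕ Fin c, χ (outer v) = leftParity (S ∘ outer) v := by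
    rintro (v | v) <;> rfl
  have hsum : ∀ (P : Fin a ⊕ Fin c → Prop) [DecidablePred P], (∑ v, if (S ∘ outer) v ∧ P v then (1 : ZMod 2) else 0) =
      (if P x then 1 else 0) + (if P z then 1 else 0) := by
    intro P _
    have hxz' : x ≠ z := by rintro rfl; omega
    rw [← Finset.sum_subset (Finset.subset_univ {x, z}), Finset.sum_pair hxz']
    · simp only [Function.comp, hSo, true_or, or_true, true_and]
    · intro v _ hv
      rw [if_neg]
      rintro ⟨h, -⟩
      rw [Function.comp, hSo] at h
      simp at hv
      tauto
  have htot := hsum fun _ => True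
  simp only [and_true, if_true] at htot
  have htot' : ∑ v, (if (S ∘ outer) v then (1 : ZMod 2) else 0) = 0 := htot.trans (by decide)
  rw [Option.some_inj, hχ, hχ, leftParity_eq _ htot' y hSy, leftParity_eq _ htot' w hSw, hsum, hsum,
    if_pos hxy, if_neg (by omega), if_pos (by omega), if_pos hzw] at h1
  revert h1
  decide

end Planarity

/-! ### Juxtaposition -/

section Juxtaposition

variable {a b c a' b' c' : ℕ}

/-- The points on the left in a juxtaposition. -/
def leftBlock : Fin a ⊕ Fin b → Fin (a + a') ⊕ Fin (b + b') :=
  Sum.map (Fin.castAdd a') (Fin.castAdd b')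

/-- The points on the right in a juxtaposition. -/
def rightBlock : Fin a' ⊕ Fin b' → Fin (a + a') ⊕ Fin (b + b') :=
  Sum.map (Fin.natAdd a) (Fin.natAdd b)

/-- Two relations placed side by side. -/
def juxtapose (r : Setoid (Fin a ⊕ Fin b)) (r' : Setoid (Fin a' ⊕ Fin b')) :
    Setoid (Fin (a + a') ⊕ Fin (b + b')) :=
  r.map leftBlock ⊔ r'.map rightBlock

theorem leftBlock_injective :
    Function.Injective (leftBlock : Fin a ⊕ Fin b → Fin (a + a') ⊕ Fin (b + b')) :=
  Sum.map_injective.2 ⟨Fin.castAdd_injective _ _, Fin.castAdd_injective _ _⟩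

theorem rightBlock_injective :
    Function.Injective (rightBlock : Fin a' ⊕ Fin b' → Fin (a + a') ⊕ Fin (b + b')) :=
  Sum.map_injective.2 ⟨Fin.natAdd_injective _ _, Fin.natAdd_injective _ _⟩

theorem castAdd_ne_natAdd (i : Fin a) (j : Fin a') : Fin.castAdd a' i ≠ Fin.natAdd a j := by
  intro h
  have := congrArg Fin.val h
  simp only [Fin.val_castAdd, Fin.val_natAdd] at this
  omega

theorem leftBlock_ne_rightBlock (x : Fin a ⊕ Fin b) (y : Fin a' ⊕ Fin b') :
    leftBlock x ≠ rightBlock y := by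
  rcases x with x | x <;> rcases y with y | y <;> intro h <;>
    simp only [leftBlock, rightBlock, Sum.map_inl, Sum.map_inr, Sum.inl.injEq, Sum.inr.injEq,
      reduceCtorEq] at h
  · exact castAdd_ne_natAdd _ _ h
  · exact castAdd_ne_natAdd _ _ h

theorem fin_add_cases (i : Fin (a + a')) :
    (∃ k, i = Fin.castAdd a' k) ∨ ∃ k, i = Fin.natAdd a k := by
  induction i using Fin.addCases with
  | left k => exact Or.inl ⟨k, rfl⟩
  | right k => exact Or.inr ⟨k, rfl⟩

theorem block_cases (x : Fin (a + a') ⊕ Fin (b + b')) :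
    (∃ y, x = leftBlock y) ∨ ∃ y, x = rightBlock y := by
  rcases x with x | x <;> rcases fin_add_cases x with ⟨k, rfl⟩ | ⟨k, rfl⟩
  · exact Or.inl ⟨Sum.inl k, rfl⟩
  · exact Or.inr ⟨Sum.inl k, rfl⟩
  · exact Or.inl ⟨Sum.inr k, rfl⟩
  · exact Or.inr ⟨Sum.inr k, rfl⟩

theorem juxtapose_left (r : Setoid (Fin a ⊕ Fin b)) (r' : Setoid (Fin a' ⊕ Fin b')) (x y) :
    juxtapose r r' (leftBlock x) y ↔ ∃ x', y = leftBlock x' ∧ r x x' :=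
  (disjoint_rel r r' _ _ leftBlock_injective rightBlock_injective leftBlock_ne_rightBlock).1 x y

theorem juxtapose_right (r : Setoid (Fin a ⊕ Fin b)) (r' : Setoid (Fin a' ⊕ Fin b')) (x y) :
    juxtapose r r' (rightBlock x) y ↔ ∃ x', y = rightBlock x' ∧ r' x x' :=
  (disjoint_rel r r' _ _ leftBlock_injective rightBlock_injective leftBlock_ne_rightBlock).2 x y

theorem juxtapose_isMatching {r : Setoid (Fin a ⊕ Fin b)} {r' : Setoid (Fin a' ⊕ Fin b')}
    (h : IsMatching r) (h' : IsMatching r') : IsMatching (juxtapose r r') := by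
  intro x
  rcases block_cases x with ⟨x, rfl⟩ | ⟨x, rfl⟩
  · obtain ⟨y, ⟨hy1, hy2⟩, hy3⟩ := h x
    refine ⟨leftBlock y, ⟨fun e => hy1 (leftBlock_injective e),
      (juxtapose_left _ _ _ _).2 ⟨y, rfl, hy2⟩⟩, ?_⟩
    rintro z ⟨hz1, hz2⟩
    obtain ⟨z, rfl, hz⟩ := (juxtapose_left _ _ _ _).1 hz2
    rw [hy3 z ⟨fun e => hz1 (e ▸ rfl), hz⟩]
  · obtain ⟨y, ⟨hy1, hy2⟩, hy3⟩ := h' x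
    refine ⟨rightBlock y, ⟨fun e => hy1 (rightBlock_injective e),
      (juxtapose_right _ _ _ _).2 ⟨y, rfl, hy2⟩⟩, ?_⟩
    rintro z ⟨hz1, hz2⟩
    obtain ⟨z, rfl, hz⟩ := (juxtapose_right _ _ _ _).1 hz2
    rw [hy3 z ⟨fun e => hz1 (e ▸ rfl), hz⟩]

theorem pos_lt (x : Fin a ⊕ Fin b) : pos x < a + b := by
  rcases x with x | x <;> simp only [pos, Sum.elim_inl, Sum.elim_inr] <;> omega

theorem pos_leftBlock (x : Fin a ⊕ Fin b) :
    pos (leftBlock x : Fin (a + a') ⊕ Fin (b + b')) =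
      if pos x < a then pos x else pos x + a' + b' := by
  rcases x with x | x
  · have h : pos (Sum.inl x : Fin a ⊕ Fin b) < a := x.2
    rw [if_pos h]
    rfl
  · have h : ¬ pos (Sum.inr x : Fin a ⊕ Fin b) < a := by
      simp only [pos, Sum.elim_inr]
      omega
    rw [if_neg h]
    simp only [pos, leftBlock, Sum.map_inr, Sum.elim_inr, Fin.val_rev, Fin.val_castAdd]
    omega

theorem pos_rightBlock (x : Fin a' ⊕ Fin b') :
    pos (rightBlock x : Fin (a + a') ⊕ Fin (b + b')) = a + pos x := by
  rcases x with x | x <;>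
    simp only [pos, rightBlock, Sum.map_inl, Sum.map_inr, Sum.elim_inl, Sum.elim_inr, Fin.val_rev,
      Fin.val_natAdd]
  omega

theorem juxtapose_isPlanar {r : Setoid (Fin a ⊕ Fin b)} {r' : Setoid (Fin a' ⊕ Fin b')}
    (h : IsPlanar r) (h' : IsPlanar r') : IsPlanar (juxtapose r r') := by
  intro x y z w hxy hyz hzw hxz hyw
  rcases block_cases x with ⟨x, rfl⟩ | ⟨x, rfl⟩ <;>
    rcases block_cases y with ⟨y, rfl⟩ | ⟨y, rfl⟩ <;>
    simp only [juxtapose_left, juxtapose_right] at hxz hyw <;>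
    obtain ⟨z, rfl, hxz⟩ := hxz <;> obtain ⟨w, rfl, hyw⟩ := hyw <;>
    simp only [pos_leftBlock, pos_rightBlock] at hxy hyz hzw
  · refine h x y z w ?_ ?_ ?_ hxz hyw
    · split_ifs at hxy <;> omega
    · split_ifs at hyz <;> omega
    · split_ifs at hzw <;> omega
  · have := pos_lt y
    have := pos_lt w
    split_ifs at hxy hyz hzw <;> omega
  · have := pos_lt x
    have := pos_lt z
    split_ifs at hxy hyz hzw <;> omega
  · exact h' x y z w (by omega) (by omega) (by omega) hxz hyw

def leftBlock₃ : Fin a ⊕ Fin b ⊕ Fin c → Fin (a + a') ⊕ Fin (b + b') ⊕ Fin (c + c') :=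
  Sum.map (Fin.castAdd a') leftBlock

def rightBlock₃ : Fin a' ⊕ Fin b' ⊕ Fin c' → Fin (a + a') ⊕ Fin (b + b') ⊕ Fin (c + c') :=
  Sum.map (Fin.natAdd a) rightBlock

theorem leftBlock₃_injective : Function.Injective (leftBlock₃ :
    Fin a ⊕ Fin b ⊕ Fin c → Fin (a + a') ⊕ Fin (b + b') ⊕ Fin (c + c')) :=
  Sum.map_injective.2 ⟨Fin.castAdd_injective _ _, leftBlock_injective⟩

theorem rightBlock₃_injective : Function.Injective (rightBlock₃ :
    Fin a' ⊕ Fin b' ⊕ Fin c' → Fin (a + a') ⊕ Fin (b + b') ⊕ Fin (c + c')) :=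
  Sum.map_injective.2 ⟨Fin.natAdd_injective _ _, rightBlock_injective⟩

theorem leftBlock₃_ne_rightBlock₃ (x : Fin a ⊕ Fin b ⊕ Fin c) (y : Fin a' ⊕ Fin b' ⊕ Fin c') :
    leftBlock₃ x ≠ rightBlock₃ y := by
  rcases x with x | x <;> rcases y with y | y <;> intro h <;>
    simp only [leftBlock₃, rightBlock₃, Sum.map_inl, Sum.map_inr, Sum.inl.injEq, Sum.inr.injEq,
      reduceCtorEq] at h
  · exact castAdd_ne_natAdd _ _ h
  · exact leftBlock_ne_rightBlock _ _ h

theorem block₃_cases (x : Fin (a + a') ⊕ Fin (b + b') ⊕ Fin (c + c')) :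
    (∃ y, x = leftBlock₃ y) ∨ ∃ y, x = rightBlock₃ y := by
  rcases x with x | x
  · rcases fin_add_cases x with ⟨k, rfl⟩ | ⟨k, rfl⟩
    · exact Or.inl ⟨Sum.inl k, rfl⟩
    · exact Or.inr ⟨Sum.inl k, rfl⟩
  · rcases block_cases x with ⟨k, rfl⟩ | ⟨k, rfl⟩
    · exact Or.inl ⟨Sum.inr k, rfl⟩
    · exact Or.inr ⟨Sum.inr k, rfl⟩

theorem outer_leftBlock (x : Fin a ⊕ Fin c) :
    (outer (leftBlock x) : Fin (a + a') ⊕ Fin (b + b') ⊕ Fin (c + c')) = leftBlock₃ (outer x) := by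
  rcases x with x | x <;> rfl

theorem outer_rightBlock (x : Fin a' ⊕ Fin c') :
    (outer (rightBlock x) : Fin (a + a') ⊕ Fin (b + b') ⊕ Fin (c + c')) =
      rightBlock₃ (outer x) := by
  rcases x with x | x <;> rfl

variable (r : Setoid (Fin a ⊕ Fin b)) (s : Setoid (Fin b ⊕ Fin c))
  (r' : Setoid (Fin a' ⊕ Fin b')) (s' : Setoid (Fin b' ⊕ Fin c'))

theorem glue_juxtapose : glue (juxtapose r r') (juxtapose s s') =
    (glue r s).map leftBlock₃ ⊔ (glue r' s').map rightBlock₃ := by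
  simp only [glue, juxtapose, map_sup, map_map]
  have h1 : (Sum.map id Sum.inl ∘ leftBlock :
      Fin a ⊕ Fin b → Fin (a + a') ⊕ Fin (b + b') ⊕ Fin (c + c')) =
      leftBlock₃ ∘ Sum.map id Sum.inl := by
    funext x; rcases x with x | x <;> rfl
  have h2 : (Sum.map id Sum.inl ∘ rightBlock :
      Fin a' ⊕ Fin b' → Fin (a + a') ⊕ Fin (b + b') ⊕ Fin (c + c')) =
      rightBlock₃ ∘ Sum.map id Sum.inl := by
    funext x; rcases x with x | x <;> rfl
  have h3 : (Sum.inr ∘ leftBlock :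
      Fin b ⊕ Fin c → Fin (a + a') ⊕ Fin (b + b') ⊕ Fin (c + c')) = leftBlock₃ ∘ Sum.inr := rfl
  have h4 : (Sum.inr ∘ rightBlock :
      Fin b' ⊕ Fin c' → Fin (a + a') ⊕ Fin (b + b') ⊕ Fin (c + c')) = rightBlock₃ ∘ Sum.inr := rfl
  rw [h1, h2, h3, h4]
  exact sup_sup_sup_comm _ _ _ _

theorem stack_juxtapose :
    stack (juxtapose r r') (juxtapose s s') = juxtapose (stack r s) (stack r' s') := by
  obtain ⟨h1, h2⟩ := disjoint_rel (glue r s) (glue r' s') leftBlock₃ rightBlock₃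
    leftBlock₃_injective rightBlock₃_injective leftBlock₃_ne_rightBlock₃
  ext x y
  rw [stack, glue_juxtapose, Setoid.comap_rel]
  rcases block_cases x with ⟨x, rfl⟩ | ⟨x, rfl⟩
  · rw [outer_leftBlock, h1, juxtapose_left]
    rcases block_cases y with ⟨y, rfl⟩ | ⟨y, rfl⟩
    · rw [outer_leftBlock]
      constructor
      · rintro ⟨x', h, h'⟩
        cases leftBlock₃_injective h
        exact ⟨y, rfl, h'⟩
      · rintro ⟨x', h, h'⟩
        cases leftBlock_injective h
        exact ⟨_, rfl, h'⟩
    · rw [outer_rightBlock]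
      constructor
      · rintro ⟨x', h, h'⟩
        exact absurd h.symm (leftBlock₃_ne_rightBlock₃ _ _)
      · rintro ⟨x', h, h'⟩
        exact absurd h.symm (leftBlock_ne_rightBlock _ _)
  · rw [outer_rightBlock, h2, juxtapose_right]
    rcases block_cases y with ⟨y, rfl⟩ | ⟨y, rfl⟩
    · rw [outer_leftBlock]
      constructor
      · rintro ⟨x', h, h'⟩
        exact absurd h (leftBlock₃_ne_rightBlock₃ _ _)
      · rintro ⟨x', h, h'⟩
        exact absurd h (leftBlock_ne_rightBlock _ _)
    · rw [outer_rightBlock]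
      constructor
      · rintro ⟨x', h, h'⟩
        cases rightBlock₃_injective h
        exact ⟨y, rfl, h'⟩
      · rintro ⟨x', h, h'⟩
        cases rightBlock_injective h
        exact ⟨_, rfl, h'⟩

theorem innerComponents_juxtapose : innerComponents (juxtapose r r') (juxtapose s s') =
    innerComponents r s + innerComponents r' s' := by
  rw [innerComponents, glue_juxtapose]
  refine disjoint_missed _ _ _ _ leftBlock₃_injective rightBlock₃_injective
    leftBlock₃_ne_rightBlock₃ block₃_cases _ _ _ (fun x => ⟨?_, ?_⟩) (fun x => ⟨?_, ?_⟩)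
  · rintro ⟨y, hy⟩
    rcases block_cases y with ⟨y, rfl⟩ | ⟨y, rfl⟩
    · rw [outer_leftBlock] at hy
      exact ⟨y, leftBlock₃_injective hy⟩
    · rw [outer_rightBlock] at hy
      exact absurd hy.symm (leftBlock₃_ne_rightBlock₃ _ _)
  · rintro ⟨y, rfl⟩
    exact ⟨_, outer_leftBlock y⟩
  · rintro ⟨y, hy⟩
    rcases block_cases y with ⟨y, rfl⟩ | ⟨y, rfl⟩
    · rw [outer_leftBlock] at hy
      exact absurd hy (leftBlock₃_ne_rightBlock₃ _ _)
    · rw [outer_rightBlock] at hy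
      exact ⟨y, rightBlock₃_injective hy⟩
  · rintro ⟨y, rfl⟩
    exact ⟨_, outer_rightBlock y⟩

theorem juxtapose_idRel : juxtapose (idRel (Fin a)) (idRel (Fin a')) = idRel (Fin (a + a')) := by
  apply le_antisymm
  · refine sup_le (map_le_iff.2 ?_) (map_le_iff.2 ?_) <;> rintro (x | x) (y | y) h <;>
      cases (show x = y from h) <;> rfl
  · have key : ∀ x : Fin (a + a'),
        juxtapose (idRel (Fin a)) (idRel (Fin a')) (Sum.inl x) (Sum.inr x) := by
      intro x
      rcases fin_add_cases x with ⟨k, rfl⟩ | ⟨k, rfl⟩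
      · exact (juxtapose_left _ _ (Sum.inl k) _).2 ⟨Sum.inr k, rfl, rfl⟩
      · exact (juxtapose_right _ _ (Sum.inl k) _).2 ⟨Sum.inr k, rfl, rfl⟩
    rintro (x | x) (y | y) h <;> cases (show x = y from h)
    · exact Setoid.refl' _ _
    · exact key x
    · exact Setoid.symm' _ (key x)
    · exact Setoid.refl' _ _

end Juxtaposition

/-! ### Kauffman diagrams -/

/-- A Kauffman diagram with `a` points on the lower and `b` points on the upper edge: the planar
isotopy class of a system of non-crossing strings is given by the pairs of points it joins. -/
@[ext]
structure Diagram (a b : ℕ) where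
  /-- Two points are related if they are equal or joined by a string. -/
  rel : Setoid (Fin a ⊕ Fin b)
  isMatching : IsMatching rel
  isPlanar : IsPlanar rel

namespace Diagram

variable {a b c e a' b' c' : ℕ}

/-- The diagram of vertical strings. -/
def id (a : ℕ) : Diagram a a where
  rel := idRel (Fin a)
  isMatching := by
    rintro (x | x)
    · refine ⟨Sum.inr x, ⟨Sum.inr_ne_inl, rfl⟩, ?_⟩
      rintro (y | y) ⟨h1, h2⟩ <;> cases (show x = y from h2)
      · exact absurd rfl h1
      · rfl
    · refine ⟨Sum.inl x, ⟨Sum.inl_ne_inr, rfl⟩, ?_⟩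
      rintro (y | y) ⟨h1, h2⟩ <;> cases (show x = y from h2)
      · rfl
      · exact absurd rfl h1
  isPlanar := by
    rintro (x | x) (y | y) (z | z) (w | w) h1 h2 h3 h4 h5 <;> cases (show x = z from h4) <;>
      cases (show y = w from h5) <;>
      simp only [pos, Sum.elim_inl, Sum.elim_inr, Fin.val_rev] at h1 h2 h3 <;> omega

/-- Concatenation of `D` with `E` put on top of it, closed loops being removed. -/
def comp (D : Diagram a b) (E : Diagram b c) : Diagram a c where
  rel := stack D.rel E.rel
  isMatching := stack_isMatching D.isMatching E.isMatching
  isPlanar := stack_isPlanar D.isMatching E.isMatching D.isPlanar E.isPlanar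

/-- The number of closed loops removed in the concatenation. -/
noncomputable def loops (D : Diagram a b) (E : Diagram b c) : ℕ := innerComponents D.rel E.rel

/-- Juxtaposition, with `D` on the left. -/
def tensor (D : Diagram a b) (D' : Diagram a' b') : Diagram (a + a') (b + b') where
  rel := juxtapose D.rel D'.rel
  isMatching := juxtapose_isMatching D.isMatching D'.isMatching
  isPlanar := juxtapose_isPlanar D.isPlanar D'.isPlanar

/-- The arc joining two points on the lower edge. -/
def cap : Diagram 2 0 where
  rel := ⊤
  isMatching := by
    rintro (x | x)
    · refine ⟨Sum.inl x.rev, ⟨fun h => ?_, trivial⟩, ?_⟩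
      · have := congrArg Fin.val (Sum.inl_injective h)
        rw [Fin.val_rev] at this
        omega
      · rintro (y | y) ⟨h, -⟩
        · congr 1
          ext
          have : (y : ℕ) ≠ x := fun h' => h (congrArg _ (Fin.ext h'))
          rw [Fin.val_rev]
          omega
        · exact y.elim0
    · exact x.elim0
  isPlanar := by
    intro x y z w h1 h2 h3
    have := pos_lt w
    omega

/-- The arc joining two points on the upper edge. -/
def cup : Diagram 0 2 where
  rel := ⊤
  isMatching := by
    rintro (x | x)
    · exact x.elim0
    · refine ⟨Sum.inr x.rev, ⟨fun h => ?_, trivial⟩, ?_⟩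
      · have := congrArg Fin.val (Sum.inr_injective h)
        rw [Fin.val_rev] at this
        omega
      · rintro (y | y) ⟨h, -⟩
        · exact y.elim0
        · congr 1
          ext
          have : (y : ℕ) ≠ x := fun h' => h (congrArg _ (Fin.ext h'))
          rw [Fin.val_rev]
          omega
  isPlanar := by
    intro x y z w h1 h2 h3
    have := pos_lt w
    omega

/-- The number of loops obtained when every point of the lower edge is joined, outside the
rectangle, with the corresponding point of the upper edge. -/
noncomputable def closureLoops (D : Diagram a a) : ℕ :=
  Nat.card (Quotient (D.rel ⊔ (Diagram.id a).rel))

theorem id_comp (D : Diagram a b) : (Diagram.id a).comp D = D :=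
  Diagram.ext (stack_idRel_left _)

theorem comp_id (D : Diagram a b) : D.comp (Diagram.id b) = D :=
  Diagram.ext (stack_idRel_right _)

theorem loops_id_left (D : Diagram a b) : (Diagram.id a).loops D = 0 :=
  innerComponents_idRel_left _

theorem loops_id_right (D : Diagram a b) : D.loops (Diagram.id b) = 0 :=
  innerComponents_idRel_right _

theorem comp_assoc (D : Diagram a b) (E : Diagram b c) (F : Diagram c e) :
    (D.comp E).comp F = D.comp (E.comp F) :=
  Diagram.ext (stack_assoc _ _ _)

theorem loops_assoc (D : Diagram a b) (E : Diagram b c) (F : Diagram c e) :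
    D.loops E + (D.comp E).loops F = E.loops F + D.loops (E.comp F) :=
  innerComponents_assoc _ _ _

theorem tensor_comp (D : Diagram a b) (E : Diagram b c) (D' : Diagram a' b')
    (E' : Diagram b' c') : (D.tensor D').comp (E.tensor E') = (D.comp E).tensor (D'.comp E') :=
  Diagram.ext (stack_juxtapose _ _ _ _)

theorem tensor_loops (D : Diagram a b) (E : Diagram b c) (D' : Diagram a' b')
    (E' : Diagram b' c') : (D.tensor D').loops (E.tensor E') = D.loops E + D'.loops E' :=
  innerComponents_juxtapose _ _ _ _

theorem tensor_id : (Diagram.id a).tensor (Diagram.id a') = Diagram.id (a + a') :=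
  Diagram.ext juxtapose_idRel

end Diagram

/-! ### The Temperley-Lieb category -/

/-- The objects of the Temperley-Lieb category with loop value `d`: natural numbers. -/
@[ext]
structure TL (d : ℂ) where
  size : ℕ

section Category

variable {d : ℂ}

/-- Concatenation, extended bilinearly, each closed loop contributing a factor `d`. -/
noncomputable def compLin (d : ℂ) (a b c : ℕ) :
    (Diagram a b →₀ ℂ) →ₗ[ℂ] (Diagram b c →₀ ℂ) →ₗ[ℂ] (Diagram a c →₀ ℂ) :=
  Finsupp.linearCombination ℂ fun D =>
    Finsupp.linearCombination ℂ fun E => Finsupp.single (D.comp E) (d ^ D.loops E)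

/-- Juxtaposition, extended bilinearly. -/
noncomputable def tensorLin (a b a' b' : ℕ) :
    (Diagram a b →₀ ℂ) →ₗ[ℂ] (Diagram a' b' →₀ ℂ) →ₗ[ℂ] (Diagram (a + a') (b + b') →₀ ℂ) :=
  Finsupp.linearCombination ℂ fun D =>
    Finsupp.linearCombination ℂ fun E => Finsupp.single (D.tensor E) 1

theorem compLin_single (a b c : ℕ) (D : Diagram a b) (E : Diagram b c) (x y : ℂ) :
    compLin d a b c (Finsupp.single D x) (Finsupp.single E y) =
      Finsupp.single (D.comp E) (x * y * d ^ D.loops E) := by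
  rw [compLin, Finsupp.linearCombination_single, LinearMap.smul_apply,
    Finsupp.linearCombination_single, Finsupp.smul_single, Finsupp.smul_single, smul_eq_mul,
    smul_eq_mul, mul_assoc]

theorem tensorLin_single (a b a' b' : ℕ) (D : Diagram a b) (E : Diagram a' b') (x y : ℂ) :
    tensorLin a b a' b' (Finsupp.single D x) (Finsupp.single E y) =
      Finsupp.single (D.tensor E) (x * y) := by
  simp [tensorLin, Finsupp.linearCombination_single]

noncomputable instance : Category (TL d) where
  Hom X Y := Diagram X.size Y.size →₀ ℂ
  id X := Finsupp.single (Diagram.id X.size) 1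
  comp {X Y Z} f g := compLin d X.size Y.size Z.size f g
  id_comp {X Y} f := by
    induction f using Finsupp.induction_linear with
    | zero => simp
    | add f g hf hg => rw [map_add, hf, hg]
    | single D x => rw [compLin_single, Diagram.id_comp, Diagram.loops_id_left]; simp
  comp_id {X Y} f := by
    induction f using Finsupp.induction_linear with
    | zero => simp
    | add f g hf hg => rw [map_add, LinearMap.add_apply, hf, hg]
    | single D x => rw [compLin_single, Diagram.comp_id, Diagram.loops_id_right]; simp
  assoc {W X Y Z} f g h := by
    induction f using Finsupp.induction_linear with
    | zero => simp
    | add f f' hf hf' => simp only [map_add, LinearMap.add_apply, hf, hf']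
    | single D x =>
      induction g using Finsupp.induction_linear with
      | zero => simp
      | add f f' hf hf' => simp only [map_add, LinearMap.add_apply, hf, hf']
      | single E y =>
        induction h using Finsupp.induction_linear with
        | zero => simp
        | add f f' hf hf' => simp only [map_add, hf, hf']
        | single F z =>
          simp only [compLin_single, Diagram.comp_assoc]
          congr 1
          have h := congrArg (d ^ ·) (Diagram.loops_assoc D E F)
          simp only [pow_add] at h
          linear_combination (x * y * z) * h

noncomputable instance : Preadditive (TL d) where
  homGroup X Y := inferInstanceAs (AddCommGroup (Diagram X.size Y.size →₀ ℂ))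
  add_comp X Y Z f f' g := LinearMap.map_add₂ (compLin d X.size Y.size Z.size) f f' g
  comp_add X Y Z f g g' := LinearMap.map_add (compLin d X.size Y.size Z.size f) g g'

noncomputable instance : Linear ℂ (TL d) where
  homModule X Y := inferInstanceAs (Module ℂ (Diagram X.size Y.size →₀ ℂ))
  smul_comp X Y Z r f g := LinearMap.map_smul₂ (compLin d X.size Y.size Z.size) r f g
  comp_smul X Y Z f r g := LinearMap.map_smul (compLin d X.size Y.size Z.size f) r g

/-- The morphism given by a diagram. -/
noncomputable def ofDiagram (d : ℂ) {a b : ℕ} (D : Diagram a b) : (⟨a⟩ : TL d) ⟶ ⟨b⟩ :=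
  Finsupp.single D (1 : ℂ)

/-- The object `X^{⊗ k}`; in particular `pow d 0` is the unit object `I` and `pow d 1` is `X`. -/
abbrev pow (d : ℂ) (k : ℕ) : TL d := ⟨k⟩

/-- The tensor product of objects. -/
abbrev tensorObj (X Y : TL d) : TL d := ⟨X.size + Y.size⟩

/-- The tensor product of morphisms. -/
noncomputable def tensorHom {X Y X' Y' : TL d} (f : X ⟶ Y) (g : X' ⟶ Y') :
    tensorObj X X' ⟶ tensorObj Y Y' :=
  tensorLin X.size Y.size X'.size Y'.size f g

theorem tensorHom_id (X Y : TL d) : tensorHom (𝟙 X) (𝟙 Y) = 𝟙 (tensorObj X Y) := by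
  change tensorLin _ _ _ _ (Finsupp.single (Diagram.id X.size) 1)
    (Finsupp.single (Diagram.id Y.size) 1) = Finsupp.single (Diagram.id (X.size + Y.size)) 1
  rw [tensorLin_single, Diagram.tensor_id, one_mul]

theorem tensorHom_comp {X Y Z X' Y' Z' : TL d} (f : X ⟶ Y) (g : Y ⟶ Z) (f' : X' ⟶ Y')
    (g' : Y' ⟶ Z') : tensorHom (f ≫ g) (f' ≫ g') = tensorHom f f' ≫ tensorHom g g' := by
  change tensorLin _ _ _ _ (compLin d _ _ _ f g) (compLin d _ _ _ f' g') =
    compLin d _ _ _ (tensorLin _ _ _ _ f f') (tensorLin _ _ _ _ g g')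
  induction f using Finsupp.induction_linear with
  | zero => simp
  | add f f' hf hf' => simp only [map_add, LinearMap.add_apply, hf, hf']
  | single D x =>
    induction g using Finsupp.induction_linear with
    | zero => simp
    | add f f' hf hf' => simp only [map_add, LinearMap.add_apply, hf, hf']
    | single E y =>
      induction f' using Finsupp.induction_linear with
      | zero => simp
      | add f f' hf hf' => simp only [map_add, LinearMap.add_apply, hf, hf']
      | single D' x' =>
        induction g' using Finsupp.induction_linear with
        | zero => simp
        | add f f' hf hf' => simp only [map_add, hf, hf']
        | single E' y' =>
          simp only [compLin_single, tensorLin_single, Diagram.tensor_comp, Diagram.tensor_loops]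
          congr 1
          ring

/-- The embedding `f ↦ f ⊗ 1_X` of `End(X^{⊗ k})` into `End(X^{⊗ (k+1)})`. -/
noncomputable def addStrand {k : ℕ} (f : pow d k ⟶ pow d k) : pow d (k + 1) ⟶ pow d (k + 1) :=
  tensorHom f (𝟙 (pow d 1))

/-- The elementary diagram `h_{j+1}` in `End(X^{⊗ (j+2)})`: `j` vertical strings followed by an
arc between the last two lower points and an arc between the last two upper points. -/
noncomputable def elementary (d : ℂ) (j : ℕ) : pow d (j + 2) ⟶ pow d (j + 2) :=
  tensorHom (𝟙 (pow d j)) (ofDiagram d Diagram.cap ≫ ofDiagram d Diagram.cup)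

/-- The Markov trace: close diagrams completely and replace each loop by `d`. -/
noncomputable def markovTrace (d : ℂ) (k : ℕ) : (pow d k ⟶ pow d k) →ₗ[ℂ] ℂ :=
  Finsupp.linearCombination ℂ fun D : Diagram k k => d ^ D.closureLoops

/-- The object `X^{⊗ k} = (1, X^{⊗ k})` of the idempotent completion. -/
noncomputable abbrev powK (d : ℂ) (k : ℕ) : Idempotents.Karoubi (TL d) :=
  (Idempotents.toKaroubi (TL d)).obj (pow d k)

/-- The tensor product `(p, X) ⊗ (p', X') = (p ⊗ p', X ⊗ X')` in the idempotent completion. -/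
noncomputable def karoubiTensor (P Q : Idempotents.Karoubi (TL d)) : Idempotents.Karoubi (TL d) where
  X := tensorObj P.X Q.X
  p := tensorHom P.p Q.p
  idem := by rw [← tensorHom_comp, P.idem, Q.idem]

end Category

/-! ### Semisimplicity in linear categories -/

section Semisimple

universe v u

variable (C : Type u) [Category.{v} C]

/-- The idempotent completion of a linear category is linear. -/
noncomputable instance karoubiLinear [Preadditive C] [Linear ℂ C] :
    Linear ℂ (Idempotents.Karoubi C) where
  homModule P Q :=
    { smul := fun c f => ⟨c • f.f, by rw [Linear.smul_comp, Linear.comp_smul, f.comm]⟩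
      one_smul := fun f => Idempotents.Karoubi.Hom.ext (one_smul ℂ f.f)
      mul_smul := fun c c' f => Idempotents.Karoubi.Hom.ext (mul_smul c c' f.f)
      smul_zero := fun c => Idempotents.Karoubi.Hom.ext (smul_zero c)
      smul_add := fun c f g => Idempotents.Karoubi.Hom.ext (smul_add c f.f g.f)
      add_smul := fun c c' f => Idempotents.Karoubi.Hom.ext (add_smul c c' f.f)
      zero_smul := fun f => Idempotents.Karoubi.Hom.ext (zero_smul ℂ f.f) }
  smul_comp _ _ _ c f g := Idempotents.Karoubi.Hom.ext (Linear.smul_comp _ _ _ c f.f g.f)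
  comp_smul _ _ _ f c g := Idempotents.Karoubi.Hom.ext (Linear.comp_smul _ _ _ f.f c g.f)

/-- A finite-dimensional linear category in which, for every finite family of objects, the
endomorphism algebra of the formal direct sum (with matrices of morphisms as endomorphisms)
is semisimple. -/
def IsEssentiallySemisimple [Preadditive C] [Linear ℂ C] : Prop :=
  (∀ X Y : C, Module.Finite ℂ (X ⟶ Y)) ∧
    ∀ (ι : Type) [Fintype ι] (X : ι → C), IsSemisimpleRing (End (Mat_.mk ι X))

variable {C}

/-- The identity of `X` is a minimal idempotent: `X` is not zero and `End(X) = ℂ 1`. -/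
def IsSimpleObject [Preadditive C] [Linear ℂ C] (X : C) : Prop :=
  𝟙 X ≠ 0 ∧ ∀ g : X ⟶ X, ∃ c : ℂ, g = c • 𝟙 X

/-- `α` and `β` are the inclusions and projections of a direct sum decomposition of `X` into the
family `Y`. -/
def IsDirectSumVia [Preadditive C] {ι : Type} [Fintype ι] (X : C) (Y : ι → C)
    (α : ∀ i, Y i ⟶ X) (β : ∀ i, X ⟶ Y i) : Prop :=
  (∀ i, α i ≫ β i = 𝟙 (Y i)) ∧ (∀ i j, i ≠ j → α i ≫ β j = 0) ∧ ∑ i, β i ≫ α i = 𝟙 X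

/-- `X` is isomorphic to the direct sum of the finite family `Y`. -/
def IsDirectSum [Preadditive C] {ι : Type} [Fintype ι] (X : C) (Y : ι → C) : Prop :=
  ∃ (α : ∀ i, Y i ⟶ X) (β : ∀ i, X ⟶ Y i), IsDirectSumVia X Y α β

end Semisimple

/-- The linear subcategory generated by `I, X, …, X^{⊗ n}`, i.e. the full subcategory on these
objects. -/
abbrev Generated (d : ℂ) (n : ℕ) : Type :=
  ObjectProperty.FullSubcategory fun Y : TL d => Y.size ≤ n

/-- The quantum integer `[k]_q = q^{k-1} + q^{k-3} + ⋯ + q^{1-k}`, which is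
`(q^k - q^{-k}) / (q - q⁻¹)` when `q ≠ ± 1`. -/
noncomputable def quantumInt (q : ℂ) (k : ℕ) : ℂ :=
  ∑ i ∈ Finset.range k, q ^ ((k : ℤ) - 1 - 2 * (i : ℤ))

end TemperleyLieb

open TemperleyLieb

namespace TemperleyLieb

/-! ### Further properties of matchings and juxtapositions -/

/-! Write f_k for the Jones-Wenzl idempotents (`jonesWenzl`), and cap and cup for the arcs at the
last two points. Everything rests on the partial trace: closing the last string of f_{k+1} gives
[k+2]/[k+1] times f_k. The recursion defines f_{k+2} as F = f_{k+1} ⊗ 1 minus a multiple of F cap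
cup F. Since cup F cap is the partial trace of f_{k+1}, the coefficient is the one for which the
subtracted term is an idempotent whose image is a copy of X_k. Hence f_{k+2} is idempotent and
killed by the last arcs, and its own partial trace follows from [k+3] = d[k+2] - [k+1].
`idempotent_splitting` is the abstract step and `jonesWenzl_aux` the induction. Iterated partial
traces give the Markov trace, and the recursion read backwards splits X_{k+1} ⊗ X into X_k and
X_{k+2}.

Absorption of f_k ⊗ 1 into f_{k+1} carries annihilation from the last arc to all arcs between
neighbouring points. A diagram with at most as many lower as upper points, other than the identity,
has such an arc on its upper edge (`Diagram.eq_id_of_forall_not_upper`), and the arc can be split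
off as a factor. So composing with f_k kills every diagram but the identity, and likewise upside
down: the endomorphisms of X_k are scalars and different X_j, X_k have no morphisms between them.
Finally f_k is not zero because it is 1 modulo endomorphisms factoring through fewer strings, and 1
is not of that kind (`id_notMem_lowerIdeal`).

The backward recursion also writes the identity of X^m as a combination of morphisms factoring
through the X_j (`id_mem_jonesWenzlIdeal`), and compression by p does the same for pX^m.
`exists_isDirectSum` turns this into a decomposition: the composition pairing of Hom(X_k, P) with
Hom(P, X_k) is non-degenerate, and dual bases are the inclusions and projections. The endomorphism
ring of a formal direct sum is then an image of a product of matrix algebras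
(`isSemisimpleRing_end`), hence semisimple. -/

theorem map_eq_self {A : Type} (r : Setoid A) {f : A → A} (hf : ∀ x, f x = x) : r.map f = r := by
  obtain rfl : f = _root_.id := funext hf
  exact le_antisymm (map_le_iff.2 fun _ _ h => h) fun _ _ h => map_rel (r := r) _root_.id h

/-- Both relations have classes of exactly two points, so the larger one has no room to grow.
Equality of two diagrams is reduced this way to finding every string of one in the other. -/
theorem IsMatching.eq_of_le {A : Type} {r s : Setoid A} (hr : IsMatching r) (hs : IsMatching s)
    (h : r ≤ s) : r = s := by
  refine le_antisymm h fun x y hxy => ?_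
  by_cases e : y = x
  · exact e ▸ r.refl _
  · obtain ⟨z, ⟨hz, hz'⟩, -⟩ := hr x
    obtain ⟨w, -, hw⟩ := hs x
    rw [hw y ⟨e, hxy⟩, ← hw z ⟨hz, h hz'⟩]
    exact hz'

theorem IsMatching.eq_of_rel {A : Type} {r : Setoid A} (hr : IsMatching r) {x y z : A}
    (hy : r x y) (hz : r x z) (hyx : y ≠ x) (hzx : z ≠ x) : y = z :=
  (hr x).unique ⟨hyx, hy⟩ ⟨hzx, hz⟩

section Stack

variable {α β γ : Type} {r : Setoid (α ⊕ β)} {s : Setoid (β ⊕ γ)}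

theorem glue_of_left {x y : α ⊕ β} (h : r x y) :
    glue r s (Sum.map id Sum.inl x) (Sum.map id Sum.inl y) :=
  (le_sup_left : _ ≤ glue r s) (map_rel _ h)

theorem glue_of_right {x y : β ⊕ γ} (h : s x y) : glue r s (Sum.inr x) (Sum.inr y) :=
  (le_sup_right : _ ≤ glue r s) (map_rel _ h)

theorem stack_of_lower {x y : α} (h : r (Sum.inl x) (Sum.inl y)) :
    stack r s (Sum.inl x) (Sum.inl y) := glue_of_left h

theorem stack_of_upper {x y : γ} (h : s (Sum.inr x) (Sum.inr y)) :
    stack r s (Sum.inr x) (Sum.inr y) := glue_of_right h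

end Stack

section Assoc

variable {a b a' b' a'' b'' : ℕ}

theorem juxtapose_of_left {r : Setoid (Fin a ⊕ Fin b)} {r' : Setoid (Fin a' ⊕ Fin b')} {x y}
    (h : r x y) : juxtapose r r' (leftBlock x) (leftBlock y) :=
  (juxtapose_left _ _ _ _).2 ⟨_, rfl, h⟩

theorem juxtapose_of_right {r : Setoid (Fin a ⊕ Fin b)} {r' : Setoid (Fin a' ⊕ Fin b')} {x y}
    (h : r' x y) : juxtapose r r' (rightBlock x) (rightBlock y) :=
  (juxtapose_right _ _ _ _).2 ⟨_, rfl, h⟩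

theorem juxtapose_assoc (r : Setoid (Fin a ⊕ Fin b)) (r' : Setoid (Fin a' ⊕ Fin b'))
    (r'' : Setoid (Fin a'' ⊕ Fin b'')) :
    juxtapose (juxtapose r r') r'' = (juxtapose r (juxtapose r' r'')).map
      (Sum.map (Fin.cast (add_assoc a a' a'').symm) (Fin.cast (add_assoc b b' b'').symm)) := by
  simp only [juxtapose, map_sup, map_map, sup_assoc]
  refine congrArg₂ (· ⊔ ·) (congrArg r.map ?_)
    (congrArg₂ (· ⊔ ·) (congrArg r'.map ?_) (congrArg r''.map ?_))
  · funext x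
    rcases x with x | x <;> rfl
  · funext x
    rcases x with x | x <;> rfl
  · funext x
    rcases x with x | x <;> simp [rightBlock, Fin.ext_iff, add_assoc]

theorem juxtapose_empty (r : Setoid (Fin a ⊕ Fin b)) (r' : Setoid (Fin 0 ⊕ Fin 0)) :
    juxtapose r r' = r := by
  refine le_antisymm (sup_le (map_le_iff.2 fun x y h => ?_) (map_le_iff.2 fun x => ?_))
    fun x y h => ?_
  · rcases x with x | x <;> rcases y with y | y <;> exact h
  · rcases x with x | x <;> exact x.elim0
  · have := juxtapose_of_left (r' := r') h
    rcases x with x | x <;> rcases y with y | y <;> exact this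

end Assoc

/-! ### Identities between small diagrams: associativity, zigzags, the closed loop. -/

namespace Diagram

variable {a b c e a' b' : ℕ}

theorem eq_of_le {D E : Diagram a b} (h : D.rel ≤ E.rel) : D = E :=
  Diagram.ext (D.isMatching.eq_of_le E.isMatching h)

theorem tensor_zero (D : Diagram a b) (E : Diagram 0 0) : D.tensor E = D :=
  Diagram.ext (juxtapose_empty _ _)

/-- The third factor has numerals as sizes, so both bracketings have definitionally equal sizes and
the casts in `juxtapose_assoc` are identities. The next two cases work for the same reason. -/
theorem tensor_assoc_id (D : Diagram a b) (E : Diagram a' b') (F : Diagram 1 1) :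
    (D.tensor E).tensor F = D.tensor (E.tensor F) :=
  Diagram.ext ((juxtapose_assoc _ _ _).trans
    (map_eq_self (juxtapose D.rel (juxtapose E.rel F.rel)) (by rintro (x | x) <;> rfl)))

theorem tensor_assoc_cap (D : Diagram a b) (E : Diagram a' b') (F : Diagram 2 0) :
    (D.tensor E).tensor F = D.tensor (E.tensor F) :=
  Diagram.ext ((juxtapose_assoc _ _ _).trans
    (map_eq_self (juxtapose D.rel (juxtapose E.rel F.rel)) (by rintro (x | x) <;> rfl)))

theorem tensor_assoc_cup (D : Diagram a b) (E : Diagram a' b') (F : Diagram 0 2) :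
    (D.tensor E).tensor F = D.tensor (E.tensor F) :=
  Diagram.ext ((juxtapose_assoc _ _ _).trans
    (map_eq_self (juxtapose D.rel (juxtapose E.rel F.rel)) (by rintro (x | x) <;> rfl)))

/-- With this, straightening a zigzag needs no computation of the composite relation; only the loops
have to be counted. -/
theorem eq_id_one (D : Diagram 1 1) : D = Diagram.id 1 := by
  refine eq_of_le ?_
  rintro (x | x) (y | y) - <;> exact Subsingleton.elim x y

/-- A closed loop consists of middle points only, so it suffices to link each middle point to the
boundary. -/
theorem loops_eq_zero {D : Diagram a b} {E : Diagram b c}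
    (h : ∀ i : Fin b, ∃ x, glue D.rel E.rel (outer x) (Sum.inr (Sum.inl i))) : D.loops E = 0 := by
  refine missed_eq_zero ?_
  rintro (x | x | x)
  · exact ⟨Sum.inl x, Setoid.refl' _ _⟩
  · exact h x
  · exact ⟨Sum.inr x, Setoid.refl' _ _⟩

theorem glue_lower_middle {D : Diagram a b} {E : Diagram b c} {x : Fin a} {i : Fin b}
    (h : D.rel (Sum.inl x) (Sum.inr i)) :
    glue D.rel E.rel (outer (Sum.inl x)) (Sum.inr (Sum.inl i)) := glue_of_left h

theorem glue_upper_middle {D : Diagram a b} {E : Diagram b c} {z : Fin c} {i : Fin b}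
    (h : E.rel (Sum.inl i) (Sum.inr z)) :
    glue D.rel E.rel (outer (Sum.inr z)) (Sum.inr (Sum.inl i)) := glue_of_right (Setoid.symm' _ h)

theorem id_rel (i : Fin a) : (Diagram.id a).rel (Sum.inl i) (Sum.inr i) := rfl

theorem tensor_rel_left {D : Diagram a b} {D' : Diagram a' b'} {x y} (h : D.rel x y) :
    (D.tensor D').rel (leftBlock x) (leftBlock y) := juxtapose_of_left h

theorem tensor_rel_right {D : Diagram a b} {D' : Diagram a' b'} {x y} (h : D'.rel x y) :
    (D.tensor D').rel (rightBlock x) (rightBlock y) := juxtapose_of_right h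

/-- All middle points lie on one S-shaped string: point 0 is reached from below, point 1 from point
0 along the arc of `cap`, point 2 from above. -/
theorem zigzag_left : ((Diagram.id 1).tensor cup).loops (cap.tensor (Diagram.id 1)) = 0 := by
  refine loops_eq_zero fun i => ?_
  have h0 := glue_lower_middle (E := cap.tensor (Diagram.id 1)) (D := (Diagram.id 1).tensor cup)
    (tensor_rel_left (D' := cup) (id_rel (0 : Fin 1)))
  have h2 := glue_upper_middle (E := cap.tensor (Diagram.id 1)) (D := (Diagram.id 1).tensor cup)
    (tensor_rel_right (D := cap) (id_rel (0 : Fin 1)))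
  have h1 := glue_of_right (r := ((Diagram.id 1).tensor cup).rel)
    (tensor_rel_left (D' := Diagram.id 1)
      (show cap.rel (Sum.inl (0 : Fin 2)) (Sum.inl (1 : Fin 2)) from trivial))
  match i with
  | 0 => exact ⟨_, h0⟩
  | 1 => exact ⟨_, Setoid.trans' _ h0 h1⟩
  | 2 => exact ⟨_, h2⟩

theorem zigzag_right : (cup.tensor (Diagram.id 1)).loops ((Diagram.id 1).tensor cap) = 0 := by
  refine loops_eq_zero fun i => ?_
  have h0 := glue_upper_middle (E := (Diagram.id 1).tensor cap) (D := cup.tensor (Diagram.id 1))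
    (tensor_rel_left (D' := cap) (id_rel (0 : Fin 1)))
  have h2 := glue_lower_middle (E := (Diagram.id 1).tensor cap) (D := cup.tensor (Diagram.id 1))
    (tensor_rel_right (D := cup) (id_rel (0 : Fin 1)))
  have h1 := glue_of_left (s := ((Diagram.id 1).tensor cap).rel)
    (tensor_rel_left (D' := Diagram.id 1)
      (show cup.rel (Sum.inr (0 : Fin 2)) (Sum.inr (1 : Fin 2)) from trivial))
  match i with
  | 0 => exact ⟨_, h0⟩
  | 1 => exact ⟨_, Setoid.trans' _ h0 h1⟩
  | 2 => exact ⟨_, h2⟩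

theorem cup_loops_cap : cup.loops cap = 1 := by
  have hg : ∀ x y, glue cup.rel cap.rel x y := by
    rintro (x | x | x) (y | y | y)
    · exact x.elim0
    · exact x.elim0
    · exact x.elim0
    · exact y.elim0
    · exact glue_of_right trivial
    · exact y.elim0
    · exact x.elim0
    · exact x.elim0
    · exact x.elim0
  change Nat.card _ = 1
  rw [Nat.card_eq_one_iff_unique]
  refine ⟨⟨?_⟩, ⟨⟨Quotient.mk _ (Sum.inr (Sum.inl 0)), ?_⟩⟩⟩
  · rintro ⟨c, hc⟩ ⟨c', hc'⟩
    induction c using Quotient.inductionOn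
    induction c' using Quotient.inductionOn
    exact Subtype.ext (Quotient.sound (hg _ _))
  · rintro (x | x) <;> exact x.elim0

/-! Turning a diagram upside down. -/

/-- Turning the rectangle upside down reverses the order of the boundary points, so crossings go to
crossings. This is what makes `flip` planar. -/
theorem pos_swap (x : Fin a ⊕ Fin b) :
    pos x.swap + pos x + 1 = a + b := by
  rcases x with x | x <;> simp only [pos, Sum.swap_inl, Sum.swap_inr, Sum.elim_inl, Sum.elim_inr,
    Fin.val_rev] <;> omega

/-- The diagram turned upside down. -/
def flip (D : Diagram a b) : Diagram b a where
  rel := D.rel.comap Sum.swap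
  isMatching := by
    intro x
    obtain ⟨y, ⟨hy, hy'⟩, h⟩ := D.isMatching x.swap
    refine ⟨y.swap, ⟨fun e => hy (by rw [← e, Sum.swap_swap]), ?_⟩, ?_⟩
    · rw [Setoid.comap_rel, Sum.swap_swap]
      exact hy'
    · rintro z ⟨hz, hz'⟩
      rw [← h z.swap ⟨fun e => hz (by rw [← Sum.swap_swap z, e, Sum.swap_swap]), hz'⟩,
        Sum.swap_swap]
  isPlanar := by
    intro x y z w h1 h2 h3 h4 h5
    have := pos_swap x
    have := pos_swap y
    have := pos_swap z
    have := pos_swap w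
    exact D.isPlanar w.swap z.swap y.swap x.swap (by omega) (by omega) (by omega)
      (D.rel.symm h5) (D.rel.symm h4)

/-! Diagrams without arcs between neighbouring points of an edge. -/

/-- Innermost arc argument: the string starting at the point next to i is trapped under the arc from
i to j by planarity, and gives a shorter arc. Here `n` counts the points strictly between i and j.
-/
theorem not_rel_upper {D : Diagram a b}
    (h : ∀ i j : Fin b, (j : ℕ) = i + 1 → ¬ D.rel (Sum.inr i) (Sum.inr j)) :
    ∀ (n : ℕ) (i j : Fin b), (j : ℕ) = i + n + 1 → ¬ D.rel (Sum.inr i) (Sum.inr j) := by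
  intro n
  induction n using Nat.strong_induction_on with
  | _ n ih =>
    intro i j hij hr
    rcases Nat.eq_zero_or_pos n with rfl | hn
    · exact h i j hij hr
    let k : Fin b := ⟨i + 1, by omega⟩
    obtain ⟨z, ⟨hz, hz'⟩, -⟩ := D.isMatching (Sum.inr k)
    have hki : pos (Sum.inr k : Fin a ⊕ Fin b) < pos (Sum.inr i : Fin a ⊕ Fin b) := by
      simp only [pos, Sum.elim_inr, Fin.val_rev, k]; omega
    have hkj : pos (Sum.inr j : Fin a ⊕ Fin b) < pos (Sum.inr k : Fin a ⊕ Fin b) := by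
      simp only [pos, Sum.elim_inr, Fin.val_rev, k]; omega
    have hzi : z ≠ Sum.inr i := by
      rintro rfl
      have := D.isMatching.eq_of_rel (D.rel.symm hz') hr (by simp [k, Fin.ext_iff])
        (by simp [Fin.ext_iff]; omega)
      simp [k, Fin.ext_iff] at this
      omega
    have hzj : z ≠ Sum.inr j := by
      rintro rfl
      have := D.isMatching.eq_of_rel (D.rel.symm hz') (D.rel.symm hr)
        (by simp [k, Fin.ext_iff]; omega) (by simp [Fin.ext_iff]; omega)
      simp [k, Fin.ext_iff] at this
    have h1 : pos z < pos (Sum.inr i : Fin a ⊕ Fin b) := by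
      refine lt_of_le_of_ne (not_lt.1 fun hlt => ?_) fun e => hzi (pos_injective e)
      exact D.isPlanar _ _ _ _ hkj hki hlt (D.rel.symm hr) hz'
    have h2 : pos (Sum.inr j : Fin a ⊕ Fin b) < pos z := by
      refine lt_of_le_of_ne (not_lt.1 fun hlt => ?_) fun e => hzj (pos_injective e.symm)
      exact D.isPlanar _ _ _ _ hlt hkj hki (D.rel.symm hz') (D.rel.symm hr)
    -- In the boundary order z lies between j and i, where there are only upper points.
    rcases z with z | l
    · simp only [pos, Sum.elim_inl, Sum.elim_inr] at h2
      omega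
    · simp only [pos, Sum.elim_inr, Fin.val_rev] at h1 h2
      have hlk : (l : ℕ) ≠ k := fun e => hz (congrArg Sum.inr (Fin.ext e))
      simp only [k] at hlk
      exact ih (l - k - 1) (by simp only [k]; omega) k l (by simp only [k]; omega) hz'

/-- By `not_rel_upper` no two upper points are joined, so each upper point is joined to a lower one.
Planarity makes this map strictly increasing, the cardinalities then agree, and a finite chain has
no order automorphism but the identity. -/
theorem eq_id_of_forall_not_upper {D : Diagram a b} (hab : a ≤ b)
    (h : ∀ i j : Fin b, (j : ℕ) = i + 1 → ¬ D.rel (Sum.inr i) (Sum.inr j)) :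
    ∃ e : a = b, e ▸ D = Diagram.id b := by
  have h' := not_rel_upper h
  have hex : ∀ i : Fin b, ∃ j : Fin a, D.rel (Sum.inr i) (Sum.inl j) := by
    intro i
    obtain ⟨z, ⟨hz, hz'⟩, -⟩ := D.isMatching (Sum.inr i)
    rcases z with z | z
    · exact ⟨z, hz'⟩
    · rcases lt_trichotomy (i : ℕ) z with hlt | heq | hlt
      · exact absurd hz' (h' (z - i - 1) i z (by omega))
      · exact absurd (congrArg Sum.inr (Fin.ext heq.symm)) hz
      · exact absurd (D.rel.symm hz') (h' (i - z - 1) z i (by omega))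
  choose φ hφ using hex
  have hmono : StrictMono φ := by
    intro i j hij
    by_contra hle
    rcases lt_or_eq_of_le (not_lt.1 hle) with hlt | heq
    · refine D.isPlanar (Sum.inl (φ j)) (Sum.inl (φ i)) (Sum.inr j) (Sum.inr i) hlt ?_ ?_
        (D.rel.symm (hφ j)) (D.rel.symm (hφ i))
      · simp only [pos, Sum.elim_inl, Sum.elim_inr]; omega
      · have : (i : ℕ) < j := hij
        simp only [pos, Sum.elim_inr, Fin.val_rev]; omega
    · have := D.isMatching.eq_of_rel (D.rel.symm (hφ i)) (heq ▸ D.rel.symm (hφ j)) (by simp)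
        (by simp)
      exact hij.ne (Sum.inr_injective this)
  have hba : b ≤ a := by simpa using Fintype.card_le_of_injective φ hmono.injective
  obtain rfl : a = b := le_antisymm hab hba
  refine ⟨rfl, (eq_of_le ?_).symm⟩
  have hid : φ = _root_.id := by
    have : ∀ i, φ i = i := fun i => by
      have h1 := Subsingleton.elim (StrictMono.orderIsoOfSurjective φ hmono
        (Finite.surjective_of_injective hmono.injective)) (OrderIso.refl _)
      exact congrArg (fun e : Fin a ≃o Fin a => e i) h1
    exact funext this
  rintro (x | x) (y | y) hxy <;> cases (show x = y from hxy)
  · exact D.rel.refl _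
  · simpa [hid] using D.rel.symm (hφ x)
  · simpa [hid] using hφ x
  · exact D.rel.refl _

theorem exists_upper_of_lt {D : Diagram a b} (hab : a < b) :
    ∃ i j : Fin b, (j : ℕ) = i + 1 ∧ D.rel (Sum.inr i) (Sum.inr j) := by
  by_contra! h
  obtain ⟨e, -⟩ := eq_id_of_forall_not_upper hab.le h
  omega

theorem exists_upper_of_ne {D : Diagram a a} (hD : D ≠ Diagram.id a) :
    ∃ i j : Fin a, (j : ℕ) = i + 1 ∧ D.rel (Sum.inr i) (Sum.inr j) := by
  by_contra! h
  obtain ⟨e, he⟩ := eq_id_of_forall_not_upper le_rfl h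
  exact hD he

theorem exists_lower_of_lt {D : Diagram a b} (hab : b < a) :
    ∃ i j : Fin a, (j : ℕ) = i + 1 ∧ D.rel (Sum.inl i) (Sum.inl j) :=
  exists_upper_of_lt (D := D.flip) hab

/-- A diagram with fewer upper than lower points has an arc on its lower edge, and this arc survives
in every composite. -/
theorem comp_ne_id (D : Diagram a b) (E : Diagram b a) (hab : b < a) :
    D.comp E ≠ Diagram.id a := by
  intro h
  obtain ⟨i, j, hij, hr⟩ := exists_lower_of_lt (D := D) hab
  have h1 : (D.comp E).rel (Sum.inl i) (Sum.inl j) := stack_of_lower hr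
  rw [h] at h1
  have : i = j := h1
  rw [this] at hij
  omega

end Diagram

namespace Diagram

variable {a b c k : ℕ}

/-! ### Splitting off an arc -/

section Factor

variable {m l : ℕ} {C : Diagram m l} {U : Diagram l m} {σ : Fin l → Fin m} {p q : Fin m}

/-- The arc of `D` at p, q is recreated by `C`, and all other strings of `D` are prolonged by the
through strings of `U` and `C`; by `eq_of_le` this determines the composite. A loop closed in
forming `U.comp D` is irrelevant, since only the loops between `C` and `U.comp D` are counted. -/
theorem comp_comp_of_lower_arc (hC : ∀ i, C.rel (Sum.inl (σ i)) (Sum.inr i))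
    (hU : ∀ i, U.rel (Sum.inl i) (Sum.inr (σ i))) (hpq : p ≠ q)
    (hCpq : C.rel (Sum.inl p) (Sum.inl q)) (hσ : ∀ x, x = p ∨ x = q ∨ ∃ i, x = σ i)
    (D : Diagram m b) (hD : D.rel (Sum.inl p) (Sum.inl q)) :
    C.comp (U.comp D) = D ∧ C.loops (U.comp D) = 0 := by
  refine ⟨(eq_of_le ?_).symm, loops_eq_zero fun i => ⟨_, glue_lower_middle (hC i)⟩⟩
  have hp : ∀ y, D.rel (Sum.inl p) y → y = Sum.inl p ∨ y = Sum.inl q := fun y hy =>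
    or_iff_not_imp_left.2 fun h => D.isMatching.eq_of_rel hy hD h (by simpa using hpq.symm)
  have hq : ∀ y, D.rel (Sum.inl q) y → y = Sum.inl p ∨ y = Sum.inl q := fun y hy =>
    hp y (D.rel.trans hD hy)
  have hR : (C.comp (U.comp D)).rel (Sum.inl p) (Sum.inl q) := stack_of_lower hCpq
  -- `τ` reaches all boundary points of `D` apart from p and q.
  let τ : Fin l ⊕ Fin b → Fin m ⊕ Fin b := Sum.map σ _root_.id
  have hτ : ∀ x, x = Sum.inl p ∨ x = Sum.inl q ∨ ∃ y, x = τ y := by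
    rintro (x | x)
    · rcases hσ x with rfl | rfl | ⟨i, rfl⟩
      · exact Or.inl rfl
      · exact Or.inr (Or.inl rfl)
      · exact Or.inr (Or.inr ⟨Sum.inl i, rfl⟩)
    · exact Or.inr (Or.inr ⟨Sum.inr x, rfl⟩)
  have h1 : ∀ x : Fin l ⊕ Fin b, glue U.rel D.rel (outer x) (Sum.inr (τ x)) := by
    rintro (x | x)
    · exact glue_of_left (hU x)
    · exact Setoid.refl' _ _
  have h2 : ∀ x y, D.rel (τ x) (τ y) → (U.comp D).rel x y := fun x y h =>
    Setoid.trans' (glue U.rel D.rel) (h1 x) (Setoid.trans' _ (glue_of_right h) (Setoid.symm' _ (h1 y)))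
  have h3 : ∀ x : Fin l ⊕ Fin b, glue C.rel (U.comp D).rel (outer (τ x)) (Sum.inr x) := by
    rintro (x | x)
    · exact glue_of_left (hC x)
    · exact Setoid.refl' _ _
  have h4 : ∀ x y, D.rel (τ x) (τ y) → (C.comp (U.comp D)).rel (τ x) (τ y) := fun x y h =>
    Setoid.trans' (glue C.rel (U.comp D).rel) (h3 x) (Setoid.trans' _ (glue_of_right (h2 _ _ h)) (Setoid.symm' _ (h3 y)))
  intro x y hxy
  rcases hτ x with rfl | rfl | ⟨x, rfl⟩
  · rcases hp y hxy with rfl | rfl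
    · exact Setoid.refl' _ _
    · exact hR
  · rcases hq y hxy with rfl | rfl
    · exact Setoid.symm' _ hR
    · exact Setoid.refl' _ _
  · rcases hτ y with rfl | rfl | ⟨y, rfl⟩
    · rcases hp _ (D.rel.symm hxy) with h | h <;> rw [h]
      exact Setoid.symm' _ hR
    · rcases hq _ (D.rel.symm hxy) with h | h <;> rw [h]
      exact hR
    · exact h4 x y hxy

theorem comp_comp_of_upper_arc (hC : ∀ i, C.rel (Sum.inl (σ i)) (Sum.inr i))
    (hU : ∀ i, U.rel (Sum.inl i) (Sum.inr (σ i))) (hpq : p ≠ q)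
    (hUpq : U.rel (Sum.inr p) (Sum.inr q)) (hσ : ∀ x, x = p ∨ x = q ∨ ∃ i, x = σ i)
    (D : Diagram b m) (hD : D.rel (Sum.inr p) (Sum.inr q)) :
    (D.comp C).comp U = D ∧ (D.comp C).loops U = 0 := by
  refine ⟨(eq_of_le ?_).symm, loops_eq_zero fun i => ⟨_, glue_upper_middle (hU i)⟩⟩
  have hp : ∀ y, D.rel (Sum.inr p) y → y = Sum.inr p ∨ y = Sum.inr q := fun y hy =>
    or_iff_not_imp_left.2 fun h => D.isMatching.eq_of_rel hy hD h (by simpa using hpq.symm)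
  have hq : ∀ y, D.rel (Sum.inr q) y → y = Sum.inr p ∨ y = Sum.inr q := fun y hy =>
    hp y (D.rel.trans hD hy)
  have hR : ((D.comp C).comp U).rel (Sum.inr p) (Sum.inr q) := stack_of_upper hUpq
  let τ : Fin b ⊕ Fin l → Fin b ⊕ Fin m := Sum.map _root_.id σ
  have hτ : ∀ x, x = Sum.inr p ∨ x = Sum.inr q ∨ ∃ y, x = τ y := by
    rintro (x | x)
    · exact Or.inr (Or.inr ⟨Sum.inl x, rfl⟩)
    · rcases hσ x with rfl | rfl | ⟨i, rfl⟩
      · exact Or.inl rfl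
      · exact Or.inr (Or.inl rfl)
      · exact Or.inr (Or.inr ⟨Sum.inr i, rfl⟩)
  have h1 : ∀ x : Fin b ⊕ Fin l, glue D.rel C.rel (outer x) (Sum.map _root_.id Sum.inl (τ x)) := by
    rintro (x | x)
    · exact Setoid.refl' _ _
    · exact glue_of_right (Setoid.symm' _ (hC x))
  have h2 : ∀ x y, D.rel (τ x) (τ y) → (D.comp C).rel x y := fun x y h =>
    Setoid.trans' (glue D.rel C.rel) (h1 x) (Setoid.trans' _ (glue_of_left h) (Setoid.symm' _ (h1 y)))
  have h3 : ∀ x : Fin b ⊕ Fin l,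
      glue (D.comp C).rel U.rel (outer (τ x)) (Sum.map _root_.id Sum.inl x) := by
    rintro (x | x)
    · exact Setoid.refl' _ _
    · exact glue_of_right (Setoid.symm' _ (hU x))
  have h4 : ∀ x y, D.rel (τ x) (τ y) → ((D.comp C).comp U).rel (τ x) (τ y) := fun x y h =>
    Setoid.trans' (glue (D.comp C).rel U.rel) (h3 x) (Setoid.trans' _ (glue_of_left (h2 _ _ h)) (Setoid.symm' _ (h3 y)))
  intro x y hxy
  rcases hτ x with rfl | rfl | ⟨x, rfl⟩
  · rcases hp y hxy with rfl | rfl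
    · exact Setoid.refl' _ _
    · exact hR
  · rcases hq y hxy with rfl | rfl
    · exact Setoid.symm' _ hR
    · exact Setoid.refl' _ _
  · rcases hτ y with rfl | rfl | ⟨y, rfl⟩
    · rcases hp _ (D.rel.symm hxy) with h | h <;> rw [h]
      exact Setoid.symm' _ hR
    · rcases hq _ (D.rel.symm hxy) with h | h <;> rw [h]
      exact hR
    · exact h4 x y hxy

end Factor

/-! ### Arcs at a prescribed position. -/

/-- Vertical strings, except for an arc joining the lower points `j` and `j + 1`. -/
def capAt (j : ℕ) : ∀ m : ℕ, Diagram (j + 2 + m) (j + m)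
  | 0 => (Diagram.id j).tensor cap
  | m + 1 => (capAt j m).tensor (Diagram.id 1)

/-- Vertical strings, except for an arc joining the upper points `j` and `j + 1`. -/
def cupAt (j : ℕ) : ∀ m : ℕ, Diagram (j + m) (j + 2 + m)
  | 0 => (Diagram.id j).tensor cup
  | m + 1 => (cupAt j m).tensor (Diagram.id 1)

theorem capAt_arc (j : ℕ) : ∀ (m : ℕ) (x y : Fin (j + 2 + m)), (x : ℕ) = j → (y : ℕ) = j + 1 →
    (capAt j m).rel (Sum.inl x) (Sum.inl y)
  | 0, x, y, hx, hy => by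
    obtain rfl : x = Fin.natAdd j (0 : Fin 2) := Fin.ext hx
    obtain rfl : y = Fin.natAdd j (1 : Fin 2) := Fin.ext hy
    exact tensor_rel_right (D := Diagram.id j) (D' := cap) (x := Sum.inl 0) (y := Sum.inl 1) trivial
  | m + 1, x, y, hx, hy => by
    exact tensor_rel_left (D' := Diagram.id 1)
      (capAt_arc j m ⟨x, by omega⟩ ⟨y, by omega⟩ hx hy)

theorem cupAt_arc (j : ℕ) : ∀ (m : ℕ) (x y : Fin (j + 2 + m)), (x : ℕ) = j → (y : ℕ) = j + 1 →
    (cupAt j m).rel (Sum.inr x) (Sum.inr y)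
  | 0, x, y, hx, hy => by
    obtain rfl : x = Fin.natAdd j (0 : Fin 2) := Fin.ext hx
    obtain rfl : y = Fin.natAdd j (1 : Fin 2) := Fin.ext hy
    exact tensor_rel_right (D := Diagram.id j) (D' := cup) (x := Sum.inr 0) (y := Sum.inr 1) trivial
  | m + 1, x, y, hx, hy => by
    exact tensor_rel_left (D' := Diagram.id 1)
      (cupAt_arc j m ⟨x, by omega⟩ ⟨y, by omega⟩ hx hy)

/-- The increasing map which misses `j` and `j + 1`. -/
def skip (j m : ℕ) (i : Fin (j + m)) : Fin (j + 2 + m) :=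
  ⟨if (i : ℕ) < j then i else i + 2, by split_ifs <;> omega⟩

theorem eq_skip {j m : ℕ} {p q : Fin (j + 2 + m)} (hp : (p : ℕ) = j) (hq : (q : ℕ) = j + 1)
    (x : Fin (j + 2 + m)) : x = p ∨ x = q ∨ ∃ i, x = skip j m i := by
  by_cases h1 : (x : ℕ) < j
  · exact Or.inr (Or.inr ⟨⟨x, by omega⟩, Fin.ext (by simp [skip, h1])⟩)
  by_cases h2 : (x : ℕ) = j
  · exact Or.inl (Fin.ext (by omega))
  by_cases h3 : (x : ℕ) = j + 1
  · exact Or.inr (Or.inl (Fin.ext (by omega)))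
  · refine Or.inr (Or.inr ⟨⟨x - 2, by omega⟩, Fin.ext ?_⟩)
    simp only [skip]
    rw [if_neg (by omega)]
    omega

theorem skip_natAdd (j m : ℕ) (i : Fin 1) :
    skip j (m + 1) (Fin.natAdd (j + m) i) = Fin.natAdd (j + 2 + m) i := by
  ext
  simp [skip]
  omega

theorem skip_zero (j : ℕ) (i : Fin j) : skip j 0 i = Fin.castAdd 2 i := by
  ext
  simp [skip]

theorem capAt_through (j : ℕ) : ∀ (m : ℕ) (i : Fin (j + m)),
    (capAt j m).rel (Sum.inl (skip j m i)) (Sum.inr i)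
  | 0, i => by
    rw [skip_zero j i]
    exact tensor_rel_left (D' := cap) (id_rel i)
  | m + 1, i => by
    rcases fin_add_cases (a := j + m) (a' := 1) i with ⟨k, rfl⟩ | ⟨k, rfl⟩
    · exact tensor_rel_left (D' := Diagram.id 1) (capAt_through j m k)
    · rw [skip_natAdd]
      exact tensor_rel_right (D := capAt j m) (id_rel k)

theorem cupAt_through (j : ℕ) : ∀ (m : ℕ) (i : Fin (j + m)),
    (cupAt j m).rel (Sum.inl i) (Sum.inr (skip j m i))
  | 0, i => by
    rw [skip_zero j i]
    exact tensor_rel_left (D' := cup) (id_rel i)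
  | m + 1, i => by
    rcases fin_add_cases (a := j + m) (a' := 1) i with ⟨k, rfl⟩ | ⟨k, rfl⟩
    · exact tensor_rel_left (D' := Diagram.id 1) (cupAt_through j m k)
    · rw [skip_natAdd]
      exact tensor_rel_right (D := cupAt j m) (id_rel k)

/-- The witness is `(cupAt j m).comp D`, which is `D` with the arc removed. -/
theorem exists_capAt_comp {j m : ℕ} (D : Diagram (j + 2 + m) b) {p q : Fin (j + 2 + m)}
    (hp : (p : ℕ) = j) (hq : (q : ℕ) = j + 1) (h : D.rel (Sum.inl p) (Sum.inl q)) :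
    ∃ E, (capAt j m).comp E = D ∧ (capAt j m).loops E = 0 :=
  ⟨_, comp_comp_of_lower_arc (capAt_through j m) (cupAt_through j m)
    (fun e => by rw [e] at hp; omega) (capAt_arc j m p q hp hq) (eq_skip hp hq) D h⟩

theorem exists_comp_cupAt {j m : ℕ} (D : Diagram b (j + 2 + m)) {p q : Fin (j + 2 + m)}
    (hp : (p : ℕ) = j) (hq : (q : ℕ) = j + 1) (h : D.rel (Sum.inr p) (Sum.inr q)) :
    ∃ E : Diagram b (j + m), E.comp (cupAt j m) = D ∧ E.loops (cupAt j m) = 0 :=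
  ⟨_, comp_comp_of_upper_arc (capAt_through j m) (cupAt_through j m)
    (fun e => by rw [e] at hp; omega) (cupAt_arc j m p q hp hq) (eq_skip hp hq) D h⟩

end Diagram

/-! ### Counting the loops of a closure -/

theorem card_quotient_eq {V V' : Type} {r : Setoid V} {r' : Setoid V'} (p : V → V') (i : V' → V)
    (hpi : ∀ v, p (i v) = v) (hip : ∀ v, r v (i (p v))) (hr : ∀ v w, r v w → r' (p v) (p w))
    (hr' : ∀ v w, r' v w → r (i v) (i w)) : Nat.card (Quotient r) = Nat.card (Quotient r') :=
  Nat.card_congr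
    { toFun := Quotient.map p hr
      invFun := Quotient.map i hr'
      left_inv := fun c => by
        induction c using Quotient.inductionOn with
        | h v => exact Quotient.sound (r.symm (hip v))
      right_inv := fun c => by
        induction c using Quotient.inductionOn with
        | h v => exact congrArg (Quotient.mk r') (hpi v) }

theorem missed_empty {B : Type} (r : Setoid B) (f : Empty → B) :
    missed r f = Nat.card (Quotient r) :=
  Nat.card_congr (Equiv.subtypeUnivEquiv fun _ a => a.elim)

namespace Diagram

variable {a b c k : ℕ}

/-- The number of loops when the upper edges of both diagrams are joined with the lower edge of
the other one. -/
noncomputable def circularLoops (D : Diagram a b) (E : Diagram b a) : ℕ :=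
  Nat.card (Quotient (D.rel ⊔ E.flip.rel))

theorem circularLoops_comm (D : Diagram a b) (E : Diagram b a) :
    circularLoops D E = circularLoops E D := by
  refine card_quotient_eq Sum.swap Sum.swap Sum.swap_swap
    (fun v => by rw [Sum.swap_swap]) ?_ ?_
  · have : D.rel ⊔ E.flip.rel ≤ (E.rel ⊔ D.flip.rel).comap Sum.swap := by
      refine sup_le (fun x y h => ?_) (fun x y h => ?_)
      · refine (le_sup_right : D.flip.rel ≤ _) (?_ : D.rel _ _)
        rwa [Sum.swap_swap, Sum.swap_swap]
      · exact (le_sup_left : E.rel ≤ _) h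
    exact fun v w h => this h
  · have : E.rel ⊔ D.flip.rel ≤ (D.rel ⊔ E.flip.rel).comap Sum.swap := by
      refine sup_le (fun x y h => ?_) (fun x y h => ?_)
      · refine (le_sup_right : E.flip.rel ≤ _) (?_ : E.rel _ _)
        rwa [Sum.swap_swap, Sum.swap_swap]
      · exact (le_sup_left : D.rel ≤ _) h
    exact fun v w h => this h

/-- Both sides count the components of the same picture drawn on an annulus: those inside the glued
rectangle are the removed loops, the others are the loops of the closed composite. This is
`contract_missed` with no outer points. The right side is symmetric in the two diagrams, which
yields the trace property. -/
theorem loops_add_closureLoops (D : Diagram a b) (E : Diagram b a) :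
    D.loops E + (D.comp E).closureLoops = circularLoops D E := by
  have h := contract_missed (glue D.rel E.rel) (Diagram.id a).rel _root_.id outer outer _root_.id
    Function.injective_id outer_injective (fun x => rfl) (fun u w h => ⟨w, h, rfl⟩)
    (fun v => Or.inl ⟨v, rfl⟩) (Empty.elim : Empty → Fin a ⊕ Fin a) (fun e => e.elim)
  have h1 : ((glue D.rel E.rel).comap outer).map _root_.id = (D.comp E).rel :=
    map_eq_self _ fun _ => rfl
  have h2 : (glue D.rel E.rel).map _root_.id = glue D.rel E.rel := map_eq_self _ fun _ => rfl
  rw [missed_empty, missed_empty, h1, h2] at h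
  refine Eq.trans h.symm ?_
  -- The closing strings join the third row to the first, so the third row is retracted onto it.
  refine card_quotient_eq (Sum.elim Sum.inl (Sum.elim Sum.inr Sum.inl))
    (Sum.map _root_.id Sum.inl) ?_ ?_ ?_ ?_
  · rintro (v | v) <;> rfl
  · rintro (v | v | v)
    · exact Setoid.refl' _ _
    · exact Setoid.refl' _ _
    · exact (le_sup_right : (Diagram.id a).rel.map outer ≤ _)
        (map_rel (r := (Diagram.id a).rel) outer (x := Sum.inr v) (y := Sum.inl v) rfl)
  · have : glue D.rel E.rel ⊔ (Diagram.id a).rel.map outer ≤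
        (D.rel ⊔ E.flip.rel).comap (Sum.elim Sum.inl (Sum.elim Sum.inr Sum.inl)) := by
      refine sup_le (sup_le (map_le_iff.2 fun x y h => ?_) (map_le_iff.2 fun x y h => ?_))
        (map_le_iff.2 fun x y h => ?_)
      · have := (le_sup_left : D.rel ≤ D.rel ⊔ E.flip.rel) h
        rcases x with x | x <;> rcases y with y | y <;> exact this
      · have := (le_sup_right : E.flip.rel ≤ D.rel ⊔ E.flip.rel) (x := x.swap) (y := y.swap)
          (by rcases x with x | x <;> rcases y with y | y <;> exact h)
        rcases x with x | x <;> rcases y with y | y <;> exact this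
      · rcases x with x | x <;> rcases y with y | y <;> cases (show x = y from h) <;>
          exact Setoid.refl' (D.rel ⊔ E.flip.rel) (Sum.inl x)
    exact fun v w h => this h
  · have : D.rel ⊔ E.flip.rel ≤ (glue D.rel E.rel ⊔ (Diagram.id a).rel.map outer).comap
        (Sum.map _root_.id Sum.inl) := by
      refine sup_le (fun x y h => ?_) (fun x y h => ?_)
      · exact (le_sup_left : glue D.rel E.rel ≤ _) (glue_of_left h)
      · have key : ∀ x : Fin a ⊕ Fin b, (glue D.rel E.rel ⊔ (Diagram.id a).rel.map outer)
            (Sum.map _root_.id Sum.inl x) (Sum.inr x.swap) := by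
          rintro (x | x)
          · exact (le_sup_right : (Diagram.id a).rel.map outer ≤ _)
              (map_rel (r := (Diagram.id a).rel) outer (x := Sum.inl x) (y := Sum.inr x) rfl)
          · exact Setoid.refl' _ _
        have h' := (le_sup_left : glue D.rel E.rel ≤
          glue D.rel E.rel ⊔ (Diagram.id a).rel.map outer) (glue_of_right (r := D.rel) h)
        exact Setoid.trans' (glue D.rel E.rel ⊔ (Diagram.id a).rel.map outer) (key x)
          (Setoid.trans' _ h' (Setoid.symm' _ (key y)))
    exact fun v w h => this h

theorem cap_comp_cup_rel {x y : Fin 2 ⊕ Fin 2} (h : (cap.comp cup).rel x y) :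
    x.isLeft = y.isLeft := by
  have hle : glue cap.rel cup.rel ≤ Setoid.ker Sum.isLeft := by
    refine sup_le (map_le_iff.2 ?_) (map_le_iff.2 ?_)
    · rintro (x | x) (y | y) -
      · rfl
      · exact y.elim0
      · exact x.elim0
      · rfl
    · rintro x y -
      rfl
  have := hle h
  rcases x with x | x <;> rcases y with y | y <;> exact this

/-- The added vertical string and the two arcs of the other diagram form a single string around the
outside, joining the last lower and the last upper point of `D` just as the closure of `D` does. -/
theorem circularLoops_strand (D : Diagram (k + 1) (k + 1)) :
    circularLoops (D.tensor (Diagram.id 1)) ((Diagram.id k).tensor (cap.comp cup)) =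
      D.closureLoops := by
  let T : Diagram (k + 2) (k + 2) := D.tensor (Diagram.id 1)
  let H : Diagram (k + 2) (k + 2) := (Diagram.id k).tensor (cap.comp cup)
  -- The extra last point of each row is retracted onto its neighbour, to which it is joined by an
  -- arc.
  let π : Fin (k + 2) → Fin (k + 1) := fun i => ⟨min i k, by omega⟩
  let i : Fin (k + 1) ⊕ Fin (k + 1) → Fin (k + 2) ⊕ Fin (k + 2) :=
    leftBlock (a' := 1) (b' := 1)
  let p : Fin (k + 2) ⊕ Fin (k + 2) → Fin (k + 1) ⊕ Fin (k + 1) := Sum.map π π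
  have hpi : ∀ v, p (i v) = v := by
    rintro (v | v)
    · exact congrArg Sum.inl (Fin.ext (min_eq_left (Nat.lt_succ_iff.1 v.2)))
    · exact congrArg Sum.inr (Fin.ext (min_eq_left (Nat.lt_succ_iff.1 v.2)))
  have hTid : ∀ j : Fin 1, T.rel (Sum.inl (Fin.natAdd (k + 1) j)) (Sum.inr (Fin.natAdd (k + 1) j)) :=
    fun j => tensor_rel_right (D := D) (id_rel j)
  have hHl : H.rel (Sum.inl (Fin.natAdd k 0)) (Sum.inl (Fin.natAdd k 1)) :=
    tensor_rel_right (D := Diagram.id k) (x := Sum.inl 0) (y := Sum.inl 1)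
      (stack_of_lower (x := (0 : Fin 2)) (y := (1 : Fin 2)) trivial)
  have hHr : H.rel (Sum.inr (Fin.natAdd k 0)) (Sum.inr (Fin.natAdd k 1)) :=
    tensor_rel_right (D := Diagram.id k) (x := Sum.inr 0) (y := Sum.inr 1)
      (stack_of_upper (x := (0 : Fin 2)) (y := (1 : Fin 2)) trivial)
  have hHid : ∀ j : Fin k, H.rel (Sum.inl (Fin.castAdd 2 j)) (Sum.inr (Fin.castAdd 2 j)) :=
    fun j => tensor_rel_left (D' := cap.comp cup) (id_rel j)
  have hT : ∀ {x y}, T.rel x y → (T.rel ⊔ H.flip.rel) x y := fun h =>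
    (le_sup_left : T.rel ≤ _) h
  have hH : ∀ {x y : Fin (k + 2) ⊕ Fin (k + 2)}, H.rel x.swap y.swap →
    (T.rel ⊔ H.flip.rel) x y := fun h => (le_sup_right : H.flip.rel ≤ T.rel ⊔ H.flip.rel) h
  have hcases : ∀ v : Fin (k + 2), (∃ w : Fin (k + 1), v = Fin.castAdd 1 w) ∨
      v = Fin.natAdd k (1 : Fin 2) := by
    intro v
    rcases fin_add_cases (a := k + 1) (a' := 1) v with ⟨w, rfl⟩ | ⟨w, rfl⟩
    · exact Or.inl ⟨w, rfl⟩
    · refine Or.inr (Fin.ext ?_)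
      have := w.2
      simp
  refine card_quotient_eq (r := T.rel ⊔ H.flip.rel) p i hpi ?_ ?_ ?_
  · have hπ : Fin.castAdd 1 (π (Fin.natAdd k (1 : Fin 2))) = Fin.natAdd k (0 : Fin 2) :=
      Fin.ext (by simp [π])
    have hπ' : ∀ w : Fin (k + 1), Fin.castAdd 1 (π (Fin.castAdd 1 w)) = Fin.castAdd 1 w :=
      fun w => Fin.ext (by simp [π]; omega)
    rintro (v | v)
    · change (T.rel ⊔ H.flip.rel) (Sum.inl v) (Sum.inl (Fin.castAdd 1 (π v)))
      rcases hcases v with ⟨w, rfl⟩ | rfl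
      · rw [hπ']
      · rw [hπ]
        exact Setoid.symm' _ (hH hHr)
    · change (T.rel ⊔ H.flip.rel) (Sum.inr v) (Sum.inr (Fin.castAdd 1 (π v)))
      rcases hcases v with ⟨w, rfl⟩ | rfl
      · rw [hπ']
      · rw [hπ]
        exact Setoid.symm' _ (hH hHl)
  · set R := D.rel ⊔ (Diagram.id (k + 1)).rel with hR
    have hid : ∀ x : Fin (k + 1), R (Sum.inl x) (Sum.inr x) := fun x =>
      (le_sup_right : (Diagram.id (k + 1)).rel ≤ R) (id_rel x)
    have h1 : T.rel ≤ R.comap p := by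
      refine sup_le (map_le_iff.2 fun x y h => ?_) (map_le_iff.2 fun x y h => ?_)
      · change R (p (i x)) (p (i y))
        rw [hpi, hpi]
        exact (le_sup_left : D.rel ≤ R) h
      · rcases x with x | x <;> rcases y with y | y <;> cases (show x = y from h)
        · exact Setoid.refl' _ _
        · exact hid _
        · exact Setoid.symm' _ (hid _)
        · exact Setoid.refl' _ _
    have h2 : H.rel ≤ R.comap (p ∘ Sum.swap) := by
      refine sup_le (map_le_iff.2 fun x y h => ?_) (map_le_iff.2 fun x y h => ?_)
      · rcases x with x | x <;> rcases y with y | y <;> cases (show x = y from h)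
        · exact Setoid.refl' _ _
        · exact Setoid.symm' _ (hid _)
        · exact hid _
        · exact Setoid.refl' _ _
      · have h' := cap_comp_cup_rel h
        have hπ : ∀ x y : Fin 2, π (Fin.natAdd k x) = π (Fin.natAdd k y) := fun x y =>
          Fin.ext (by simp [π])
        have hpe : p (Sum.swap (rightBlock x)) = p (Sum.swap (rightBlock y)) := by
          rcases x with x | x <;> rcases y with y | y
          · exact congrArg Sum.inr (hπ x y)
          · cases h'
          · cases h'
          · exact congrArg Sum.inl (hπ x y)
        change R (p (Sum.swap (rightBlock x))) (p (Sum.swap (rightBlock y)))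
        rw [hpe]
    have h3 : T.rel ⊔ H.flip.rel ≤ R.comap p := by
      refine sup_le h1 fun x y h => ?_
      have := h2 (show H.rel x.swap y.swap from h)
      simpa [Setoid.comap_rel] using this
    exact fun v w h => h3 h
  · have h1 : D.rel ⊔ (Diagram.id (k + 1)).rel ≤ (T.rel ⊔ H.flip.rel).comap i := by
      have hid : ∀ x : Fin (k + 1), (T.rel ⊔ H.flip.rel) (i (Sum.inl x)) (i (Sum.inr x)) := by
        intro x
        rcases fin_add_cases (a := k) (a' := 1) x with ⟨w, rfl⟩ | ⟨w, rfl⟩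
        · exact hH (Setoid.symm' _ (hHid w))
        · rw [Subsingleton.elim w 0]
          exact Setoid.trans' _ (hH (y := Sum.inl (Fin.natAdd k 1)) hHr)
            (Setoid.trans' _ (hT (hTid 0))
              (Setoid.symm' _ (hH (y := Sum.inr (Fin.natAdd k 1)) hHl)))
      refine sup_le (fun x y h => hT (tensor_rel_left h)) ?_
      rintro (x | x) (y | y) h <;> cases (show x = y from h)
      · exact Setoid.refl' _ _
      · exact hid x
      · exact Setoid.symm' _ (hid x)
      · exact Setoid.refl' _ _
    exact fun v w h => h1 h

end Diagram

section Morphisms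

variable {d : ℂ} {a b c k : ℕ}

/-! ### Calculating with morphisms -/

theorem smul_ofDiagram (x : ℂ) (D : Diagram a b) :
    x • ofDiagram d D = (Finsupp.single D x : Diagram a b →₀ ℂ) :=
  (Finsupp.smul_single x D (1 : ℂ)).trans (by rw [smul_eq_mul, mul_one])

/-- Reduces linear identities to diagrams without leaving the language of morphisms for that of
`Finsupp`. -/
theorem hom_induction {P : (pow d a ⟶ pow d b) → Prop} (zero : P 0)
    (add : ∀ f g, P f → P g → P (f + g)) (smul : ∀ (x : ℂ) (D : Diagram a b), P (x • ofDiagram d D))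
    (f : pow d a ⟶ pow d b) : P f :=
  Finsupp.induction_linear (motive := P) f zero add fun D x => smul_ofDiagram x D ▸ smul x D

theorem ofDiagram_comp (D : Diagram a b) (E : Diagram b c) :
    ofDiagram d D ≫ ofDiagram d E = d ^ D.loops E • ofDiagram d (D.comp E) := by
  rw [smul_ofDiagram]
  exact (compLin_single a b c D E 1 1).trans (by rw [one_mul, one_mul])

theorem ofDiagram_id : ofDiagram d (Diagram.id a) = 𝟙 (pow d a) := rfl

/-- The embedding `f ↦ f ⊗ 1_X` of `Hom(X^{⊗ a}, X^{⊗ b})` into `Hom(X^{⊗ (a+1)}, X^{⊗ (b+1)})`. -/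
noncomputable def strand (f : pow d a ⟶ pow d b) : pow d (a + 1) ⟶ pow d (b + 1) :=
  tensorHom f (𝟙 (pow d 1))

theorem tensorHom_add (f g : pow d a ⟶ pow d b) {a' b' : ℕ} (h : pow d a' ⟶ pow d b') :
    tensorHom (f + g) h = tensorHom f h + tensorHom g h :=
  LinearMap.map_add₂ (tensorLin a b a' b') f g h

theorem tensorHom_smul (x : ℂ) (f : pow d a ⟶ pow d b) {a' b' : ℕ} (h : pow d a' ⟶ pow d b') :
    tensorHom (x • f) h = x • tensorHom f h :=
  LinearMap.map_smul₂ (tensorLin a b a' b') x f h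

theorem tensorHom_ofDiagram {a' b' : ℕ} (D : Diagram a b) (D' : Diagram a' b') :
    tensorHom (ofDiagram d D) (ofDiagram d D') = ofDiagram d (D.tensor D') :=
  (tensorLin_single a b a' b' D D' 1 1).trans (by rw [one_mul]; rfl)

theorem strand_add (f g : pow d a ⟶ pow d b) : strand (f + g) = strand f + strand g :=
  tensorHom_add f g _

theorem strand_smul (x : ℂ) (f : pow d a ⟶ pow d b) : strand (x • f) = x • strand f :=
  tensorHom_smul x f _

theorem strand_zero : strand (0 : pow d a ⟶ pow d b) = 0 := by
  simpa using strand_smul 0 (0 : pow d a ⟶ pow d b)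

theorem strand_sub (f g : pow d a ⟶ pow d b) : strand (f - g) = strand f - strand g := by
  rw [eq_sub_iff_add_eq, ← strand_add, sub_add_cancel]

theorem strand_id : strand (𝟙 (pow d a)) = 𝟙 (pow d (a + 1)) := tensorHom_id (pow d a) (pow d 1)

theorem strand_comp (f : pow d a ⟶ pow d b) (g : pow d b ⟶ pow d c) :
    strand (f ≫ g) = strand f ≫ strand g := by
  have h := tensorHom_comp f g (𝟙 (pow d 1)) (𝟙 (pow d 1))
  rwa [Category.id_comp] at h

theorem strand_ofDiagram (D : Diagram a b) :
    strand (ofDiagram d D) = ofDiagram d (D.tensor (Diagram.id 1)) :=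
  tensorHom_ofDiagram D (Diagram.id 1)

theorem strand_strand (f : pow d a ⟶ pow d b) :
    strand (strand f) = (tensorHom f (𝟙 (pow d 2)) : pow d (a + 2) ⟶ pow d (b + 2)) := by
  induction f using hom_induction with
  | zero => exact (congrArg strand strand_zero).trans (strand_zero.trans
      (LinearMap.map_zero₂ (tensorLin a b 2 2) (𝟙 (pow d 2))).symm)
  | add f g hf hg => rw [strand_add, strand_add, hf, hg, tensorHom_add]
  | smul x D =>
    rw [strand_smul, strand_smul, strand_ofDiagram, strand_ofDiagram, tensorHom_smul,
      Diagram.tensor_assoc_id, Diagram.tensor_id]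
    exact congrArg (x • ·) (tensorHom_ofDiagram D (Diagram.id 2)).symm

theorem tensorHom_id_zero (f : pow d a ⟶ pow d b) :
    (tensorHom f (𝟙 (pow d 0)) : pow d a ⟶ pow d b) = f := by
  induction f using hom_induction with
  | zero => exact LinearMap.map_zero₂ (tensorLin a b 0 0) (𝟙 (pow d 0))
  | add f g hf hg =>
    refine (tensorHom_add f g _).trans ?_
    exact congrArg₂ (· + ·) hf hg
  | smul x D =>
    refine (tensorHom_smul x _ _).trans (congrArg (x • ·) ?_)
    exact (tensorHom_ofDiagram D (Diagram.id 0)).trans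
      (congrArg (ofDiagram d) (Diagram.tensor_zero D _))

/-! ### The arcs at the last two points and their relations. -/

/-- The arc joining the last two lower points. -/
noncomputable def capLast (d : ℂ) (k : ℕ) : pow d (k + 2) ⟶ pow d k :=
  ofDiagram d ((Diagram.id k).tensor Diagram.cap)

/-- The arc joining the last two upper points. -/
noncomputable def cupLast (d : ℂ) (k : ℕ) : pow d k ⟶ pow d (k + 2) :=
  ofDiagram d ((Diagram.id k).tensor Diagram.cup)

theorem capLast_eq : capLast d k = tensorHom (𝟙 (pow d k)) (ofDiagram d Diagram.cap) :=
  (tensorHom_ofDiagram (Diagram.id k) Diagram.cap).symm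

theorem cupLast_eq : cupLast d k = tensorHom (𝟙 (pow d k)) (ofDiagram d Diagram.cup) :=
  (tensorHom_ofDiagram (Diagram.id k) Diagram.cup).symm

theorem elementary_eq : elementary d k = capLast d k ≫ cupLast d k := by
  have h := tensorHom_comp (𝟙 (pow d k)) (𝟙 (pow d k)) (ofDiagram d Diagram.cap)
    (ofDiagram d Diagram.cup)
  rw [Category.id_comp] at h
  rw [capLast_eq, cupLast_eq]
  exact h

/-- By the interchange law both sides are the tensor product of f with the arc. -/
theorem strand_strand_capLast (f : pow d a ⟶ pow d b) :
    strand (strand f) ≫ capLast d b = capLast d a ≫ f := by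
  have h1 := tensorHom_comp f (𝟙 (pow d b)) (𝟙 (pow d 2)) (ofDiagram d Diagram.cap)
  have h2 := tensorHom_comp (𝟙 (pow d a)) f (ofDiagram d Diagram.cap) (𝟙 (pow d 0))
  rw [Category.id_comp, Category.comp_id] at h1 h2
  rw [strand_strand, capLast_eq, capLast_eq]
  refine h1.symm.trans (h2.trans ?_)
  exact congrArg (tensorHom (𝟙 (pow d a)) (ofDiagram d Diagram.cap) ≫ ·) (tensorHom_id_zero f)

theorem cupLast_strand_strand (f : pow d a ⟶ pow d b) :
    cupLast d a ≫ strand (strand f) = f ≫ cupLast d b := by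
  have h1 := tensorHom_comp (𝟙 (pow d a)) f (ofDiagram d Diagram.cup) (𝟙 (pow d 2))
  have h2 := tensorHom_comp f (𝟙 (pow d b)) (𝟙 (pow d 0)) (ofDiagram d Diagram.cup)
  rw [Category.id_comp, Category.comp_id] at h1 h2
  rw [strand_strand, cupLast_eq, cupLast_eq]
  refine h1.symm.trans (h2.trans ?_)
  exact congrArg (· ≫ tensorHom (𝟙 (pow d b)) (ofDiagram d Diagram.cup)) (tensorHom_id_zero f)

theorem cupLast_capLast : cupLast d k ≫ capLast d k = d • 𝟙 (pow d k) := by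
  rw [cupLast, capLast, ofDiagram_comp, Diagram.tensor_loops, Diagram.loops_id_left,
    Diagram.cup_loops_cap, zero_add, pow_one, Diagram.tensor_comp, Diagram.tensor_zero,
    Diagram.id_comp, ofDiagram_id]

/-- After regrouping, the picture consists of k vertical strings beside the zigzag of
`Diagram.zigzag_left`. That zigzag closes no loop, and it is vertical because there is only one
diagram with one point on each edge. -/
theorem cupLast_strand_capLast :
    cupLast d (k + 1) ≫ strand (capLast d k) = 𝟙 (pow d (k + 1)) := by
  have h1 : (Diagram.id (k + 1)).tensor Diagram.cup =
      (Diagram.id k).tensor ((Diagram.id 1).tensor Diagram.cup) := by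
    rw [← Diagram.tensor_id]
    exact Diagram.tensor_assoc_cup _ _ _
  have h2 := Diagram.tensor_assoc_id (Diagram.id k) Diagram.cap (Diagram.id 1)
  have h : cupLast d (k + 1) ≫ strand (capLast d k) =
      ofDiagram d ((Diagram.id k).tensor ((Diagram.id 1).tensor Diagram.cup)) ≫
        ofDiagram d ((Diagram.id k).tensor (Diagram.cap.tensor (Diagram.id 1))) :=
    congrArg₂ (· ≫ ·) (congrArg (ofDiagram d) h1)
      ((strand_ofDiagram _).trans (congrArg (ofDiagram d) h2))
  have h3 : ((Diagram.id k).tensor ((Diagram.id 1).tensor Diagram.cup)).comp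
      ((Diagram.id k).tensor (Diagram.cap.tensor (Diagram.id 1))) = Diagram.id (k + 1) :=
    (Diagram.tensor_comp _ _ _ _).trans
      ((congrArg₂ Diagram.tensor (Diagram.id_comp _) (Diagram.eq_id_one _)).trans
        Diagram.tensor_id)
  have h4 : ((Diagram.id k).tensor ((Diagram.id 1).tensor Diagram.cup)).loops
      ((Diagram.id k).tensor (Diagram.cap.tensor (Diagram.id 1))) = 0 := by
    rw [Diagram.tensor_loops, Diagram.loops_id_left, Diagram.zigzag_left]
  rw [h, ofDiagram_comp, h4, pow_zero, one_smul]
  exact congrArg (ofDiagram d) h3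

theorem strand_cupLast_capLast :
    strand (cupLast d k) ≫ capLast d (k + 1) = 𝟙 (pow d (k + 1)) := by
  have h1 : (Diagram.id (k + 1)).tensor Diagram.cap =
      (Diagram.id k).tensor ((Diagram.id 1).tensor Diagram.cap) := by
    rw [← Diagram.tensor_id]
    exact Diagram.tensor_assoc_cap _ _ _
  have h2 := Diagram.tensor_assoc_id (Diagram.id k) Diagram.cup (Diagram.id 1)
  have h : strand (cupLast d k) ≫ capLast d (k + 1) =
      ofDiagram d ((Diagram.id k).tensor (Diagram.cup.tensor (Diagram.id 1))) ≫
        ofDiagram d ((Diagram.id k).tensor ((Diagram.id 1).tensor Diagram.cap)) :=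
    congrArg₂ (· ≫ ·) ((strand_ofDiagram _).trans (congrArg (ofDiagram d) h2))
      (congrArg (ofDiagram d) h1)
  have h3 : ((Diagram.id k).tensor (Diagram.cup.tensor (Diagram.id 1))).comp
      ((Diagram.id k).tensor ((Diagram.id 1).tensor Diagram.cap)) = Diagram.id (k + 1) :=
    (Diagram.tensor_comp _ _ _ _).trans
      ((congrArg₂ Diagram.tensor (Diagram.id_comp _) (Diagram.eq_id_one _)).trans
        Diagram.tensor_id)
  have h4 : ((Diagram.id k).tensor (Diagram.cup.tensor (Diagram.id 1))).loops
      ((Diagram.id k).tensor ((Diagram.id 1).tensor Diagram.cap)) = 0 := by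
    rw [Diagram.tensor_loops, Diagram.loops_id_left, Diagram.zigzag_right]
  rw [h, ofDiagram_comp, h4, pow_zero, one_smul]
  exact congrArg (ofDiagram d) h3

/-! ### The Markov trace -/

theorem markovTrace_ofDiagram (D : Diagram k k) :
    markovTrace d k (ofDiagram d D) = d ^ D.closureLoops :=
  (Finsupp.linearCombination_single ℂ (1 : ℂ) D).trans (one_smul _ _)

/-- On diagrams both sides are d to the power `Diagram.circularLoops`, which is symmetric. -/
theorem markovTrace_comm (f : pow d a ⟶ pow d b) (g : pow d b ⟶ pow d a) :
    markovTrace d a (f ≫ g) = markovTrace d b (g ≫ f) := by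
  induction f using hom_induction with
  | zero => simp
  | add f f' h h' => rw [Preadditive.add_comp, Preadditive.comp_add, map_add, map_add, h, h']
  | smul x D =>
    induction g using hom_induction with
    | zero => simp
    | add f f' h h' => rw [Preadditive.add_comp, Preadditive.comp_add, map_add, map_add, h, h']
    | smul y E =>
      simp only [Linear.smul_comp, Linear.comp_smul, ofDiagram_comp, map_smul,
        markovTrace_ofDiagram, smul_eq_mul, ← pow_add, Diagram.loops_add_closureLoops]
      rw [Diagram.circularLoops_comm]
      ring

/-- The Markov property of the trace. On diagrams it is `Diagram.circularLoops_strand`. -/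
theorem markovTrace_strand_comp (f : pow d (k + 1) ⟶ pow d (k + 1)) :
    markovTrace d (k + 2) (strand f ≫ capLast d k ≫ cupLast d k) = markovTrace d (k + 1) f := by
  induction f using hom_induction with
  | zero => rw [strand_zero, Limits.zero_comp, map_zero, map_zero]
  | add f g hf hg => rw [strand_add, Preadditive.add_comp, map_add, map_add, hf, hg]
  | smul x D =>
    have h : capLast d k ≫ cupLast d k =
        ofDiagram d ((Diagram.id k).tensor (Diagram.cap.comp Diagram.cup)) := by
      have h0 : Diagram.cap.loops Diagram.cup = 0 := Diagram.loops_eq_zero fun i => i.elim0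
      rw [capLast, cupLast, ofDiagram_comp, Diagram.tensor_loops, Diagram.tensor_comp, h0,
        Diagram.loops_id_left, Diagram.id_comp, add_zero, pow_zero, one_smul]
    rw [strand_smul, Linear.smul_comp, map_smul, map_smul, h, strand_ofDiagram, ofDiagram_comp,
      map_smul, markovTrace_ofDiagram, markovTrace_ofDiagram, smul_eq_mul (d ^ _), ← pow_add,
      Diagram.loops_add_closureLoops, Diagram.circularLoops_strand]

/-- Closing the last string. -/
noncomputable def partialTrace (f : pow d (k + 1) ⟶ pow d (k + 1)) : pow d k ⟶ pow d k :=
  cupLast d k ≫ strand f ≫ capLast d k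

/-- Cyclicity moves the cup behind the cap, which gives the configuration of the Markov property. -/
theorem markovTrace_partialTrace (f : pow d (k + 1) ⟶ pow d (k + 1)) :
    markovTrace d k (partialTrace f) = markovTrace d (k + 1) f := by
  rw [partialTrace, markovTrace_comm, Category.assoc, markovTrace_strand_comp]

/-! ### Arcs and through strings -/

/-- The morphism given by `Diagram.capAt`. -/
noncomputable def capAt (d : ℂ) (j m : ℕ) : pow d (j + 2 + m) ⟶ pow d (j + m) :=
  ofDiagram d (Diagram.capAt j m)

/-- The morphism given by `Diagram.cupAt`. -/
noncomputable def cupAt (d : ℂ) (j m : ℕ) : pow d (j + m) ⟶ pow d (j + 2 + m) :=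
  ofDiagram d (Diagram.cupAt j m)

/-- Arcs further to the left arise by adding strings on the right, as the Jones-Wenzl idempotents
do; this lets annihilation by arcs be proved by induction on `m`. -/
theorem capAt_succ (j m : ℕ) : capAt d j (m + 1) = strand (capAt d j m) :=
  (strand_ofDiagram _).symm

theorem cupAt_succ (j m : ℕ) : cupAt d j (m + 1) = strand (cupAt d j m) :=
  (strand_ofDiagram _).symm

/-- The diagram begins with the arc, by `Diagram.exists_capAt_comp`, so whatever is killed by the
arc is killed by the diagram. The family `g` over all sizes makes it possible to rewrite the size as
`j + 2 + m`. -/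
theorem comp_eq_zero_of_lower {g : ∀ k, pow d k ⟶ pow d k}
    (hg : ∀ j m, j + 2 + m = a → g (j + 2 + m) ≫ capAt d j m = 0)
    (D : Diagram a b) {p q : Fin a} (hpq : (q : ℕ) = p + 1) (h : D.rel (Sum.inl p) (Sum.inl q)) :
    g a ≫ ofDiagram d D = 0 := by
  obtain ⟨m, hm⟩ : ∃ m, a = p + 2 + m := ⟨a - (p + 2), by omega⟩
  generalize hj : (p : ℕ) = j at hm hpq
  subst hm
  obtain ⟨E, hE, hl⟩ := Diagram.exists_capAt_comp D hj hpq h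
  have hD : ofDiagram d D = capAt d j m ≫ ofDiagram d E := by
    rw [capAt, ofDiagram_comp, hl, hE, pow_zero, one_smul]
  rw [hD, ← Category.assoc, hg j m rfl, Limits.zero_comp]

theorem comp_eq_zero_of_upper {g : ∀ k, pow d k ⟶ pow d k}
    (hg : ∀ j m, j + 2 + m = b → cupAt d j m ≫ g (j + 2 + m) = 0)
    (D : Diagram a b) {p q : Fin b} (hpq : (q : ℕ) = p + 1) (h : D.rel (Sum.inr p) (Sum.inr q)) :
    ofDiagram d D ≫ g b = 0 := by
  obtain ⟨m, hm⟩ : ∃ m, b = p + 2 + m := ⟨b - (p + 2), by omega⟩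
  generalize hj : (p : ℕ) = j at hm hpq
  subst hm
  obtain ⟨E, hE, hl⟩ := Diagram.exists_comp_cupAt D hj hpq h
  have hD : ofDiagram d D = ofDiagram d E ≫ cupAt d j m := by
    rw [cupAt, ofDiagram_comp, hl, hE, pow_zero, one_smul]
  rw [hD, Category.assoc, hg j m rfl, Limits.comp_zero]

/-! ### The ideal of endomorphisms factoring through fewer strings. -/

/-- The endomorphisms factoring through fewer strings. -/
noncomputable def lowerIdeal (d : ℂ) (k : ℕ) : Submodule ℂ (pow d k ⟶ pow d k) :=
  Submodule.span ℂ {f | ∃ j < k, ∃ (u : pow d k ⟶ pow d j) (v : pow d j ⟶ pow d k), f = u ≫ v}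

theorem comp_mem_lowerIdeal {j : ℕ} (hj : j < k) (u : pow d k ⟶ pow d j) (v : pow d j ⟶ pow d k) :
    u ≫ v ∈ lowerIdeal d k := Submodule.subset_span ⟨j, hj, u, v, rfl⟩

theorem strand_mem_lowerIdeal {f : pow d k ⟶ pow d k} (hf : f ∈ lowerIdeal d k) :
    strand f ∈ lowerIdeal d (k + 1) := by
  induction hf using Submodule.span_induction with
  | mem f hf =>
    obtain ⟨j, hj, u, v, rfl⟩ := hf
    rw [strand_comp]
    exact comp_mem_lowerIdeal (Nat.succ_lt_succ hj) _ _
  | zero => rw [strand_zero]; exact zero_mem _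
  | add f g _ _ hf hg => rw [strand_add]; exact add_mem hf hg
  | smul x f _ hf => rw [strand_smul]; exact Submodule.smul_mem _ _ hf

/-- The coefficient of the identity diagram is a linear form that vanishes on everything factoring
through fewer strings, by `Diagram.comp_ne_id`, but not on the identity. -/
theorem id_notMem_lowerIdeal : 𝟙 (pow d k) ∉ lowerIdeal d k := by
  intro h
  let χ : (pow d k ⟶ pow d k) →ₗ[ℂ] ℂ := Finsupp.lapply (Diagram.id k)
  have hχ : lowerIdeal d k ≤ LinearMap.ker χ := by
    refine Submodule.span_le.2 ?_
    rintro _ ⟨j, hj, u, v, rfl⟩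
    change χ (u ≫ v) = 0
    induction u using hom_induction with
    | zero => rw [Limits.zero_comp, map_zero]
    | add f g hf hg => rw [Preadditive.add_comp, map_add, hf, hg, add_zero]
    | smul x D =>
      induction v using hom_induction with
      | zero => rw [Limits.comp_zero, map_zero]
      | add f g hf hg => rw [Preadditive.comp_add, map_add, hf, hg, add_zero]
      | smul y E =>
        have h0 : χ (ofDiagram d (D.comp E)) = 0 :=
          Finsupp.single_eq_of_ne (Diagram.comp_ne_id D E hj).symm
        rw [Linear.smul_comp, Linear.comp_smul, ofDiagram_comp, map_smul, map_smul, map_smul, h0,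
          smul_zero, smul_zero, smul_zero]
  have h1 : χ (𝟙 (pow d k)) = 1 := Finsupp.single_eq_same
  rw [LinearMap.mem_ker.1 (hχ h)] at h1
  exact zero_ne_one h1

instance (a b : ℕ) : Finite (Diagram a b) :=
  Finite.of_injective (fun D : Diagram a b => (D.rel : _ → _ → Prop)) fun _ _ h =>
    Diagram.ext (Setoid.ext fun x y => iff_of_eq (congrFun (congrFun h x) y))

instance (X Y : TL d) : Module.Finite ℂ (X ⟶ Y) :=
  inferInstanceAs (Module.Finite ℂ (Diagram X.size Y.size →₀ ℂ))

end Morphisms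

/-! ### Quantum integers -/

theorem quantumInt_zero (q : ℂ) : quantumInt q 0 = 0 := by simp [quantumInt]

theorem quantumInt_one (q : ℂ) : quantumInt q 1 = 1 := by simp [quantumInt]

theorem quantumInt_succ {q : ℂ} (hq : q ≠ 0) (k : ℕ) :
    quantumInt q (k + 1) = q * quantumInt q k + (q ^ k)⁻¹ := by
  rw [quantumInt, Finset.sum_range_succ, quantumInt, Finset.mul_sum]
  congr 1
  · refine Finset.sum_congr rfl fun i _ => ?_
    rw [← zpow_one_add₀ hq]
    congr 1
    push_cast
    ring
  · rw [← zpow_natCast, ← zpow_neg]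
    congr 1
    push_cast
    ring

/-- Using the one-step recursion at k + 1 and at k avoids dividing by q - q⁻¹, so that q = ±1 is
included. -/
theorem quantumInt_add_two {q : ℂ} (hq : q ≠ 0) (k : ℕ) :
    quantumInt q (k + 2) = (q + q⁻¹) * quantumInt q (k + 1) - quantumInt q k := by
  have h : q⁻¹ * quantumInt q (k + 1) = quantumInt q k + (q ^ (k + 1))⁻¹ := by
    rw [quantumInt_succ hq k, mul_add, inv_mul_cancel_left₀ hq, ← mul_inv, ← pow_succ']
  rw [quantumInt_succ hq (k + 1), add_mul, h]
  ring

section JonesWenzl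

variable {d q : ℂ} {n k : ℕ}

/-! ### Jones-Wenzl idempotents -/

/-- The Jones-Wenzl idempotents. -/
noncomputable def jonesWenzl (d q : ℂ) : ∀ k : ℕ, pow d k ⟶ pow d k
  | 0 => 𝟙 _
  | 1 => 𝟙 _
  | k + 2 => strand (jonesWenzl d q (k + 1)) - (quantumInt q (k + 1) / quantumInt q (k + 2)) •
      (strand (jonesWenzl d q (k + 1)) ≫ elementary d k ≫ strand (jonesWenzl d q (k + 1)))

theorem jonesWenzl_add_two : jonesWenzl d q (k + 2) = strand (jonesWenzl d q (k + 1)) -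
    (quantumInt q (k + 1) / quantumInt q (k + 2)) • (strand (jonesWenzl d q (k + 1)) ≫
      capLast d k ≫ cupLast d k ≫ strand (jonesWenzl d q (k + 1))) := by
  rw [jonesWenzl, elementary_eq, Category.assoc]

/-- Splitting the part factoring through `A` off an idempotent `F`. -/
theorem idempotent_splitting {C : Type*} [Category C] [Preadditive C] [Linear ℂ C] {A B : C}
    {F G P : B ⟶ B} {g : A ⟶ A} {u : B ⟶ A} {v : A ⟶ B} {c t : ℂ} (hF : F ≫ F = F)
    (hFG : F ≫ G = F) (hGF : G ≫ F = F) (hu : G ≫ u = u ≫ g) (hv : v ≫ G = g ≫ v)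
    (ht : v ≫ F ≫ u = t • g) (hct : c * t = 1) (hP : P = F - c • (F ≫ u ≫ v ≫ F)) :
    F ≫ u ≫ g = F ≫ u ∧ g ≫ v ≫ F = v ≫ F ∧ F ≫ P = P ∧ P ≫ F = P ∧ P ≫ P = P ∧
      P ≫ u = 0 ∧ v ≫ P = 0 := by
  -- `G` is the counterpart of `g` on the side of `B`: pulled back through `u`, the factor `g`
  -- becomes `G` and is absorbed by `F`.
  have h1 : F ≫ u ≫ g = F ≫ u := by rw [← hu, ← Category.assoc, hFG]
  have h2 : g ≫ v ≫ F = v ≫ F := by rw [← Category.assoc, ← hv, Category.assoc, hGF]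
  have h3 : F ≫ P = P := by
    rw [hP, Preadditive.comp_sub, Linear.comp_smul, ← Category.assoc F F, hF]
  have h4 : P ≫ F = P := by
    rw [hP, Preadditive.sub_comp, Linear.smul_comp]
    simp only [Category.assoc, hF]
  -- In the subtracted term `ht` produces t g, the factor g is dropped by `h1`, and c t = 1 makes
  -- the two terms cancel.
  have h5 : P ≫ u = 0 := by
    rw [hP, Preadditive.sub_comp, Linear.smul_comp]
    simp only [Category.assoc, ht, Linear.comp_smul, smul_smul, hct, one_smul, h1, sub_self]
  have h6 : v ≫ P = 0 := by
    rw [hP, Preadditive.comp_sub, Linear.comp_smul]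
    have h : v ≫ F ≫ u ≫ v ≫ F = t • (v ≫ F) := by
      rw [← Category.assoc F u, ← Category.assoc v, ht, Linear.smul_comp, h2]
    rw [h, smul_smul, hct, one_smul, sub_self]
  refine ⟨h1, h2, h3, h4, ?_, h5, h6⟩
  have h : (F - c • (F ≫ u ≫ v ≫ F)) ≫ P = P := by
    rw [Preadditive.sub_comp, Linear.smul_comp, h3]
    simp only [Category.assoc, h3, h6, Limits.comp_zero, smul_zero, sub_zero]
  rwa [← hP] at h

theorem partialTrace_id : partialTrace (𝟙 (pow d (k + 1))) = d • 𝟙 (pow d k) := by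
  rw [partialTrace, strand_id, Category.id_comp, cupLast_capLast]

theorem partialTrace_strand (f : pow d (k + 1) ⟶ pow d (k + 1)) :
    partialTrace (strand f) = d • f := by
  rw [partialTrace, strand_strand_capLast, ← Category.assoc, cupLast_capLast, Linear.smul_comp,
    Category.id_comp]

/-- The closing arcs form zigzags with the two inner arcs. Straightening both leaves the two copies
of f on top of each other. -/
theorem partialTrace_strand_arc_strand (f : pow d (k + 1) ⟶ pow d (k + 1)) :
    partialTrace (strand f ≫ capLast d k ≫ cupLast d k ≫ strand f) = f ≫ f := by
  rw [partialTrace]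
  simp only [strand_comp, Category.assoc, strand_strand_capLast]
  rw [← Category.assoc (cupLast d (k + 1)), cupLast_strand_strand, Category.assoc,
    ← Category.assoc (cupLast d (k + 1)), cupLast_strand_capLast, Category.id_comp,
    ← Category.assoc (strand (cupLast d k)), strand_cupLast_capLast, Category.id_comp]

theorem partialTrace_sub_smul (f g : pow d (k + 1) ⟶ pow d (k + 1)) (x : ℂ) :
    partialTrace (f - x • g) = partialTrace f - x • partialTrace g := by
  simp only [partialTrace, strand_sub, strand_smul, Preadditive.sub_comp, Preadditive.comp_sub,
    Linear.smul_comp, Linear.comp_smul]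

/-- One simultaneous induction, because the partial trace at level k + 1 is the hypothesis `ht` of
`idempotent_splitting` at level k + 2. Only [k+1] stands in the denominator of the partial trace, so
that formula reaches level n even when [n+1] = 0. -/
theorem jonesWenzl_aux (hq : q ≠ 0) (hd : d = q + q⁻¹)
    (hn : ∀ k : ℕ, 1 ≤ k → k ≤ n → quantumInt q k ≠ 0) (k : ℕ) (hk : k + 1 ≤ n) :
    strand (jonesWenzl d q k) ≫ jonesWenzl d q (k + 1) = jonesWenzl d q (k + 1) ∧
    jonesWenzl d q (k + 1) ≫ strand (jonesWenzl d q k) = jonesWenzl d q (k + 1) ∧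
    jonesWenzl d q (k + 1) ≫ jonesWenzl d q (k + 1) = jonesWenzl d q (k + 1) ∧
    partialTrace (jonesWenzl d q (k + 1)) =
      (quantumInt q (k + 2) / quantumInt q (k + 1)) • jonesWenzl d q k := by
  induction k with
  | zero =>
    refine ⟨?_, ?_, Category.id_comp _, ?_⟩
    · exact (congrArg (· ≫ 𝟙 (pow d 1)) strand_id).trans (Category.id_comp _)
    · exact (congrArg (𝟙 (pow d 1) ≫ ·) strand_id).trans (Category.id_comp _)
    -- Closing a single string gives d, which is [2]/[1].
    · refine partialTrace_id.trans ?_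
      rw [quantumInt_add_two hq, quantumInt_one, quantumInt_zero, hd, mul_one, sub_zero, div_one]
      rfl
  | succ k ih =>
    obtain ⟨h1, h2, h3, h4⟩ := ih (by omega)
    have hk1 := hn (k + 1) (by omega) (by omega)
    have hk2 := hn (k + 2) (by omega) (by omega)
    obtain ⟨-, -, h5, h6, h7, -, -⟩ := idempotent_splitting
      (F := strand (jonesWenzl d q (k + 1))) (G := strand (strand (jonesWenzl d q k)))
      (by rw [← strand_comp, h3]) (by rw [← strand_comp, h2]) (by rw [← strand_comp, h1])
      (strand_strand_capLast _) (cupLast_strand_strand _) h4 (div_mul_div_cancel₀' hk1 _ _ |>.trans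
        (div_self hk2)) jonesWenzl_add_two
    refine ⟨h5, h6, h7, ?_⟩
    -- The three-term recursion divided by [k+2]: the two terms of the partial trace add up to the
    -- next ratio.
    have hc : d - quantumInt q (k + 1) / quantumInt q (k + 2) =
        quantumInt q (k + 3) / quantumInt q (k + 2) := by
      rw [quantumInt_add_two hq (k + 1), ← hd]
      field_simp
    rw [jonesWenzl_add_two, partialTrace_sub_smul, partialTrace_strand,
      partialTrace_strand_arc_strand, h3, ← sub_smul, hc]

theorem jonesWenzl_idem (hq : q ≠ 0) (hd : d = q + q⁻¹)
    (hn : ∀ k : ℕ, 1 ≤ k → k ≤ n → quantumInt q k ≠ 0) (k : ℕ) (hk : k ≤ n) :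
    jonesWenzl d q k ≫ jonesWenzl d q k = jonesWenzl d q k := by
  cases k with
  | zero => exact Category.id_comp _
  | succ k => exact (jonesWenzl_aux hq hd hn k hk).2.2.1

/-- Partial traces remove one string at a time and the ratios telescope. The start value is 1 = [1],
as the empty diagram has no loops. -/
theorem markovTrace_jonesWenzl (hq : q ≠ 0) (hd : d = q + q⁻¹)
    (hn : ∀ k : ℕ, 1 ≤ k → k ≤ n → quantumInt q k ≠ 0) (k : ℕ) (hk : k ≤ n) :
    markovTrace d k (jonesWenzl d q k) = quantumInt q (k + 1) := by
  induction k with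
  | zero =>
    refine (markovTrace_ofDiagram (Diagram.id 0)).trans ?_
    rw [Diagram.closureLoops, quantumInt_one, Nat.card_eq_zero.2, pow_zero]
    refine Or.inl ⟨fun c => ?_⟩
    induction c using Quotient.inductionOn with
    | h x => rcases x with x | x <;> exact x.elim0
  | succ k ih =>
    rw [← markovTrace_partialTrace, (jonesWenzl_aux hq hd hn k hk).2.2.2, map_smul, ih (by omega),
      smul_eq_mul, div_mul_cancel₀ _ (hn (k + 1) (by omega) hk)]

theorem jonesWenzl_splitting (hq : q ≠ 0) (hd : d = q + q⁻¹)
    (hn : ∀ k : ℕ, 1 ≤ k → k ≤ n → quantumInt q k ≠ 0) (k : ℕ) (hk : k + 2 ≤ n) :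
    strand (jonesWenzl d q (k + 1)) ≫ capLast d k ≫ jonesWenzl d q k =
      strand (jonesWenzl d q (k + 1)) ≫ capLast d k ∧
    jonesWenzl d q k ≫ cupLast d k ≫ strand (jonesWenzl d q (k + 1)) =
      cupLast d k ≫ strand (jonesWenzl d q (k + 1)) ∧
    jonesWenzl d q (k + 2) ≫ capLast d k = 0 ∧ cupLast d k ≫ jonesWenzl d q (k + 2) = 0 := by
  obtain ⟨h1, h2, h3, h4⟩ := jonesWenzl_aux hq hd hn k (by omega)
  have hk1 := hn (k + 1) (by omega) (by omega)
  have hk2 := hn (k + 2) (by omega) (by omega)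
  obtain ⟨h5, h6, -, -, -, h7, h8⟩ := idempotent_splitting
    (F := strand (jonesWenzl d q (k + 1))) (G := strand (strand (jonesWenzl d q k)))
    (by rw [← strand_comp, h3]) (by rw [← strand_comp, h2]) (by rw [← strand_comp, h1])
    (strand_strand_capLast _) (cupLast_strand_strand _) h4 (div_mul_div_cancel₀' hk1 _ _ |>.trans
      (div_self hk2)) jonesWenzl_add_two
  exact ⟨h5, h6, h7, h8⟩

/-- The arc at the last two points is killed by construction. Any other arc comes from one string
fewer, and absorbing `strand` of the preceding idempotent reduces it to the induction hypothesis. -/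
theorem jonesWenzl_capAt (hq : q ≠ 0) (hd : d = q + q⁻¹)
    (hn : ∀ k : ℕ, 1 ≤ k → k ≤ n → quantumInt q k ≠ 0) (j m : ℕ) (h : j + 2 + m ≤ n) :
    jonesWenzl d q (j + 2 + m) ≫ capAt d j m = 0 := by
  induction m with
  | zero => exact (jonesWenzl_splitting hq hd hn j h).2.2.1
  | succ m ih =>
    have h1 := (jonesWenzl_aux hq hd hn (j + 2 + m) h).2.1
    have h2 := ih (by omega)
    change jonesWenzl d q (j + 2 + m + 1) ≫ capAt d j (m + 1) = 0
    rw [capAt_succ, ← h1, Category.assoc, ← strand_comp, h2, strand_zero, Limits.comp_zero]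

theorem cupAt_jonesWenzl (hq : q ≠ 0) (hd : d = q + q⁻¹)
    (hn : ∀ k : ℕ, 1 ≤ k → k ≤ n → quantumInt q k ≠ 0) (j m : ℕ) (h : j + 2 + m ≤ n) :
    cupAt d j m ≫ jonesWenzl d q (j + 2 + m) = 0 := by
  induction m with
  | zero => exact (jonesWenzl_splitting hq hd hn j h).2.2.2
  | succ m ih =>
    have h1 := (jonesWenzl_aux hq hd hn (j + 2 + m) h).1
    have h2 := ih (by omega)
    change cupAt d j (m + 1) ≫ jonesWenzl d q (j + 2 + m + 1) = 0
    rw [cupAt_succ, ← h1, ← Category.assoc, ← strand_comp, h2, strand_zero, Limits.zero_comp]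

/-- The term subtracted in the recursion factors through two strings fewer, whatever its
coefficient, and adding a string preserves the ideals. -/
theorem jonesWenzl_sub_id_mem (k : ℕ) : jonesWenzl d q k - 𝟙 (pow d k) ∈ lowerIdeal d k := by
  induction k with
  | zero => exact (sub_self (𝟙 (pow d 0))).symm ▸ zero_mem _
  | succ k ih =>
    cases k with
    | zero => exact (sub_self (𝟙 (pow d 1))).symm ▸ zero_mem _
    | succ k =>
      have h := strand_mem_lowerIdeal ih
      rw [strand_sub, strand_id] at h
      have h' := Submodule.smul_mem _ (quantumInt q (k + 1) / quantumInt q (k + 2))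
        (comp_mem_lowerIdeal (show k < k + 2 by omega)
          (strand (jonesWenzl d q (k + 1)) ≫ capLast d k)
          (cupLast d k ≫ strand (jonesWenzl d q (k + 1))))
      rw [Category.assoc] at h'
      have h'' := sub_mem h h'
      rw [sub_right_comm, ← jonesWenzl_add_two] at h''
      exact h''

/-- Argued modulo `lowerIdeal` because the Markov trace of f_k is [k+1], which may vanish for k = n.
-/
theorem jonesWenzl_ne_zero (k : ℕ) : jonesWenzl d q k ≠ 0 := by
  intro h
  have h' := jonesWenzl_sub_id_mem (d := d) (q := q) k
  rw [h, zero_sub] at h'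
  exact id_notMem_lowerIdeal (neg_mem_iff.1 h')

/-! ### Morphisms composed with Jones-Wenzl idempotents. -/

theorem comp_jonesWenzl_of_upper (hq : q ≠ 0) (hd : d = q + q⁻¹)
    (hn : ∀ k : ℕ, 1 ≤ k → k ≤ n → quantumInt q k ≠ 0) {a b : ℕ} (hb : b ≤ n) (D : Diagram a b)
    (hD : ∃ i j : Fin b, (j : ℕ) = i + 1 ∧ D.rel (Sum.inr i) (Sum.inr j)) :
    ofDiagram d D ≫ jonesWenzl d q b = 0 := by
  obtain ⟨i, j, hij, hr⟩ := hD
  exact comp_eq_zero_of_upper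
    (fun j m h => cupAt_jonesWenzl hq hd hn j m (h.trans_le hb)) D hij hr

/-- A diagram with more upper than lower points has an arc between neighbouring upper points, so no
diagram survives. -/
theorem comp_jonesWenzl_of_lt (hq : q ≠ 0) (hd : d = q + q⁻¹)
    (hn : ∀ k : ℕ, 1 ≤ k → k ≤ n → quantumInt q k ≠ 0) {a b : ℕ} (hab : a < b) (hb : b ≤ n)
    (g : pow d a ⟶ pow d b) : g ≫ jonesWenzl d q b = 0 := by
  induction g using hom_induction with
  | zero => rw [Limits.zero_comp]
  | add f g hf hg => rw [Preadditive.add_comp, hf, hg, add_zero]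
  | smul x D =>
    rw [Linear.smul_comp, comp_jonesWenzl_of_upper hq hd hn hb D (Diagram.exists_upper_of_lt hab),
      smul_zero]

/-- The identity is the only diagram that survives, so c is its coefficient in g. -/
theorem exists_comp_jonesWenzl_eq (hq : q ≠ 0) (hd : d = q + q⁻¹)
    (hn : ∀ k : ℕ, 1 ≤ k → k ≤ n → quantumInt q k ≠ 0) (hk : k ≤ n)
    (g : pow d k ⟶ pow d k) : ∃ c : ℂ, g ≫ jonesWenzl d q k = c • jonesWenzl d q k := by
  induction g using hom_induction with
  | zero => exact ⟨0, by rw [Limits.zero_comp, zero_smul]⟩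
  | add f g hf hg =>
    obtain ⟨c, hc⟩ := hf
    obtain ⟨c', hc'⟩ := hg
    exact ⟨c + c', by rw [Preadditive.add_comp, hc, hc', add_smul]⟩
  | smul x D =>
    by_cases hD : D = Diagram.id k
    · exact ⟨x, by rw [hD, ofDiagram_id, Linear.smul_comp, Category.id_comp]⟩
    · exact ⟨0, by rw [Linear.smul_comp, comp_jonesWenzl_of_upper hq hd hn hk D
        (Diagram.exists_upper_of_ne hD), smul_zero, zero_smul]⟩

theorem jonesWenzl_comp_of_lt (hq : q ≠ 0) (hd : d = q + q⁻¹)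
    (hn : ∀ k : ℕ, 1 ≤ k → k ≤ n → quantumInt q k ≠ 0) {a b : ℕ} (hab : b < a) (ha : a ≤ n)
    (g : pow d a ⟶ pow d b) : jonesWenzl d q a ≫ g = 0 := by
  induction g using hom_induction with
  | zero => rw [Limits.comp_zero]
  | add f g hf hg => rw [Preadditive.comp_add, hf, hg, add_zero]
  | smul x D =>
    obtain ⟨i, j, hij, hr⟩ := Diagram.exists_lower_of_lt (D := D) hab
    rw [Linear.comp_smul, comp_eq_zero_of_lower
      (fun j m h => jonesWenzl_capAt hq hd hn j m (h.trans_le ha)) D hij hr, smul_zero]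

/-! ### Identities factored through Jones-Wenzl idempotents. -/

/-- The span of the endomorphisms of `X^{⊗ k}` factoring through some `jonesWenzl d q j` with
`j ≤ k`. -/
noncomputable def jonesWenzlIdeal (d q : ℂ) (k : ℕ) : Submodule ℂ (pow d k ⟶ pow d k) :=
  Submodule.span ℂ {f | ∃ j ≤ k, ∃ (u : pow d k ⟶ pow d j) (v : pow d j ⟶ pow d k),
    f = u ≫ jonesWenzl d q j ≫ v}

theorem comp_mem_jonesWenzlIdeal {j : ℕ} (hj : j ≤ k) (u : pow d k ⟶ pow d j)
    (v : pow d j ⟶ pow d k) : u ≫ jonesWenzl d q j ≫ v ∈ jonesWenzlIdeal d q k :=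
  Submodule.subset_span ⟨j, hj, u, v, rfl⟩

/-- The recursion read backwards. The factor f_k can be inserted in the middle because the arc
followed by f_{k+1} ⊗ 1 absorbs it. -/
theorem strand_jonesWenzl (hq : q ≠ 0) (hd : d = q + q⁻¹)
    (hn : ∀ k : ℕ, 1 ≤ k → k ≤ n → quantumInt q k ≠ 0) (hk : k + 2 ≤ n) :
    strand (jonesWenzl d q (k + 1)) = jonesWenzl d q (k + 2) +
      (quantumInt q (k + 1) / quantumInt q (k + 2)) •
        ((strand (jonesWenzl d q (k + 1)) ≫ capLast d k) ≫ jonesWenzl d q k ≫ cupLast d k ≫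
          strand (jonesWenzl d q (k + 1))) := by
  rw [(jonesWenzl_splitting hq hd hn k hk).2.1, Category.assoc, jonesWenzl_add_two, sub_add_cancel]

/-- The spans are stable under adding a string: f_0 ⊗ 1 is f_1, and for j ≥ 1 the morphism f_j ⊗ 1
splits into a part through f_{j+1} and a part through f_{j-1}. -/
theorem id_mem_jonesWenzlIdeal (hq : q ≠ 0) (hd : d = q + q⁻¹)
    (hn : ∀ k : ℕ, 1 ≤ k → k ≤ n → quantumInt q k ≠ 0) (m : ℕ) (hm : m ≤ n) :
    𝟙 (pow d m) ∈ jonesWenzlIdeal d q m := by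
  induction m with
  | zero =>
    have h := comp_mem_jonesWenzlIdeal (q := q) le_rfl (𝟙 (pow d 0)) (𝟙 (pow d 0))
    rwa [Category.id_comp, Category.comp_id] at h
  | succ m ih =>
    have key : ∀ f ∈ jonesWenzlIdeal d q m, strand f ∈ jonesWenzlIdeal d q (m + 1) := by
      intro f hf
      induction hf using Submodule.span_induction with
      | zero => rw [strand_zero]; exact zero_mem _
      | add f g _ _ hf hg => rw [strand_add]; exact add_mem hf hg
      | smul x f _ hf => rw [strand_smul]; exact Submodule.smul_mem _ _ hf
      | mem f hf =>
        obtain ⟨j, hj, u, v, rfl⟩ := hf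
        rw [strand_comp, strand_comp]
        cases j with
        | zero =>
          have h : strand (jonesWenzl d q 0) = jonesWenzl d q 1 := strand_id
          rw [h]
          exact comp_mem_jonesWenzlIdeal (by omega) _ _
        | succ j =>
          rw [strand_jonesWenzl hq hd hn (by omega), Preadditive.add_comp, Preadditive.comp_add,
            Linear.smul_comp, Linear.comp_smul]
          refine add_mem (comp_mem_jonesWenzlIdeal (by omega) _ _) (Submodule.smul_mem _ _ ?_)
          have h := comp_mem_jonesWenzlIdeal (q := q) (show j ≤ m + 1 by omega)
            (strand u ≫ strand (jonesWenzl d q (j + 1)) ≫ capLast d j)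
            ((cupLast d j ≫ strand (jonesWenzl d q (j + 1))) ≫ strand v)
          simp only [Category.assoc] at h ⊢
          exact h
    have h := key _ (ih (by omega))
    rwa [strand_id] at h

end JonesWenzl

/-! ### Decompositions into orthogonal simple objects -/

section DirectSums

variable {C D : Type*} [Category C] [Category D] [Preadditive C] [Preadditive D]

theorem IsDirectSumVia.map (F : C ⥤ D) [F.Additive] {ι : Type} [Fintype ι] {X : C} {Y : ι → C}
    {α : ∀ i, Y i ⟶ X} {β : ∀ i, X ⟶ Y i} (h : IsDirectSumVia X Y α β) :
    IsDirectSumVia (F.obj X) (fun i => F.obj (Y i)) (fun i => F.map (α i))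
      (fun i => F.map (β i)) := by
  obtain ⟨h1, h2, h3⟩ := h
  refine ⟨fun i => ?_, fun i j hij => ?_, ?_⟩
  · rw [← F.map_comp, h1, F.map_id]
  · rw [← F.map_comp, h2 i j hij, F.map_zero]
  · simp only [← F.map_comp, ← F.map_sum, h3, F.map_id]

theorem IsDirectSum.map (F : C ⥤ D) [F.Additive] {ι : Type} [Fintype ι] {X : C} {Y : ι → C}
    (h : IsDirectSum X Y) : IsDirectSum (F.obj X) (fun i => F.obj (Y i)) := by
  obtain ⟨α, β, h⟩ := h
  exact ⟨_, _, h.map F⟩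

theorem IsDirectSum.reindex {ι κ : Type} [Fintype ι] [Fintype κ] {X : C} {Y : ι → C}
    (h : IsDirectSum X Y) (e : κ ≃ ι) : IsDirectSum X (fun k => Y (e k)) := by
  obtain ⟨α, β, h1, h2, h3⟩ := h
  refine ⟨fun k => α (e k), fun k => β (e k), fun k => h1 _,
    fun k l hkl => h2 _ _ (e.injective.ne hkl), ?_⟩
  rw [← h3]
  exact e.sum_comp fun i => β i ≫ α i

theorem IsDirectSum.sigma {ι : Type} [Fintype ι] {X : C} {Y : ι → C} (h : IsDirectSum X Y)
    {κ : ι → Type} [∀ i, Fintype (κ i)] {Z : ∀ i, κ i → C} (h' : ∀ i, IsDirectSum (Y i) (Z i)) :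
    IsDirectSum X (fun x : Σ i, κ i => Z x.1 x.2) := by
  obtain ⟨α, β, h1, h2, h3⟩ := h
  choose α' β' h1' h2' h3' using h'
  refine ⟨fun x => α' x.1 x.2 ≫ α x.1, fun x => β x.1 ≫ β' x.1 x.2, fun x => ?_, ?_, ?_⟩
  · rw [Category.assoc, ← Category.assoc (α x.1), h1, Category.id_comp, h1']
  · rintro ⟨i, x⟩ ⟨j, y⟩ hxy
    rw [Category.assoc, ← Category.assoc (α i)]
    by_cases hij : i = j
    · subst hij
      dsimp only
      rw [h1, Category.id_comp, h2' i x y (fun e => hxy (by rw [e]))]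
    · dsimp only
      rw [h2 i j hij, Limits.zero_comp, Limits.comp_zero]
  · rw [Fintype.sum_sigma, ← h3]
    refine Finset.sum_congr rfl fun i _ => ?_
    have h : ∑ y, (β i ≫ β' i y) ≫ α' i y ≫ α i = β i ≫ (∑ y, β' i y ≫ α' i y) ≫ α i := by
      simp only [Preadditive.sum_comp, Preadditive.comp_sum, Category.assoc]
    rw [h, h3', Category.id_comp]

theorem isDirectSum_of_iso {ι : Type} [Fintype ι] {X : C} {Y : ι → C} [Limits.HasBiproduct Y]
    (e : X ≅ ⨁ Y) : IsDirectSum X Y := by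
  classical
  refine ⟨fun i => Limits.biproduct.ι Y i ≫ e.inv, fun i => e.hom ≫ Limits.biproduct.π Y i,
    fun i => by simp, fun i j hij => by simp [Limits.biproduct.ι_π_ne _ hij], ?_⟩
  have h : ∀ i, (e.hom ≫ Limits.biproduct.π Y i) ≫ Limits.biproduct.ι Y i ≫ e.inv =
      e.hom ≫ (Limits.biproduct.π Y i ≫ Limits.biproduct.ι Y i) ≫ e.inv :=
    fun i => by simp only [Category.assoc]
  simp only [h]
  rw [← Preadditive.comp_sum, ← Preadditive.sum_comp, Limits.biproduct.total, Category.id_comp,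
    Iso.hom_inv_id]

theorem isDirectSum_mat (M : Mat_ C) : IsDirectSum M fun i => (Mat_.embedding C).obj (M.X i) :=
  isDirectSum_of_iso M.isoBiproductEmbedding

/-- A direct sum of copies of pairwise orthogonal objects with endomorphism rings covered by `ℂ`
has a semisimple endomorphism ring. -/
theorem isSemisimpleRing_end {κ : Type} [Fintype κ] (T : κ → C) (ρ : ∀ k, ℂ →+* End (T k))
    (hρ : ∀ k, Function.Surjective (ρ k)) (hT : ∀ k l, k ≠ l → ∀ g : T k ⟶ T l, g = 0)
    {A : κ → Type} [∀ k, Fintype (A k)] {P : C} (hP : IsDirectSum P fun x : Σ k, A k => T x.1) :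
    IsSemisimpleRing (End P) := by
  classical
  obtain ⟨α, β, h1, h2, h3⟩ := hP
  -- Matrix units: project to copy a of `T k`, multiply by the scalar z, include as copy b.
  let E : ∀ k, A k → A k → ℂ → (P ⟶ P) := fun k a b z => β ⟨k, a⟩ ≫ ρ k z ≫ α ⟨k, b⟩
  have hE0 : ∀ k a b, E k a b 0 = 0 := fun k a b => by
    change β ⟨k, a⟩ ≫ (ρ k 0 : T k ⟶ T k) ≫ α ⟨k, b⟩ = 0
    rw [map_zero]
    exact (congrArg _ Limits.zero_comp).trans Limits.comp_zero
  have hE1 : ∀ k a b, E k a b 1 = β ⟨k, a⟩ ≫ α ⟨k, b⟩ := fun k a b => by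
    change β ⟨k, a⟩ ≫ (ρ k 1 : T k ⟶ T k) ≫ α ⟨k, b⟩ = _
    rw [map_one]
    exact congrArg _ (Category.id_comp _)
  have hEadd : ∀ k a b z w, E k a b (z + w) = E k a b z + E k a b w := fun k a b z w => by
    change β ⟨k, a⟩ ≫ (ρ k (z + w) : T k ⟶ T k) ≫ α ⟨k, b⟩ = _
    rw [map_add]
    exact (congrArg _ (Preadditive.add_comp _ _ _ _ _ _)).trans (Preadditive.comp_add _ _ _ _ _ _)
  have hEmul : ∀ k a b c z w, E k a b z ≫ E k b c w = E k a c (w * z) := fun k a b c z w => by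
    have h : (ρ k (w * z) : T k ⟶ T k) = (ρ k z : T k ⟶ T k) ≫ (ρ k w : T k ⟶ T k) :=
      map_mul (ρ k) w z
    change (β ⟨k, a⟩ ≫ (ρ k z : T k ⟶ T k) ≫ α ⟨k, b⟩) ≫
      β ⟨k, b⟩ ≫ (ρ k w : T k ⟶ T k) ≫ α ⟨k, c⟩ =
        β ⟨k, a⟩ ≫ (ρ k (w * z) : T k ⟶ T k) ≫ α ⟨k, c⟩
    rw [h]
    simp only [Category.assoc]
    rw [← Category.assoc (α ⟨k, b⟩), h1, Category.id_comp]
  have hEzero : ∀ k l a b a' b' z w, (⟨k, b⟩ : Σ k, A k) ≠ ⟨l, a'⟩ →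
      E k a b z ≫ E l a' b' w = 0 := fun k l a b a' b' z w h => by
    simp only [E, Category.assoc]
    rw [← Category.assoc (α ⟨k, b⟩), h2 _ _ h, Limits.zero_comp, Limits.comp_zero,
      Limits.comp_zero]
  -- The source a is the column index, because multiplication in `End P` is composition in the
  -- reverse order.
  let φ : (∀ k, Matrix (A k) (A k) ℂ) → End P := fun M => ∑ k, ∑ a, ∑ b, E k a b (M k b a)
  have hφ1 : φ 1 = 1 := by
    change ∑ k, ∑ a, ∑ b, E k a b ((1 : Matrix (A k) (A k) ℂ) b a) = 𝟙 P
    rw [← h3, Fintype.sum_sigma]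
    refine Finset.sum_congr rfl fun k _ => Finset.sum_congr rfl fun a _ => ?_
    rw [Finset.sum_eq_single a, Matrix.one_apply_eq, hE1]
    · intro b _ hb
      rw [Matrix.one_apply_ne hb, hE0]
    · intro h
      exact absurd (Finset.mem_univ _) h
  have hφmul : ∀ M N, φ (M * N) = φ M * φ N := by
    intro M N
    change ∑ k, ∑ a, ∑ c, E k a c ((M k * N k) c a) =
      (∑ k, ∑ a, ∑ b, E k a b (N k b a)) ≫ (∑ k, ∑ a, ∑ b, E k a b (M k b a))
    rw [Preadditive.sum_comp]
    refine Finset.sum_congr rfl fun k _ => ?_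
    rw [Preadditive.sum_comp]
    refine Finset.sum_congr rfl fun a _ => ?_
    rw [Preadditive.sum_comp]
    have h : ∀ b, E k a b (N k b a) ≫ ∑ l, ∑ b', ∑ c, E l b' c (M l c b') =
        ∑ c, E k a c (M k c b * N k b a) := by
      intro b
      rw [Preadditive.comp_sum, Finset.sum_eq_single k, Preadditive.comp_sum,
        Finset.sum_eq_single b, Preadditive.comp_sum]
      · exact Finset.sum_congr rfl fun c _ => hEmul _ _ _ _ _ _
      · intro b' _ hb
        rw [Preadditive.comp_sum]
        exact Finset.sum_eq_zero fun c _ => hEzero _ _ _ _ _ _ _ _ fun e => hb (by cases e; rfl)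
      · intro h
        exact absurd (Finset.mem_univ _) h
      · intro l _ hl
        rw [Preadditive.comp_sum]
        refine Finset.sum_eq_zero fun b' _ => ?_
        rw [Preadditive.comp_sum]
        exact Finset.sum_eq_zero fun c _ => hEzero _ _ _ _ _ _ _ _ fun e => hl (by cases e; rfl)
      · intro h
        exact absurd (Finset.mem_univ _) h
    simp only [h]
    rw [Finset.sum_comm]
    refine Finset.sum_congr rfl fun c _ => ?_
    rw [Matrix.mul_apply]
    exact map_sum (AddMonoidHom.mk' (E k a c) (hEadd k a c)) _ _
  have hφ0 : φ 0 = 0 := by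
    change ∑ k, ∑ a, ∑ b, E k a b 0 = 0
    simp only [hE0, Finset.sum_const_zero]
  have hφadd : ∀ M N, φ (M + N) = φ M + φ N := by
    intro M N
    change ∑ k, ∑ a, ∑ b, E k a b (M k b a + N k b a) =
      (∑ k, ∑ a, ∑ b, E k a b (M k b a)) + ∑ k, ∑ a, ∑ b, E k a b (N k b a)
    simp only [hEadd, Finset.sum_add_distrib]
  let Φ : (∀ k, Matrix (A k) (A k) ℂ) →+* End P :=
    { toFun := φ, map_one' := hφ1, map_mul' := hφmul, map_zero' := hφ0, map_add' := hφadd }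
  -- A product of matrix algebras is semisimple and so is every image of it; injectivity of `Φ` is
  -- not needed. A preimage of r collects the scalars by which r maps one copy of `T k` to another.
  refine Φ.isSemisimpleRing_of_surjective fun r => ?_
  choose M hM using fun k => fun b a => hρ k (α ⟨k, a⟩ ≫ (r : P ⟶ P) ≫ β ⟨k, b⟩ : T k ⟶ T k)
  refine ⟨fun k => Matrix.of (M k), ?_⟩
  change ∑ k, ∑ a, ∑ b, β ⟨k, a⟩ ≫ (ρ k (M k b a) : T k ⟶ T k) ≫ α ⟨k, b⟩ = (r : P ⟶ P)
  have hr : (r : P ⟶ P) = (∑ x, β x ≫ α x) ≫ (r : P ⟶ P) ≫ ∑ y, β y ≫ α y := by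
    rw [h3, Category.id_comp, Category.comp_id]
  conv_rhs => rw [hr]
  rw [Preadditive.sum_comp, Fintype.sum_sigma]
  refine Finset.sum_congr rfl fun k _ => Finset.sum_congr rfl fun a _ => ?_
  rw [Preadditive.comp_sum, Preadditive.comp_sum, Fintype.sum_sigma, Finset.sum_eq_single k]
  · refine Finset.sum_congr rfl fun b _ => ?_
    rw [hM]
    simp only [Category.assoc]
  · intro l _ hl
    refine Finset.sum_eq_zero fun b _ => ?_
    -- Blocks between different `T k` and `T l` vanish by orthogonality.
    have h := hT k l hl.symm (α ⟨k, a⟩ ≫ (r : P ⟶ P) ≫ β ⟨l, b⟩)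
    have h' : (β ⟨k, a⟩ ≫ α ⟨k, a⟩) ≫ (r : P ⟶ P) ≫ β ⟨l, b⟩ ≫ α ⟨l, b⟩ =
        β ⟨k, a⟩ ≫ (α ⟨k, a⟩ ≫ (r : P ⟶ P) ≫ β ⟨l, b⟩) ≫ α ⟨l, b⟩ := by
      simp only [Category.assoc]
    rw [h', h, Limits.zero_comp, Limits.comp_zero]
  · intro h
    exact absurd (Finset.mem_univ _) h

/-- A fully faithful additive functor identifies the endomorphism rings of formal direct sums. -/
noncomputable def endMatEquiv (F : C ⥤ D) [F.Additive] [F.Full] [F.Faithful] {ι : Type}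
    [Fintype ι] (X : ι → C) : End (Mat_.mk ι X) ≃+* End (Mat_.mk ι fun i => F.obj (X i)) where
  toFun r := fun i j => F.map ((r : Mat_.Hom (Mat_.mk ι X) (Mat_.mk ι X)) i j)
  invFun s := fun i j => F.preimage
    ((s : Mat_.Hom (Mat_.mk ι fun i => F.obj (X i)) (Mat_.mk ι fun i => F.obj (X i))) i j)
  left_inv r := Mat_.hom_ext _ _ fun i j => F.preimage_map _
  right_inv r := Mat_.hom_ext _ _ fun i j => F.map_preimage _
  map_mul' r s := Mat_.hom_ext _ _ fun i j => by
    refine (F.map_sum _ _).trans ?_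
    exact Finset.sum_congr rfl fun k _ => F.map_comp _ _
  map_add' r s := Mat_.hom_ext _ _ fun i j => F.map_add

end DirectSums

/-! ### Splitting an object into orthogonal simple objects. -/

section Linear

variable {C : Type*} [Category C] [Preadditive C] [Linear ℂ C]

/-- The scalars in the endomorphism ring of an object. -/
noncomputable def scalarEnd (X : C) : ℂ →+* End X := algebraMap ℂ (End X)

theorem scalarEnd_apply (X : C) (c : ℂ) : (scalarEnd X c : X ⟶ X) = c • 𝟙 X :=
  Algebra.algebraMap_eq_smul_one c

/-- The endomorphisms of a simple object. -/
noncomputable def IsSimpleObject.endEquiv {X : C} (h : IsSimpleObject X) : ℂ ≃ₗ[ℂ] (X ⟶ X) :=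
  LinearEquiv.ofBijective (LinearMap.toSpanSingleton ℂ (X ⟶ X) (𝟙 X))
    ⟨fun _ _ hxy => smul_left_injective ℂ h.1 hxy, fun g => (h.2 g).imp fun _ hc => hc.symm⟩

theorem IsSimpleObject.endEquiv_symm_smul {X : C} (h : IsSimpleObject X) (g : X ⟶ X) :
    h.endEquiv.symm g • 𝟙 X = g := h.endEquiv.apply_symm_apply g

/-- If the identity of `P` is a combination of morphisms factoring through pairwise orthogonal
simple objects, then `P` is a direct sum of them. -/
theorem exists_isDirectSum {κ : Type} [Fintype κ] (T : κ → C) (hS : ∀ k, IsSimpleObject (T k))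
    (hT : ∀ k l, k ≠ l → ∀ g : T k ⟶ T l, g = 0) (P : C) [∀ k, Module.Finite ℂ (T k ⟶ P)]
    (hP : 𝟙 P ∈ Submodule.span ℂ {f | ∃ (k : κ) (u : P ⟶ T k) (v : T k ⟶ P), f = u ≫ v}) :
    ∃ m : κ → ℕ, IsDirectSum P fun x : Σ k, Fin (m k) => T x.1 := by
  classical
  -- The composition pairing, with the endomorphisms of `T k` identified with ℂ.
  let B : ∀ k, (T k ⟶ P) →ₗ[ℂ] (P ⟶ T k) →ₗ[ℂ] ℂ := fun k =>
    (Linear.comp (T k) P (T k) : (T k ⟶ P) →ₗ[ℂ] (P ⟶ T k) →ₗ[ℂ] (T k ⟶ T k)).compr₂ (hS k).endEquiv.symm.toLinearMap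
  have hB : ∀ k (v : T k ⟶ P) (w : P ⟶ T k), v ≫ w = B k v w • 𝟙 (T k) := fun k v w =>
    ((hS k).endEquiv_symm_smul (v ≫ w)).symm
  have hinj : ∀ k, Function.Injective (B k) := by
    intro k
    rw [← LinearMap.ker_eq_bot, LinearMap.ker_eq_bot']
    intro v hv
    -- A morphism v in the left kernel is killed by everything that factors through the simple
    -- objects, in particular by the identity of `P`.
    have key : ∀ f ∈ Submodule.span ℂ
        {f | ∃ (k : κ) (u : P ⟶ T k) (v : T k ⟶ P), f = u ≫ v}, v ≫ f = 0 := by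
      intro f hf
      induction hf using Submodule.span_induction with
      | zero => rw [Limits.comp_zero]
      | add f g _ _ hf hg => rw [Preadditive.comp_add, hf, hg, add_zero]
      | smul x f _ hf => rw [Linear.comp_smul, hf, smul_zero]
      | mem f hf =>
        obtain ⟨l, u, w, rfl⟩ := hf
        rw [← Category.assoc]
        by_cases hkl : k = l
        · subst hkl
          rw [hB, hv, LinearMap.zero_apply, zero_smul, Limits.zero_comp]
        · rw [hT k l hkl (v ≫ u), Limits.zero_comp]
    rw [← Category.comp_id v, key _ hP]
  -- In finite dimension every linear form on Hom(T k, P) is therefore pairing with some morphism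
  -- from `P`. The coordinate forms of a basis give projections dual to the basis elements as
  -- inclusions.
  have hsurj : ∀ k, Function.Surjective (B k).flip := fun k =>
    LinearMap.flip_surjective_iff₁.2 (hinj k)
  let b := fun k => Module.finBasis ℂ (T k ⟶ P)
  choose w hw using fun k a => hsurj k ((b k).coord a)
  have hw' : ∀ k a a', b k a ≫ w k a' = if a = a' then 𝟙 (T k) else 0 := by
    intro k a a'
    have h : B k (b k a) (w k a') = (b k).coord a' (b k a) := LinearMap.congr_fun (hw k a') _
    rw [hB, h, Module.Basis.coord_apply, Module.Basis.repr_self, Finsupp.single_apply]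
    split_ifs
    · rw [one_smul]
    · rw [zero_smul]
  refine ⟨fun k => Module.finrank ℂ (T k ⟶ P), fun x => b x.1 x.2, fun x => w x.1 x.2, ?_, ?_, ?_⟩
  · rintro ⟨k, a⟩
    rw [hw', if_pos rfl]
  · rintro ⟨k, a⟩ ⟨l, a'⟩ h
    by_cases hkl : k = l
    · subst hkl
      dsimp only
      rw [hw', if_neg fun e => h (by rw [e])]
    · exact hT k l hkl _
  -- The idempotent `e` fixes the basis, hence every morphism from a `T k`, hence everything
  -- factoring through some `T k`, hence the identity.
  · set e := ∑ x : Σ k, Fin (Module.finrank ℂ (T k ⟶ P)), w x.1 x.2 ≫ b x.1 x.2 with he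
    have h1 : ∀ k a, b k a ≫ e = b k a := by
      intro k a
      rw [he, Preadditive.comp_sum, Finset.sum_eq_single ⟨k, a⟩, ← Category.assoc, hw', if_pos rfl,
        Category.id_comp]
      · rintro ⟨l, a'⟩ - h
        rw [← Category.assoc]
        by_cases hkl : k = l
        · subst hkl
          dsimp only
          rw [hw', if_neg fun e => h (by rw [e]), Limits.zero_comp]
        · rw [hT k l hkl (b k a ≫ w l a'), Limits.zero_comp]
      · intro h
        exact absurd (Finset.mem_univ _) h
    have h2 : ∀ k (v : T k ⟶ P), v ≫ e = v := by
      intro k v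
      have h : Linear.rightComp ℂ (T k) e = LinearMap.id := (b k).ext fun a => h1 k a
      exact LinearMap.congr_fun h v
    have h3 : ∀ f ∈ Submodule.span ℂ
        {f | ∃ (k : κ) (u : P ⟶ T k) (v : T k ⟶ P), f = u ≫ v}, f ≫ e = f := by
      intro f hf
      induction hf using Submodule.span_induction with
      | zero => rw [Limits.zero_comp]
      | add f g _ _ hf hg => rw [Preadditive.add_comp, hf, hg]
      | smul x f _ hf => rw [Linear.smul_comp, hf]
      | mem f hf =>
        obtain ⟨l, u, w, rfl⟩ := hf
        rw [Category.assoc, h2]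
    rw [← Category.id_comp e, h3 _ hP]

end Linear

section Karoubi

variable {d q : ℂ} {n k : ℕ}

/-! ### Simple objects of the idempotent completion -/

/-- The morphisms between two objects of the idempotent completion inside those between the
underlying objects. -/
noncomputable def karoubiHomLinear (P Q : Idempotents.Karoubi (TL d)) :
    (P ⟶ Q) →ₗ[ℂ] (P.X ⟶ Q.X) where
  toFun f := f.f
  map_add' _ _ := rfl
  map_smul' _ _ := rfl

instance (P Q : Idempotents.Karoubi (TL d)) : Module.Finite ℂ (P ⟶ Q) :=
  Module.Finite.of_injective (karoubiHomLinear P Q) fun _ _ h => Idempotents.Karoubi.Hom.ext h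

/-- Compressing an endomorphism to a direct factor. -/
noncomputable def compress (P : Idempotents.Karoubi (TL d)) : (P.X ⟶ P.X) →ₗ[ℂ] (P ⟶ P) where
  toFun f := ⟨P.p ≫ f ≫ P.p, by simp⟩
  map_add' f g := Idempotents.Karoubi.Hom.ext (by
    change P.p ≫ (f + g) ≫ P.p = P.p ≫ f ≫ P.p + P.p ≫ g ≫ P.p
    rw [Preadditive.add_comp, Preadditive.comp_add])
  map_smul' c f := Idempotents.Karoubi.Hom.ext (by
    change P.p ≫ (c • f) ≫ P.p = c • (P.p ≫ f ≫ P.p)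
    rw [Linear.smul_comp, Linear.comp_smul])

theorem compress_id (P : Idempotents.Karoubi (TL d)) : compress P (𝟙 P.X) = 𝟙 P :=
  Idempotents.Karoubi.Hom.ext ((congrArg (P.p ≫ ·) (Category.id_comp _)).trans P.idem)

/-- The direct factor of `X^{⊗ k}` given by the idempotent `f k`. -/
noncomputable abbrev imageObj (f : ∀ k, pow d k ⟶ pow d k) (hf : ∀ k, f k ≫ f k = f k) (k : ℕ) :
    Idempotents.Karoubi (TL d) := ⟨pow d k, f k, hf k⟩

variable {f : ∀ k, pow d k ⟶ pow d k}

/-- Here and below f is a family of idempotents that agrees with `jonesWenzl` only up to n, since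
beyond n a quantum integer may vanish and idempotency is not available. -/
theorem isSimpleObject_imageObj (hq : q ≠ 0) (hd : d = q + q⁻¹)
    (hn : ∀ k : ℕ, 1 ≤ k → k ≤ n → quantumInt q k ≠ 0) (hf : ∀ k, f k ≫ f k = f k)
    (hfJ : ∀ k ≤ n, f k = jonesWenzl d q k) (hk : k ≤ n) : IsSimpleObject (imageObj f hf k) := by
  refine ⟨fun h0 => jonesWenzl_ne_zero (d := d) (q := q) k
    ((hfJ k hk).symm.trans (congrArg Idempotents.Karoubi.Hom.f h0)), fun g => ?_⟩
  obtain ⟨c, hc⟩ := exists_comp_jonesWenzl_eq hq hd hn hk g.f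
  rw [← hfJ k hk] at hc
  exact ⟨c, Idempotents.Karoubi.Hom.ext ((Idempotents.Karoubi.comp_p g).symm.trans hc)⟩

theorem hom_imageObj_eq_zero (hq : q ≠ 0) (hd : d = q + q⁻¹)
    (hn : ∀ k : ℕ, 1 ≤ k → k ≤ n → quantumInt q k ≠ 0) (hf : ∀ k, f k ≫ f k = f k)
    (hfJ : ∀ k ≤ n, f k = jonesWenzl d q k) {j k : ℕ} (hj : j ≤ n) (hk : k ≤ n)
    (hjk : j ≠ k) (g : imageObj f hf j ⟶ imageObj f hf k) : g = 0 := by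
  refine Idempotents.Karoubi.Hom.ext ?_
  rcases lt_or_gt_of_ne hjk with hlt | hlt
  · have h := comp_jonesWenzl_of_lt hq hd hn hlt hk (g.f : pow d j ⟶ pow d k)
    rw [← hfJ k hk] at h
    exact (Idempotents.Karoubi.comp_p g).symm.trans h
  · have h := jonesWenzl_comp_of_lt hq hd hn hlt hj (g.f : pow d j ⟶ pow d k)
    rw [← hfJ j hj] at h
    exact (Idempotents.Karoubi.p_comp g).symm.trans h

/-- The identity of P is the compression of the identity of the underlying tensor power, and
compression carries morphisms through f_j to morphisms through X_j. Hence `exists_isDirectSum`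
applies. -/
theorem exists_isDirectSum_imageObj (hq : q ≠ 0) (hd : d = q + q⁻¹)
    (hn : ∀ k : ℕ, 1 ≤ k → k ≤ n → quantumInt q k ≠ 0) (hf : ∀ k, f k ≫ f k = f k)
    (hfJ : ∀ k ≤ n, f k = jonesWenzl d q k) (P : Idempotents.Karoubi (TL d)) (hP : P.X.size ≤ n) :
    ∃ m : Fin (n + 1) → ℕ, IsDirectSum P
      fun x : Σ k : Fin (n + 1), Fin (m k) => imageObj f hf (x.1 : ℕ) := by
  refine exists_isDirectSum (fun k : Fin (n + 1) => imageObj f hf (k : ℕ))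
    (fun k => isSimpleObject_imageObj hq hd hn hf hfJ (Nat.lt_succ_iff.1 k.2))
    (fun k l hkl => hom_imageObj_eq_zero hq hd hn hf hfJ (Nat.lt_succ_iff.1 k.2)
      (Nat.lt_succ_iff.1 l.2) fun e => hkl (Fin.ext e)) P ?_
  rw [← compress_id]
  obtain ⟨⟨m⟩, p, hp⟩ := P
  suffices h : jonesWenzlIdeal d q m ≤ Submodule.comap (compress ⟨⟨m⟩, p, hp⟩)
      (Submodule.span ℂ {g | ∃ (k : Fin (n + 1)) (u : _ ⟶ imageObj f hf k)
        (v : imageObj f hf k ⟶ _), g = u ≫ v}) from h (id_mem_jonesWenzlIdeal hq hd hn m hP)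
  refine Submodule.span_le.2 ?_
  rintro _ ⟨j, hj, u, v, rfl⟩
  rw [← hfJ j (hj.trans hP)]
  -- The idempotent `f j` is doubled, so that each half is a morphism of the idempotent completion.
  refine Submodule.subset_span ⟨⟨j, Nat.lt_succ_iff.2 (hj.trans hP)⟩,
    ⟨p ≫ u ≫ f j, ?_⟩, ⟨f j ≫ v ≫ p, ?_⟩, ?_⟩
  · change p ≫ (p ≫ u ≫ f j) ≫ f j = _
    simp only [Category.assoc, hf j]
    rw [← Category.assoc p p, hp]
  · change f j ≫ (f j ≫ v ≫ p) ≫ p = _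
    simp only [Category.assoc, hp]
    rw [← Category.assoc (f j), hf]
  · refine Idempotents.Karoubi.Hom.ext ?_
    change p ≫ (u ≫ f j ≫ v) ≫ p = (p ≫ u ≫ f j) ≫ f j ≫ v ≫ p
    simp only [Category.assoc]
    rw [← Category.assoc (f j) (f j), hf]

theorem exists_fin_isDirectSum_imageObj (hq : q ≠ 0) (hd : d = q + q⁻¹)
    (hn : ∀ k : ℕ, 1 ≤ k → k ≤ n → quantumInt q k ≠ 0) (hf : ∀ k, f k ≫ f k = f k)
    (hfJ : ∀ k ≤ n, f k = jonesWenzl d q k) (P : Idempotents.Karoubi (TL d)) (hP : P.X.size ≤ n) :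
    ∃ (r : ℕ) (c : Fin r → ℕ), (∀ i, c i ≤ n) ∧ IsDirectSum P fun i => imageObj f hf (c i) := by
  obtain ⟨m, hm⟩ := exists_isDirectSum_imageObj hq hd hn hf hfJ P hP
  exact ⟨_, fun i => ((Fintype.equivFin (Σ k : Fin (n + 1), Fin (m k))).symm i).1,
    fun i => Nat.lt_succ_iff.1 (Fin.is_lt _), hm.reindex (Fintype.equivFin _).symm⟩

/-! ### Decomposition of X_k ⊗ X and of the tensor powers of X. -/

theorem isDirectSum_pair {C : Type*} [Category C] [Preadditive C] {X Y Z : C} (α₀ : Y ⟶ X)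
    (α₁ : Z ⟶ X) (β₀ : X ⟶ Y) (β₁ : X ⟶ Z) (h₀₀ : α₀ ≫ β₀ = 𝟙 Y) (h₁₁ : α₁ ≫ β₁ = 𝟙 Z)
    (h₀₁ : α₀ ≫ β₁ = 0) (h₁₀ : α₁ ≫ β₀ = 0) (h : β₀ ≫ α₀ + β₁ ≫ α₁ = 𝟙 X) :
    IsDirectSum X ![Y, Z] := by
  refine ⟨fun i => match i with | 0 => α₀ | 1 => α₁, fun i => match i with | 0 => β₀ | 1 => β₁,
    fun i => match i with | 0 => h₀₀ | 1 => h₁₁, fun i j hij => ?_, ?_⟩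
  · match i, j with
    | 0, 0 => exact absurd rfl hij
    | 0, 1 => exact h₀₁
    | 1, 0 => exact h₁₀
    | 1, 1 => exact absurd rfl hij
  · rw [Fin.sum_univ_two]
    exact h

theorem isDirectSum_tensor (hq : q ≠ 0) (hd : d = q + q⁻¹)
    (hn : ∀ k : ℕ, 1 ≤ k → k ≤ n → quantumInt q k ≠ 0) (hf : ∀ k, f k ≫ f k = f k)
    (hfJ : ∀ k ≤ n, f k = jonesWenzl d q k) (hk : k + 2 ≤ n) :
    IsDirectSum (karoubiTensor (imageObj f hf (k + 1)) (powK d 1))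
      ![imageObj f hf k, imageObj f hf (k + 2)] := by
  obtain ⟨h3, h4, h5, h6⟩ := jonesWenzl_splitting hq hd hn k hk
  have hpt := (jonesWenzl_aux hq hd hn k (by omega)).2.2.2
  rw [partialTrace] at hpt
  obtain ⟨hFP, hPF, -, -⟩ := jonesWenzl_aux hq hd hn (k + 1) hk
  have hsum := strand_jonesWenzl hq hd hn hk
  have hk1 := hn (k + 1) (by omega) (by omega)
  have hk2 := hn (k + 2) (by omega) (by omega)
  change strand (jonesWenzl d q (k + 1)) ≫ jonesWenzl d q (k + 2) = jonesWenzl d q (k + 2) at hFP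
  change jonesWenzl d q (k + 2) ≫ strand (jonesWenzl d q (k + 1)) = jonesWenzl d q (k + 2) at hPF
  rw [← hfJ k (by omega), ← hfJ (k + 1) (by omega)] at h3 h4 hpt hsum
  rw [← hfJ (k + 1) (by omega), ← hfJ (k + 2) hk] at hFP hPF
  rw [← hfJ (k + 2) hk] at h5 h6 hsum
  have hF : strand (f (k + 1)) ≫ strand (f (k + 1)) = strand (f (k + 1)) := by
    rw [← strand_comp, hf]
  set F := strand (f (k + 1)) with hFdef
  set c := quantumInt q (k + 1) / quantumInt q (k + 2) with hc
  have hct : c * (quantumInt q (k + 2) / quantumInt q (k + 1)) = 1 := by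
    rw [hc]
    field_simp
  -- X_k is embedded by the cup and projected to by the cap, with f_{k+1} ⊗ 1 absorbing on the other
  -- side. The factor c normalises their composite, which is the partial trace of f_{k+1}. On
  -- X_{k+2} both maps are f_{k+2}.
  refine isDirectSum_pair ⟨cupLast d k ≫ F, ?_⟩ ⟨f (k + 2), ?_⟩
    ⟨c • (F ≫ capLast d k), ?_⟩ ⟨f (k + 2), ?_⟩ ?_ ?_ ?_ ?_ ?_
  · change f k ≫ (cupLast d k ≫ F) ≫ F = cupLast d k ≫ F
    rw [Category.assoc, hF, h4]
  · change f (k + 2) ≫ f (k + 2) ≫ F = f (k + 2)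
    rw [hPF, hf]
  · change F ≫ (c • (F ≫ capLast d k)) ≫ f k = c • (F ≫ capLast d k)
    rw [Linear.smul_comp, Linear.comp_smul, Category.assoc, h3, ← Category.assoc, hF]
  · change F ≫ f (k + 2) ≫ f (k + 2) = f (k + 2)
    rw [hf, hFP]
  · refine Idempotents.Karoubi.Hom.ext ?_
    change (cupLast d k ≫ F) ≫ (c • (F ≫ capLast d k)) = f k
    rw [Linear.comp_smul, Category.assoc, ← Category.assoc F, hF, hpt, smul_smul, hct, one_smul]
  · exact Idempotents.Karoubi.Hom.ext (hf (k + 2))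
  · refine Idempotents.Karoubi.Hom.ext ?_
    change (cupLast d k ≫ F) ≫ f (k + 2) = 0
    rw [Category.assoc, hFP, h6]
  · refine Idempotents.Karoubi.Hom.ext ?_
    change f (k + 2) ≫ (c • (F ≫ capLast d k)) = 0
    rw [Linear.comp_smul, ← Category.assoc, hPF, h5, smul_zero]
  · refine Idempotents.Karoubi.Hom.ext ?_
    change (c • (F ≫ capLast d k)) ≫ cupLast d k ≫ F + f (k + 2) ≫ f (k + 2) = F
    rw [h4] at hsum
    rw [hf, Linear.smul_comp]
    exact (add_comm _ _).trans hsum.symm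

theorem exists_isDirectSumVia_cons {C : Type*} [Category C] [Preadditive C] {S : ℕ → C} {X Q : C}
    {k r : ℕ} {c : Fin r → ℕ} {α : ∀ i, S (c i) ⟶ Q} {β : ∀ i, Q ⟶ S (c i)}
    (h : IsDirectSumVia Q (fun i => S (c i)) α β) {iQ : Q ⟶ X} {pQ : X ⟶ Q} {iS : S k ⟶ X}
    {pS : X ⟶ S k} (hQQ : iQ ≫ pQ = 𝟙 Q) (hSS : iS ≫ pS = 𝟙 (S k)) (hQS : iQ ≫ pS = 0)
    (hSQ : iS ≫ pQ = 0) (hsum : pS ≫ iS + pQ ≫ iQ = 𝟙 X) :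
    ∃ (α' : ∀ i, S ((Fin.cons k c : Fin (r + 1) → ℕ) i) ⟶ X)
      (β' : ∀ i, X ⟶ S ((Fin.cons k c : Fin (r + 1) → ℕ) i)),
      IsDirectSumVia X (fun i => S ((Fin.cons k c : Fin (r + 1) → ℕ) i)) α' β' ∧
        β' 0 ≫ α' 0 = pS ≫ iS := by
  obtain ⟨h1, h2, h3⟩ := h
  let c' : Fin (r + 1) → ℕ := Fin.cons k c
  let α' : ∀ i, S (c' i) ⟶ X := Fin.cases iS fun i => α i ≫ iQ
  let β' : ∀ i, X ⟶ S (c' i) := Fin.cases pS fun i => pQ ≫ β i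
  refine ⟨α', β', ⟨?_, ?_, ?_⟩, rfl⟩
  · refine Fin.cases hSS fun i => ?_
    change (α i ≫ iQ) ≫ pQ ≫ β i = 𝟙 _
    rw [Category.assoc, ← Category.assoc iQ, hQQ, Category.id_comp, h1]
  · refine Fin.cases (Fin.cases (fun h => absurd rfl h) fun j _ => ?_)
      fun i => Fin.cases (fun _ => ?_) fun j hij => ?_
    · change iS ≫ pQ ≫ β j = 0
      rw [← Category.assoc, hSQ, Limits.zero_comp]
    · change (α i ≫ iQ) ≫ pS = 0
      rw [Category.assoc, hQS, Limits.comp_zero]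
    · change (α i ≫ iQ) ≫ pQ ≫ β j = 0
      rw [Category.assoc, ← Category.assoc iQ, hQQ, Category.id_comp,
        h2 i j fun e => hij (congrArg Fin.succ e)]
  · rw [Fin.sum_univ_succ, ← hsum]
    refine congrArg (pS ≫ iS + ·) ?_
    change ∑ i, (pQ ≫ β i) ≫ α i ≫ iQ = pQ ≫ iQ
    have h : ∀ i, (pQ ≫ β i) ≫ α i ≫ iQ = pQ ≫ (β i ≫ α i) ≫ iQ := fun i => by
      simp only [Category.assoc]
    simp only [h]
    rw [← Preadditive.comp_sum, ← Preadditive.sum_comp, h3, Category.id_comp]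

/-- The summand X_k is split off by f_k itself, and the complement Q, the image of 1 - f_k, is
decomposed by the general result. Its summands all have smaller index because Q has no morphisms to
X_l for l ≥ k. -/
theorem exists_decomposition_powK (hq : q ≠ 0) (hd : d = q + q⁻¹)
    (hn : ∀ k : ℕ, 1 ≤ k → k ≤ n → quantumInt q k ≠ 0) (hf : ∀ k, f k ≫ f k = f k)
    (hfJ : ∀ k ≤ n, f k = jonesWenzl d q k) (hk : k ≤ n) :
    ∃ (r : ℕ) (c : Fin r → ℕ) (α : ∀ i, imageObj f hf (c i) ⟶ powK d k)
      (β : ∀ i, powK d k ⟶ imageObj f hf (c i)) (i₀ : Fin r),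
      IsDirectSumVia (powK d k) (fun i => imageObj f hf (c i)) α β ∧
        (∀ i, c i ≤ k) ∧ (∀ i, c i = k ↔ i = i₀) ∧ (β i₀ ≫ α i₀).f = f k := by
  have hp1 : (𝟙 (pow d k) - f k) ≫ f k = 0 := by
    rw [Preadditive.sub_comp, Category.id_comp, hf, sub_self]
  have hp2 : f k ≫ (𝟙 (pow d k) - f k) = 0 := by
    rw [Preadditive.comp_sub, Category.comp_id, hf, sub_self]
  have hp3 : (𝟙 (pow d k) - f k) ≫ (𝟙 (pow d k) - f k) = 𝟙 (pow d k) - f k := by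
    rw [Preadditive.comp_sub, hp1, sub_zero, Category.comp_id]
  let Q : Idempotents.Karoubi (TL d) := ⟨pow d k, 𝟙 (pow d k) - f k, hp3⟩
  obtain ⟨r, c, hc, α, β, h⟩ := exists_fin_isDirectSum_imageObj hq hd hn hf hfJ Q hk
  -- For l > k every morphism from X^k is killed by f_l. For l = k it becomes a multiple of f_k,
  -- which is killed by 1 - f_k.
  have hzero : ∀ l, k ≤ l → l ≤ n → ∀ b : Q ⟶ imageObj f hf l, b = 0 := by
    intro l hl hln b
    refine Idempotents.Karoubi.Hom.ext (b.comm.symm.trans ?_)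
    change (𝟙 (pow d k) - f k) ≫ (b.f : pow d k ⟶ pow d l) ≫ f l = 0
    rcases hl.lt_or_eq with hlt | rfl
    · rw [hfJ l hln, comp_jonesWenzl_of_lt hq hd hn hlt hln, Limits.comp_zero]
    · obtain ⟨x, hx⟩ := exists_comp_jonesWenzl_eq hq hd hn hk b.f
      rw [← hfJ k hk] at hx
      rw [hx, Linear.comp_smul, hp1, smul_zero]
  have hlt : ∀ i, c i < k := by
    intro i
    by_contra hki
    have h := h.1 i
    rw [hzero (c i) (not_lt.1 hki) (hc i) (β i), Limits.comp_zero] at h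
    exact (isSimpleObject_imageObj hq hd hn hf hfJ (hc i)).1 h.symm
  let iQ : Q ⟶ powK d k := ⟨𝟙 (pow d k) - f k, by
    change (𝟙 (pow d k) - f k) ≫ (𝟙 (pow d k) - f k) ≫ 𝟙 (pow d k) = _
    rw [Category.comp_id, hp3]⟩
  let pQ : powK d k ⟶ Q := ⟨𝟙 (pow d k) - f k, by
    change 𝟙 (pow d k) ≫ (𝟙 (pow d k) - f k) ≫ (𝟙 (pow d k) - f k) = _
    rw [Category.id_comp, hp3]⟩
  let iS : imageObj f hf k ⟶ powK d k := ⟨f k, by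
    change f k ≫ f k ≫ 𝟙 (pow d k) = _
    rw [Category.comp_id, hf]⟩
  let pS : powK d k ⟶ imageObj f hf k := ⟨f k, by
    change 𝟙 (pow d k) ≫ f k ≫ f k = _
    rw [Category.id_comp, hf]⟩
  have hQQ : iQ ≫ pQ = 𝟙 Q := Idempotents.Karoubi.Hom.ext hp3
  have hSS : iS ≫ pS = 𝟙 (imageObj f hf k) := Idempotents.Karoubi.Hom.ext (hf k)
  have hQS : iQ ≫ pS = 0 := Idempotents.Karoubi.Hom.ext hp1
  have hSQ : iS ≫ pQ = 0 := Idempotents.Karoubi.Hom.ext hp2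
  have hsum : pS ≫ iS + pQ ≫ iQ = 𝟙 (powK d k) := by
    refine Idempotents.Karoubi.Hom.ext ?_
    change f k ≫ f k + (𝟙 (pow d k) - f k) ≫ (𝟙 (pow d k) - f k) = 𝟙 (pow d k)
    rw [hf, hp3, add_sub_cancel]
  obtain ⟨α', β', h', h0⟩ := exists_isDirectSumVia_cons (S := imageObj f hf) h hQQ hSS hQS hSQ hsum
  refine ⟨r + 1, Fin.cons k c, α', β', 0, h', Fin.cases le_rfl fun i => (hlt i).le, ?_, ?_⟩
  · refine Fin.cases ⟨fun _ => rfl, fun _ => rfl⟩ fun i => ⟨fun h => ?_, fun h => ?_⟩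
    · exact absurd h (hlt i).ne
    · exact absurd h (Fin.succ_ne_zero i)
  · rw [h0]
    exact hf k

/-! ### Essential semisimplicity. -/

/-- The action of an additive functor on an endomorphism ring. -/
noncomputable def mapEndRingHom {C D : Type*} [Category C] [Category D] [Preadditive C]
    [Preadditive D] (F : C ⥤ D) [F.Additive] (X : C) : End X →+* End (F.obj X) where
  toFun g := F.map g
  map_one' := F.map_id X
  map_mul' g h := F.map_comp h g
  map_zero' := F.map_zero X X
  map_add' _ _ := F.map_add

/-- Summands exist only after idempotent completion, and finite sums only among formal matrices. The
endomorphism ring is therefore transported along a fully faithful functor to `Mat_` of the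
completion, where the formal sum splits into copies of the X_k. -/
theorem isEssentiallySemisimple_generated (hq : q ≠ 0) (hd : d = q + q⁻¹)
    (hn : ∀ k : ℕ, 1 ≤ k → k ≤ n → quantumInt q k ≠ 0) (hf : ∀ k, f k ≫ f k = f k)
    (hfJ : ∀ k ≤ n, f k = jonesWenzl d q k) : IsEssentiallySemisimple (Generated d n) := by
  refine ⟨fun X Y => ?_, fun ι _ X => ?_⟩
  · exact Module.Finite.equiv (InducedCategory.homLinearEquiv (R := ℂ) (X := X) (Y := Y)).symm
  let F : Generated d n ⥤ Idempotents.Karoubi (TL d) :=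
    ObjectProperty.ι _ ⋙ Idempotents.toKaroubi (TL d)
  let G := Mat_.embedding (Idempotents.Karoubi (TL d))
  let T : Fin (n + 1) → Idempotents.Karoubi (TL d) := fun k => imageObj f hf (k : ℕ)
  have hS : ∀ k, IsSimpleObject (T k) := fun k =>
    isSimpleObject_imageObj hq hd hn hf hfJ (Nat.lt_succ_iff.1 k.2)
  choose m hm using fun i => exists_isDirectSum_imageObj hq hd hn hf hfJ (F.obj (X i)) (X i).2
  have h1 := (isDirectSum_mat (Mat_.mk ι fun i => F.obj (X i))).sigma fun i => (hm i).map G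
  -- Regroups the summands by their isomorphism type X_k instead of by the member of the family they
  -- come from.
  let e : (Σ k : Fin (n + 1), Σ i, Fin (m i k)) ≃ Σ i, Σ k : Fin (n + 1), Fin (m i k) :=
    { toFun := fun x => ⟨x.2.1, x.1, x.2.2⟩
      invFun := fun x => ⟨x.2.1, x.1, x.2.2⟩
      left_inv := fun _ => rfl
      right_inv := fun _ => rfl }
  have h2 := isSemisimpleRing_end (fun k => G.obj (T k))
    (fun k => (mapEndRingHom G (T k)).comp (scalarEnd (T k)))
    (fun k => by
      intro g
      obtain ⟨g, rfl⟩ := G.map_surjective g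
      obtain ⟨c, hc⟩ := (hS k).2 g
      refine ⟨c, ?_⟩
      change G.map (scalarEnd (T k) c : T k ⟶ T k) = G.map g
      rw [scalarEnd_apply, ← hc])
    (fun k l hkl g => by
      obtain ⟨g, rfl⟩ := G.map_surjective g
      have : g = 0 := hom_imageObj_eq_zero hq hd hn hf hfJ (Nat.lt_succ_iff.1 k.2)
        (Nat.lt_succ_iff.1 l.2) (fun e => hkl (Fin.ext e)) g
      rw [this, G.map_zero])
    (h1.reindex e)
  exact (endMatEquiv F X).isSemisimpleRing_iff.2 h2

end Karoubi

end TemperleyLieb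

open TemperleyLieb

theorem mainTheorem1 (d q : ℂ) (hq : q ≠ 0) (hd : d = q + q⁻¹) (n : ℕ)
    (hn : ∀ k : ℕ, 1 ≤ k → k ≤ n → quantumInt q k ≠ 0) :
    IsEssentiallySemisimple (Generated d n) ∧
    ∃ (f : ∀ k : ℕ, pow d k ⟶ pow d k) (hf : ∀ k, f k ≫ f k = f k),
      let S : ℕ → Idempotents.Karoubi (TL d) := fun k => ⟨pow d k, f k, hf k⟩
      f 0 = 𝟙 (pow d 0) ∧ f 1 = 𝟙 (pow d 1) ∧
      (∀ j : ℕ, j + 1 < n →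
        f (j + 2) = addStrand (f (j + 1)) -
          (quantumInt q (j + 1) / quantumInt q (j + 2)) •
            (addStrand (f (j + 1)) ≫ elementary d j ≫
              addStrand (f (j + 1)))) ∧
      (∀ k ≤ n, markovTrace d k (f k) = quantumInt q (k + 1)) ∧
      (∀ k ≤ n, IsSimpleObject (S k)) ∧
      (∀ j ≤ n, ∀ k ≤ n, j ≠ k → ∀ g : S j ⟶ S k, g = 0) ∧
      (∀ P : Idempotents.Karoubi (TL d), P.X.size ≤ n →
        ∃ (r : ℕ) (c : Fin r → ℕ), (∀ i, c i ≤ n) ∧ IsDirectSum P (fun i => S (c i))) ∧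
      (∀ j : ℕ, j + 1 < n → IsDirectSum (karoubiTensor (S (j + 1)) (powK d 1)) ![S j, S (j + 2)]) ∧
      (∀ k ≤ n, ∃ (r : ℕ) (c : Fin r → ℕ)
        (α : ∀ i, S (c i) ⟶ powK d k)
        (β : ∀ i, powK d k ⟶ S (c i)) (i₀ : Fin r),
        IsDirectSumVia (powK d k) (fun i => S (c i)) α β ∧
        (∀ i, c i ≤ k) ∧ (∀ i, c i = k ↔ i = i₀) ∧ (β i₀ ≫ α i₀).f = f k) := by
  -- Beyond n the identity is used as a default value, so that the whole family consists of
  -- idempotents.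
  have hidem : ∀ k, (if k ≤ n then jonesWenzl d q k else 𝟙 (pow d k)) ≫
      (if k ≤ n then jonesWenzl d q k else 𝟙 (pow d k)) =
      if k ≤ n then jonesWenzl d q k else 𝟙 (pow d k) := by
    intro k
    split_ifs with hk
    · exact jonesWenzl_idem hq hd hn k hk
    · exact Category.id_comp _
  obtain ⟨f, hfdef⟩ : ∃ f : ∀ k, pow d k ⟶ pow d k,
    ∀ k, f k = if k ≤ n then jonesWenzl d q k else 𝟙 (pow d k) := ⟨_, fun _ => rfl⟩
  have hf : ∀ k, f k ≫ f k = f k := fun k => by rw [hfdef, hidem]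
  have hfJ : ∀ k ≤ n, f k = jonesWenzl d q k := fun k hk => by rw [hfdef, if_pos hk]
  refine ⟨isEssentiallySemisimple_generated hq hd hn hf hfJ, f, hf, hfJ 0 n.zero_le, ?_, ?_, ?_,
    ?_, ?_, ?_, ?_, ?_⟩
  -- For n = 0 the default value applies at 1, and it is the identity as well.
  · rw [hfdef]
    split_ifs <;> rfl
  · intro j hj
    rw [hfJ (j + 2) hj, hfJ (j + 1) (by omega)]
    -- On endomorphisms `strand` and `addStrand` are definitionally equal, so this is the defining
    -- recursion of `jonesWenzl`.
    rfl
  · intro k hk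
    rw [hfJ k hk, markovTrace_jonesWenzl hq hd hn k hk]
  · exact fun k hk => isSimpleObject_imageObj hq hd hn hf hfJ hk
  · exact fun j hj k hk hjk => hom_imageObj_eq_zero hq hd hn hf hfJ hj hk hjk
  · exact exists_fin_isDirectSum_imageObj hq hd hn hf hfJ
  · exact fun j hj => isDirectSum_tensor hq hd hn hf hfJ hj
  · exact fun k hk => exists_decomposition_powK hq hd hn hf hfJ hk
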